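/- Let $(C,0)$ be a generic irreducible planar curve singularity over $\mathbb{C}$, given by a parametrization $$x(t)=t^{dn},\qquad y(t)=t^{dm}+\lambda t^{dm+1}+(\text{higher order terms in }t),\qquad \lambda\in\mathbb{C}^\times,$$ with $d\ge 1$, $m>n\ge 1$ and $\gcd(n,m)=1$. Let $R=\mathbb{C}[[x(t),y(t)]]\subset \tilde R=\mathbb{C}[[t]]$, $E=\mathbb{C}((t))$, $\delta=\dim_{\mathbb{C}}\tilde R/R$. For $J\subset E$ put $\mathrm{ord}_t(J)=\{\mathrm{ord}_t(z): z\in J\setminus\{0\}\}\subset\mathbb{Z}$, and let $\Gamma=\mathrm{ord}_t(R)$. A $0$-normalized $\Gamma$-semimodule is a subset $\Delta\subset\mathbb{N}$ with $\min\Delta=0$ and $\Gamma+\Delta\subset\Delta$. For such $\Delta$ let * $e(\Delta)=\delta-|\mathbb{N}\setminus\Delta|$; * $A(\Delta)=\{a\in\Delta: a-dn\notin\Delta\}$, the set of $dn$-generators, so that $\Delta=\bigsqcup_{a\in A(\Delta)}(a+dn\mathbb{N})$; * $\mathrm{Gaps}(a)=[a,\infty)\setminus\Delta$ for $a\in\Delta$,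 and $\dim\Delta=\sum_{a\in A(\Delta)}|\mathrm{Gaps}(a)|-\sum_{a\in A(\Delta)}|\mathrm{Gaps}(a+dm)|$. Call $\Delta$ admissible if for every $i\in\{0,\dots,d-1\}$ there is $a\in A(\Delta)$ with $a\equiv i \pmod d$ and $a+dm+1\in\Delta$. For an integer $\tau\ge 0$ let $\mathrm{Hilb}^{[\tau]}(C,0)$ be the (reduced) punctual Hilbert scheme of ideals $I\subset R$ with $\dim_{\mathbb{C}}R/I=\tau$, and let $\mathrm{AJ}_\tau(I)=t^{\tau}I^{-1}$, where $I^{-1}=\{z\in E: zI\subset R\}$. Let $J_\Delta$ be the set of $R$-submodules $M\subset\tilde R$ with $\mathrm{ord}_t(M)=\Delta$, let $\iota_\Delta(M)=t^{e(\Delta)}M$, and let $$H_\Delta^{[\tau]}=\{I\in\mathrm{Hilb}^{[\tau]}(C,0): \mathrm{AJ}_\tau(I)\in\iota_\Delta(J_\Delta)\},$$ with its structure of a reduced subvariety of $\mathrm{Hilb}^{[\tau]}(C,0)$. **Theorem.** Let $\Delta$ be a $0$-normalized $\Gamma$-semimodule and $\tau\ge 0$. Then $H_\Delta^{[\tau]}\neq\emptyset$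 if and only if $\Delta$ is admissible and $\tau_0:=\tau-e(\Delta)\in\Delta$. In this case there is an isomorphism of complex varieties $$H_\Delta^{[\tau]}\cong\mathbb{A}^{\dim\Delta-|\mathrm{Gaps}(\tau_0)|};$$ in particular the exponent is a non-negative integer. -/

import Mathlib

open scoped PowerSeries Topology

noncomputable section

/-! ### Complex varieties as spaces with functions -/

/-- A set `X` covered by charts `dom i`, each carrying complex-valued coordinate functions
`coord i v` (only the values on `dom i` matter). -/
structure ChartedSet (X : Type) where
  Index : Type
  Var : Type
  dom : Index → Set X
  coord : Index → Var → X → ℂ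

namespace ChartedSet

variable {X Y : Type}

/-- The value at `x` of a polynomial in the coordinates of the chart `i`. -/
def evalAt (A : ChartedSet X) (i : A.Index) (P : MvPolynomial A.Var ℂ) (x : X) : ℂ :=
  MvPolynomial.eval (fun v => A.coord i v x) P

/-- The part of the chart `i` where the polynomial `Q` in the coordinates does not vanish. -/
def basicOpen (A : ChartedSet X) (i : A.Index) (Q : MvPolynomial A.Var ℂ) : Set X :=
  {x | x ∈ A.dom i ∧ A.evalAt i Q x ≠ 0}

/-- The Zariski topology. -/
@[reducible] def zariski (A : ChartedSet X) : TopologicalSpace X :=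
  TopologicalSpace.generateFrom {U | ∃ i Q, U = A.basicOpen i Q}

/-- `f` is regular on `U`: near each point of `U` it is a quotient of two polynomials in the
coordinates of some chart. -/
def IsRegularOn (A : ChartedSet X) (U : Set X) (f : X → ℂ) : Prop :=
  ∀ x ∈ U, ∃ (i : A.Index) (P Q : MvPolynomial A.Var ℂ), x ∈ A.basicOpen i Q ∧
    ∀ x' ∈ U ∩ A.basicOpen i Q, f x' = A.evalAt i P x' / A.evalAt i Q x'

/-- The induced (reduced) structure on a subset: induced topology, and functions that are locally
restrictions of regular functions. -/
def restrict (A : ChartedSet X) (S : Set X) : ChartedSet S where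
  Index := A.Index
  Var := A.Var
  dom i := {x | (x : X) ∈ A.dom i}
  coord i v x := A.coord i v x

/-- Affine space `𝔸^N` over `ℂ`. -/
def affineSpace (N : ℕ) : ChartedSet (Fin N → ℂ) where
  Index := Unit
  Var := Fin N
  dom _ := Set.univ
  coord _ v x := x v

/-- Isomorphism of spaces with functions: a Zariski homeomorphism that identifies the regular
functions on corresponding open sets. -/
def IsIsomorphic (A : ChartedSet X) (B : ChartedSet Y) : Prop :=
  ∃ e : X ≃ Y,
    (∀ U : Set Y, IsOpen[B.zariski] U ↔ IsOpen[A.zariski] (e ⁻¹' U)) ∧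
    ∀ U : Set Y, IsOpen[B.zariski] U → ∀ f : Y → ℂ,
      (B.IsRegularOn U f ↔ A.IsRegularOn (e ⁻¹' U) (f ∘ e))

end ChartedSet

/-! ### Generic irreducible planar curve singularities -/

/-- A parametrization `x = t^{dn}`, `y = t^{dm} + λ t^{dm+1} + (higher order terms)` with
`gcd(n,m) = 1`, `m > n` and `λ ≠ 0`. -/
structure GenericBranch where
  d : ℕ
  n : ℕ
  m : ℕ
  y : ℂ⟦X⟧
  d_pos : 0 < d
  n_pos : 0 < n
  n_lt_m : n < m
  coprime : Nat.Coprime n m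
  coeff_lt : ∀ k < d * m, PowerSeries.coeff k y = 0
  coeff_dm : PowerSeries.coeff (d * m) y = 1
  coeff_succ : PowerSeries.coeff (d * m + 1) y ≠ 0

namespace GenericBranch

variable (C : GenericBranch)

/-- The pair `(x(t), y(t))`. -/
def xy : Fin 2 → ℂ⟦X⟧ := ![PowerSeries.X ^ (C.d * C.n), C.y]

theorem hasSubst_xy : MvPowerSeries.HasSubst C.xy := by
  apply MvPowerSeries.hasSubst_of_constantCoeff_zero
  intro s
  fin_cases s
  · change PowerSeries.constantCoeff (PowerSeries.X ^ (C.d * C.n) : ℂ⟦X⟧) = 0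
    have h : C.d * C.n ≠ 0 := (Nat.mul_pos C.d_pos C.n_pos).ne'
    simp [h]
  · change PowerSeries.constantCoeff C.y = 0
    rw [← PowerSeries.coeff_zero_eq_constantCoeff_apply]
    exact C.coeff_lt 0 (Nat.mul_pos C.d_pos (C.n_pos.trans C.n_lt_m))

/-- The complete local ring `R = ℂ[[x(t), y(t)]]`, inside its normalization `ℂ[[t]]`. -/
def R : Subalgebra ℂ ℂ⟦X⟧ :=
  (MvPowerSeries.substAlgHom (R := ℂ) C.hasSubst_xy).range

/-- The fraction field `E = ℂ((t))`. -/
abbrev E : Type := LaurentSeries ℂ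

/-- `ord_t(J)`, the set of `t`-adic orders of the nonzero elements of `J`. -/
def ordSet (J : Set E) : Set ℤ := {a | ∃ z ∈ J, z ≠ 0 ∧ HahnSeries.order z = a}

/-- The value semigroup `Γ = ord_t(R)`. -/
def Gam : Set ℤ := ordSet (Set.range (algebraMap C.R E))

/-- `δ = dim ℂ[[t]] / R`. -/
def delta : ℕ := Module.finrank ℂ (ℂ⟦X⟧ ⧸ Subalgebra.toSubmodule C.R)

/-- A `Γ`-semimodule `Δ` with minimum `0`. -/
structure IsNormalizedSemimodule (Δ : Set ℤ) : Prop where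
  add_mem : ∀ a ∈ C.Gam, ∀ b ∈ Δ, a + b ∈ Δ
  isLeast : IsLeast Δ 0

/-- `δ(Δ) = |ℕ ∖ Δ|`. -/
def deltaOf (Δ : Set ℤ) : ℕ := (Set.Ici (0 : ℤ) \ Δ).ncard

/-- `e(Δ) = δ - δ(Δ)`. -/
def e (Δ : Set ℤ) : ℤ := (C.delta : ℤ) - (deltaOf Δ : ℤ)

/-- The `dn`-generators of `Δ`. For `Δ` bounded below and `dn`-invariant this is the unique set
`A` such that `Δ` is the disjoint union of the sets `a + dn ℕ`, `a ∈ A`. -/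
def gens (Δ : Set ℤ) : Set ℤ := {a | a ∈ Δ ∧ a - ((C.d * C.n : ℕ) : ℤ) ∉ Δ}

/-- The residue `i` modulo `d` is `ℓ`-admissible for `Δ`. -/
def IsAdmissibleAt (Δ : Set ℤ) (l i : ℕ) : Prop :=
  ∃ a ∈ C.gens Δ, a ≡ (i : ℤ) [ZMOD (C.d : ℤ)] ∧ a + ((C.d * C.m : ℕ) : ℤ) + (l : ℤ) ∈ Δ

/-- `Δ` is admissible. -/
def IsAdmissible (Δ : Set ℤ) : Prop := ∀ i < C.d, C.IsAdmissibleAt Δ 1 i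

/-- `Gaps(a) = [a, ∞) ∖ Δ`. -/
def gaps (Δ : Set ℤ) (a : ℤ) : Set ℤ := Set.Ici a \ Δ

/-- `dim Δ = ∑_{a ∈ A(Δ)} |Gaps(a)| - ∑_{a ∈ A(Δ)} |Gaps(a + dm)|`. -/
def dimOf (Δ : Set ℤ) : ℤ :=
  (∑ᶠ a ∈ C.gens Δ, ((gaps Δ a).ncard : ℤ)) -
    ∑ᶠ a ∈ C.gens Δ, ((gaps Δ (a + ((C.d * C.m : ℕ) : ℤ))).ncard : ℤ)

/-! ### Modules, the Hilbert scheme and its strata -/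

/-- `t^k M`. -/
def tMul (k : ℤ) (M : Submodule C.R E) : Submodule C.R E :=
  M.map (LinearMap.mulLeft C.R (HahnSeries.single k (1 : ℂ) : E))

/-- The dual `J⁻¹ = {z ∈ E | z J ⊆ R}`. -/
def dual (J : Submodule C.R E) : Submodule C.R E := 1 / J

/-- `J_Δ`: the `R`-submodules `M` of `ℂ[[t]]` with `ord_t(M) = Δ`, where `min ord_t(M) = 0`. -/
def JStratum (Δ : Set ℤ) : Set (Submodule C.R E) :=
  {M | (M : Set E) ⊆ Set.range (algebraMap ℂ⟦X⟧ E) ∧ IsLeast (ordSet (M : Set E)) 0 ∧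
    ordSet (M : Set E) = Δ}

/-- `ι_Δ(M) = t^{e(Δ)} M`. -/
def iota (Δ : Set ℤ) (M : Submodule C.R E) : Submodule C.R E := C.tMul (C.e Δ) M

/-- The (points of the) Hilbert scheme: ideals of `R` of colength `τ`. -/
def Hilb (τ : ℕ) : Type :=
  {I : Ideal C.R // Module.Finite ℂ (C.R ⧸ I) ∧ Module.finrank ℂ (C.R ⧸ I) = τ}

/-- The Abel–Jacobi map `I ↦ t^τ I⁻¹`. -/
def AJ (τ : ℕ) (I : C.Hilb τ) : Submodule C.R E :=
  C.tMul τ (C.dual (Submodule.map (Algebra.linearMap C.R E) I.1))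

/-- The elements `b₁, …, b_τ` of `R` map to a basis of `R / I`. -/
def IsFrame {τ : ℕ} (b : Fin τ → C.R) (I : C.Hilb τ) : Prop :=
  ∀ f : C.R, ∃! c : Fin τ → ℂ, f - ∑ j, c j • b j ∈ I.1

open Classical in
/-- The `j`-th coefficient of the class of `f` in the basis `b` of `R / I`. -/
def frameCoord {τ : ℕ} (b : Fin τ → C.R) (fj : C.R × Fin τ) (I : C.Hilb τ) : ℂ :=
  if h : C.IsFrame b I then (h fj.1).choose fj.2 else 0

/-- The reduced variety structure on the Hilbert scheme, by its standard charts: where `b` is a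
basis of `R / I`, the coordinates are the entries of the matrix of `R → R / I ≅ ℂ^τ`. These are
the charts of the Grassmannian of codimension-`τ` subspaces of `R`. -/
def hilbCharts (τ : ℕ) : ChartedSet (C.Hilb τ) where
  Index := Fin τ → C.R
  Var := C.R × Fin τ
  dom b := {I | C.IsFrame b I}
  coord b fj I := C.frameCoord b fj I

/-- The stratum `H_Δ^{[τ]} = Hilb^{[τ]} ∩ ι_Δ(J_Δ)`, the intersection being taken through the
Abel–Jacobi map. -/
def HStratum (Δ : Set ℤ) (τ : ℕ) : Set (C.Hilb τ) :=
  {I | C.AJ τ I ∈ C.iota Δ '' C.JStratum Δ}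

/-- `H_Δ^{[τ]}` with its structure of a subvariety of the Hilbert scheme. -/
def hStratumCharts (Δ : Set ℤ) (τ : ℕ) : ChartedSet (C.HStratum Δ τ) :=
  (C.hilbCharts τ).restrict (C.HStratum Δ τ)

end GenericBranch

end

/-! Put q = dn, w = dm, let D be the set of exponents in Δ and gen r the least element of D in the
residue class r mod q. A module M in J_Δ is the closed span of a unique reduced family F_b = t^b ∑
Λ_b^ℓ t^ℓ (b in D). Here Λ_b depends only on b mod q (stability under x), Λ_r^0 = 1, and Λ_r^k = 0
for k ≥ 1 with gen r + k in D. Two conditions remain: M is stable under y, and M contains t^{τ₀}.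
The second says that R lies in t^{-τ₀}M, so that the dual of t^{-τ₀}M is an ideal of R.

Stability under y asks that y F_r have coordinate zero at each gap gen r + w + k. This equation has
the form Λ_r^k - Λ_{r+w}^k + (lower levels) = 0, a linear system at level k on the graph with edges
r → r + w. As gcd(n,m) = 1, each class mod d is one cycle of length n. A cycle with a missing
equation breaks into paths and is solvable. A complete cycle gives one obstruction: the lower terms
must sum to zero around it. The obstructions at level k + 1 are removed at level k: adding constants
s_i to the unknowns of the classes i changes the sum over a complete class i by nλ(s_i - s_{i+1})
(`clSum_kap_ext`). Admissibility says that no class is complete at level 1. Hence there is no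
initial obstruction, and it also gives enough unknowns for this formula to hold. The class of the
largest generator is never complete, so the equations for the s_i again run along paths in ℤ/d. The
condition on t^{τ₀} fixes one more constant at each gap of τ₀. Counting unknowns minus equations
telescopes to dim Δ - |Gaps(τ₀)|. Conversely, the sum over a class at level 1 is nλ ≠ 0, so a
non-admissible Δ carries no module (`IsYStable.isAdm`).

The equations are solved over every commutative ℂ-algebra by the same linear forms. Over a
polynomial ring this gives a polynomial parametrization with linear inverse
(`exists_parametrization`).

For the passage to ideals, R is the closed span of x^a y^i z^j with i < n, j < d and z proportional
to y^n - x^m (`mem_R_iff`). Its semigroup is therefore symmetric (`frob_sub_mem_iff`), and a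
functional `resF` identifies the dual of a module with its annihilator (`mem_dual_iff`). Elements
r_i of R, of orders complementary to those of t^{-τ₀}F_b for b in D outside τ₀ + Γ, pair with these
unitriangularly. They thus form one frame of R/I for all I in the stratum, in which frame
coordinates and parameters are polynomials in each other (`exists_eval_frameCoord`,
`exists_eval_eq`). -/

noncomputable section

/-! ### Morphisms of charted spaces. -/

namespace ChartedSet

variable {X Y : Type}

/-- In charts around each point, `f` is given by quotients of polynomials with a common
denominator. -/
def IsMorph (A : ChartedSet X) (B : ChartedSet Y) (f : X → Y) : Prop :=
  ∀ x i, f x ∈ B.dom i → ∃ (i' : A.Index) (Q : MvPolynomial A.Var ℂ), x ∈ A.basicOpen i' Q ∧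
    (∀ x' ∈ A.basicOpen i' Q, f x' ∈ B.dom i) ∧
    ∀ v, ∃ P : MvPolynomial A.Var ℂ, ∀ x' ∈ A.basicOpen i' Q,
      B.coord i v (f x') = A.evalAt i' P x' / A.evalAt i' Q x'

/-- Every coordinate pulls back with the same denominator `Q`, so a polynomial pulls back with a
power of `Q` as denominator. -/
theorem IsMorph.exists_evalAt {A : ChartedSet X} {B : ChartedSet Y} {f : X → Y}
    (hf : A.IsMorph B f) (x : X) (i : B.Index) (hx : f x ∈ B.dom i) :
    ∃ (i' : A.Index) (Q : MvPolynomial A.Var ℂ), x ∈ A.basicOpen i' Q ∧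
      (∀ x' ∈ A.basicOpen i' Q, f x' ∈ B.dom i) ∧
      ∀ R : MvPolynomial B.Var ℂ, ∃ (P : MvPolynomial A.Var ℂ) (k : ℕ), ∀ x' ∈ A.basicOpen i' Q,
        B.evalAt i R (f x') = A.evalAt i' P x' / A.evalAt i' Q x' ^ k := by
  obtain ⟨i', Q, hxQ, hdom, hv⟩ := hf x i hx
  refine ⟨i', Q, hxQ, hdom, fun R => ?_⟩
  induction R using MvPolynomial.induction_on with
  | C a => exact ⟨MvPolynomial.C a, 0, fun x' _ => by simp [evalAt]⟩
  | add p q hp hq =>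
    obtain ⟨P₁, k₁, h₁⟩ := hp
    obtain ⟨P₂, k₂, h₂⟩ := hq
    refine ⟨P₁ * Q ^ k₂ + P₂ * Q ^ k₁, k₁ + k₂, fun x' hx' => ?_⟩
    have hne : A.evalAt i' Q x' ≠ 0 := hx'.2
    have e₁ := h₁ x' hx'
    have e₂ := h₂ x' hx'
    simp only [evalAt, map_add, map_mul, map_pow] at *
    rw [e₁, e₂]
    field_simp
    ring
  | mul_X p v hp =>
    obtain ⟨P₁, k₁, h₁⟩ := hp
    obtain ⟨P₂, h₂⟩ := hv v
    refine ⟨P₁ * P₂, k₁ + 1, fun x' hx' => ?_⟩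
    have hne : A.evalAt i' Q x' ≠ 0 := hx'.2
    have e₁ := h₁ x' hx'
    have e₂ := h₂ x' hx'
    simp only [evalAt, map_mul, MvPolynomial.eval_X] at *
    rw [e₁, e₂]
    field_simp
    ring

theorem isOpen_basicOpen (A : ChartedSet X) (i : A.Index) (Q : MvPolynomial A.Var ℂ) :
    IsOpen[A.zariski] (A.basicOpen i Q) :=
  TopologicalSpace.isOpen_generateFrom_of_mem ⟨i, Q, rfl⟩

theorem isOpen_of_forall_basicOpen (A : ChartedSet X) {U : Set X}
    (h : ∀ x ∈ U, ∃ i Q, x ∈ A.basicOpen i Q ∧ A.basicOpen i Q ⊆ U) : IsOpen[A.zariski] U := by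
  let := A.zariski
  rw [isOpen_iff_mem_nhds]
  intro x hx
  obtain ⟨i, Q, h₁, h₂⟩ := h x hx
  exact Filter.mem_of_superset ((A.isOpen_basicOpen i Q).mem_nhds h₁) h₂

theorem IsMorph.isOpen_preimage {A : ChartedSet X} {B : ChartedSet Y} {f : X → Y}
    (hf : A.IsMorph B f) {U : Set Y} (hU : IsOpen[B.zariski] U) :
    IsOpen[A.zariski] (f ⁻¹' U) := by
  let := A.zariski
  let := B.zariski
  have hc : Continuous f := by
    refine continuous_generateFrom_iff.2 ?_
    rintro _ ⟨i, R, rfl⟩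
    refine A.isOpen_of_forall_basicOpen fun x hx => ?_
    obtain ⟨i', Q, hxQ, hdom, hR⟩ := hf.exists_evalAt x i hx.1
    obtain ⟨P, k, hP⟩ := hR R
    -- The factor `Q` keeps the neighbourhood inside the region where the formula for the pullback
    -- is valid.
    refine ⟨i', Q * P, ⟨hxQ.1, ?_⟩, fun x' hx' => ?_⟩
    · have h := hP x hxQ
      have hne : B.evalAt i R (f x) ≠ 0 := hx.2
      have hQ := hxQ.2
      rw [h] at hne
      simp only [evalAt, map_mul] at *
      exact mul_ne_zero hQ (div_ne_zero_iff.1 hne).1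
    · have h2 := hx'.2
      simp only [evalAt, map_mul] at h2
      have hxQ' : x' ∈ A.basicOpen i' Q := ⟨hx'.1, left_ne_zero_of_mul h2⟩
      refine ⟨hdom x' hxQ', ?_⟩
      rw [hP x' hxQ']
      exact div_ne_zero (right_ne_zero_of_mul h2) (pow_ne_zero _ hxQ'.2)
  exact hU.preimage hc

theorem IsMorph.isRegularOn_comp {A : ChartedSet X} {B : ChartedSet Y} {f : X → Y}
    (hf : A.IsMorph B f) {U : Set Y} {φ : Y → ℂ} (hφ : B.IsRegularOn U φ) :
    A.IsRegularOn (f ⁻¹' U) (φ ∘ f) := by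
  intro x hx
  obtain ⟨i, P, Q, hxQ, hPQ⟩ := hφ (f x) hx
  obtain ⟨i', S, hxS, hdom, hS⟩ := hf.exists_evalAt x i hxQ.1
  obtain ⟨P₁, k₁, h₁⟩ := hS P
  obtain ⟨P₂, k₂, h₂⟩ := hS Q
  -- This is (P₁/S^k₁)/(P₂/S^k₂) with denominators cleared; the extra `S` on both sides forces `S ≠
  -- 0` on the new basic open set.
  refine ⟨i', P₁ * S ^ k₂ * S, P₂ * S ^ k₁ * S, ⟨hxS.1, ?_⟩, ?_⟩
  · have hne : B.evalAt i Q (f x) ≠ 0 := hxQ.2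
    rw [h₂ x hxS] at hne
    have hSx := hxS.2
    simp only [evalAt, map_mul, map_pow] at *
    exact mul_ne_zero (mul_ne_zero (div_ne_zero_iff.1 hne).1 (pow_ne_zero _ hSx)) hSx
  · rintro x' ⟨hx'U, hx'i, hx'⟩
    simp only [evalAt, map_mul, map_pow] at hx'
    have hS0 : MvPolynomial.eval (fun v => A.coord i' v x') S ≠ 0 := right_ne_zero_of_mul hx'
    have hP20 : MvPolynomial.eval (fun v => A.coord i' v x') P₂ ≠ 0 :=
      left_ne_zero_of_mul (left_ne_zero_of_mul hx')
    have hx'S : x' ∈ A.basicOpen i' S := ⟨hx'i, hS0⟩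
    have e₁ := h₁ x' hx'S
    have e₂ := h₂ x' hx'S
    have hmem : f x' ∈ U ∩ B.basicOpen i Q := by
      refine ⟨hx'U, hdom x' hx'S, ?_⟩
      rw [e₂]
      exact div_ne_zero hP20 (pow_ne_zero _ hS0)
    have e := hPQ _ hmem
    rw [Function.comp_apply, e, e₁, e₂]
    simp only [evalAt, map_mul, map_pow]
    field_simp

theorem isIsomorphic_of_isMorph {A : ChartedSet X} {B : ChartedSet Y} (e : X ≃ Y)
    (h₁ : A.IsMorph B e) (h₂ : B.IsMorph A e.symm) : A.IsIsomorphic B := by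
  refine ⟨e, fun U => ⟨fun h => h₁.isOpen_preimage h, fun h => ?_⟩, fun U _ f =>
    ⟨fun h => h₁.isRegularOn_comp h, fun h => ?_⟩⟩
  · simpa [← Set.preimage_comp] using h₂.isOpen_preimage h
  · have := h₂.isRegularOn_comp h
    simpa [← Set.preimage_comp, Function.comp_assoc] using this

end ChartedSet

/-! ### Change of frame on the Hilbert scheme. -/

namespace GenericBranch

variable (C : GenericBranch)

theorem IsFrame.sub_sum_mem {C : GenericBranch} {τ : ℕ} {b : Fin τ → C.R} {I : C.Hilb τ}
    (h : C.IsFrame b I) (f : C.R) : f - ∑ j, C.frameCoord b (f, j) I • b j ∈ I.1 := by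
  have := (h f).choose_spec.1
  simpa [frameCoord, dif_pos h] using this

theorem IsFrame.frameCoord_eq {C : GenericBranch} {τ : ℕ} {b : Fin τ → C.R} {I : C.Hilb τ}
    (h : C.IsFrame b I) (f : C.R) (c : Fin τ → ℂ) (hc : f - ∑ j, c j • b j ∈ I.1) (j : Fin τ) :
    C.frameCoord b (f, j) I = c j := by
  have := (h f).unique (h.sub_sum_mem f) hc
  exact congrFun this j

theorem smul_mem_ideal {C : GenericBranch} (I : Ideal C.R) (a : ℂ) {f : C.R} (hf : f ∈ I) :
    a • f ∈ I := by
  rw [Algebra.smul_def]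
  exact I.mul_mem_left _ hf

/-- The change-of-frame matrix. -/
def frameMatrix {τ : ℕ} (b₀ b : Fin τ → C.R) (I : C.Hilb τ) : Matrix (Fin τ) (Fin τ) ℂ :=
  Matrix.of fun i j => C.frameCoord b₀ (b j, i) I

/-- Modulo `I` each `b j` is a combination of the `b₀ i` with coefficients the columns of the
matrix, and expansions in `b₀` are unique. -/
theorem sub_sum_mem_iff {C : GenericBranch} {τ : ℕ} {b₀ b : Fin τ → C.R} {I : C.Hilb τ}
    (h₀ : C.IsFrame b₀ I) (f : C.R) (c : Fin τ → ℂ) :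
    f - ∑ j, c j • b j ∈ I.1 ↔
      (C.frameMatrix b₀ b I).mulVec c = fun i => C.frameCoord b₀ (f, i) I := by
  have key : f - ∑ i, ((C.frameMatrix b₀ b I).mulVec c) i • b₀ i - (f - ∑ j, c j • b j) ∈ I.1 := by
    have h1 : f - ∑ i, ((C.frameMatrix b₀ b I).mulVec c) i • b₀ i - (f - ∑ j, c j • b j) =
        ∑ j, c j • (b j - ∑ i, C.frameCoord b₀ (b j, i) I • b₀ i) := by
      simp only [smul_sub, Finset.sum_sub_distrib, Finset.smul_sum]
      rw [Finset.sum_comm]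
      simp only [Matrix.mulVec, dotProduct, frameMatrix, Matrix.of_apply, Finset.sum_smul, smul_smul,
        mul_comm]
      abel
    rw [h1]
    exact Submodule.sum_mem _ fun j _ => smul_mem_ideal _ _ (h₀.sub_sum_mem (b j))
  constructor
  · intro h
    have h2 := I.1.add_mem key h
    rw [sub_add_cancel] at h2
    funext i
    exact (h₀.frameCoord_eq f _ h2 i).symm
  · intro h
    have h2 := h₀.sub_sum_mem f
    have h3 : f - ∑ i, ((C.frameMatrix b₀ b I).mulVec c) i • b₀ i ∈ I.1 := by
      rw [h]; exact h2
    have := I.1.sub_mem h3 key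
    simpa using this

theorem isFrame_iff_det_ne_zero {C : GenericBranch} {τ : ℕ} {b₀ b : Fin τ → C.R} {I : C.Hilb τ}
    (h₀ : C.IsFrame b₀ I) : C.IsFrame b I ↔ (C.frameMatrix b₀ b I).det ≠ 0 := by
  constructor
  · intro h hdet
    obtain ⟨v, hv, hv0⟩ := Matrix.exists_mulVec_eq_zero_iff.2 hdet
    have h0 : ∀ c, (C.frameMatrix b₀ b I).mulVec c = 0 → c = 0 := by
      intro c hc
      obtain ⟨w, hw, huniq⟩ := h 0
      have h00 : (fun i => C.frameCoord b₀ (0, i) I) = (0 : Fin τ → ℂ) := by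
        funext i
        exact h₀.frameCoord_eq 0 0 (by simp) i
      have e1 := huniq c ((sub_sum_mem_iff h₀ 0 c).2 (by rw [hc, h00]))
      have e2 := huniq 0 (by simp)
      rw [e1, ← e2]
    exact hv (h0 v hv0)
  · intro hdet f
    have hu : IsUnit (C.frameMatrix b₀ b I).det := isUnit_iff_ne_zero.2 hdet
    refine ⟨(C.frameMatrix b₀ b I)⁻¹.mulVec fun i => C.frameCoord b₀ (f, i) I, ?_, fun c hc => ?_⟩
    · refine (sub_sum_mem_iff h₀ f _).2 ?_
      rw [Matrix.mulVec_mulVec, Matrix.mul_nonsing_inv _ hu, Matrix.one_mulVec]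
    · rw [← (sub_sum_mem_iff h₀ f c).1 hc, Matrix.mulVec_mulVec, Matrix.nonsing_inv_mul _ hu,
        Matrix.one_mulVec]

/-- A bijection from affine space onto a stratum with a global frame is an isomorphism as soon as
it is polynomial in both directions with respect to that frame. -/
theorem isIsomorphic_hStratumCharts (Δ : Set ℤ) (τ N : ℕ) (b₀ : Fin τ → C.R)
    (h₀ : ∀ I ∈ C.HStratum Δ τ, C.IsFrame b₀ I) (e : (Fin N → ℂ) ≃ C.HStratum Δ τ)
    (hq : ∀ f j, ∃ q : MvPolynomial (Fin N) ℂ,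
      ∀ p, C.frameCoord b₀ (f, j) (e p) = MvPolynomial.eval p q)
    (hs : ∀ i, ∃ s : MvPolynomial (C.R × Fin τ) ℂ,
      ∀ p, MvPolynomial.eval (fun v => C.frameCoord b₀ v (e p)) s = p i) :
    (ChartedSet.affineSpace N).IsIsomorphic (C.hStratumCharts Δ τ) := by
  choose q hq using hq
  choose s hs using hs
  refine ChartedSet.isIsomorphic_of_isMorph e ?_ ?_
  · intro p (b : Fin τ → C.R) hb
    -- The change-of-frame matrix is polynomial in the parameters; its determinant cuts out the
    -- chart of `b`.
    let M : Matrix (Fin τ) (Fin τ) (MvPolynomial (Fin N) ℂ) := Matrix.of fun i j => q (b j) i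
    have hM : ∀ p, M.map (MvPolynomial.eval p) = C.frameMatrix b₀ b (e p) := by
      intro p
      ext i j
      simp [M, frameMatrix, hq]
    have hdet : ∀ p, MvPolynomial.eval p M.det = (C.frameMatrix b₀ b (e p)).det := by
      intro p
      rw [← hM, RingHom.map_det]
      rfl
    have hmem : ∀ p, p ∈ (ChartedSet.affineSpace N).basicOpen () M.det ↔
        C.IsFrame b (e p : C.Hilb τ) := by
      intro p
      refine Iff.trans ?_ (isFrame_iff_det_ne_zero (h₀ _ (e p).2)).symm
      rw [← hdet]
      exact ⟨fun h => h.2, fun h => ⟨trivial, h⟩⟩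
    refine ⟨(), M.det, (hmem p).2 hb, fun p' hp' => (hmem p').1 hp', ?_⟩
    rintro ⟨f, j⟩
    -- Cramer's rule: all coordinates in the frame `b` have the common denominator `M.det`.
    refine ⟨(M.adjugate.mulVec fun i => q f i) j, fun p' hp' => ?_⟩
    have hfr : C.IsFrame b (e p' : C.Hilb τ) := (hmem p').1 hp'
    have h0 := h₀ _ (e p').2
    have hne := (isFrame_iff_det_ne_zero h0).1 hfr
    have h1 := (sub_sum_mem_iff h0 f _).1 (hfr.sub_sum_mem f)
    have h2 := congrArg (C.frameMatrix b₀ b (e p')).adjugate.mulVec h1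
    rw [Matrix.mulVec_mulVec, Matrix.adjugate_mul, Matrix.smul_mulVec, Matrix.one_mulVec] at h2
    have h3 := congrFun h2 j
    change C.frameCoord b (f, j) (e p') = MvPolynomial.eval p' _ / MvPolynomial.eval p' _
    rw [hdet, eq_div_iff hne, mul_comm]
    refine Eq.trans h3 ?_
    simp only [Matrix.mulVec, dotProduct, map_sum, map_mul, hq]
    refine Finset.sum_congr rfl fun i _ => ?_
    rw [← hM, ← RingHom.mapMatrix_apply, ← RingHom.map_adjugate]
    rfl
  · intro x i _
    refine ⟨b₀, 1, ⟨h₀ _ x.2, ?_⟩, fun _ _ => trivial, fun v => ⟨s v, fun x' _ => ?_⟩⟩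
    · change MvPolynomial.eval _ 1 ≠ 0
      simp
    · obtain ⟨p, rfl⟩ := e.surjective x'
      have h1 := hs v p
      change e.symm (e p) v = MvPolynomial.eval _ _ / MvPolynomial.eval _ _
      rw [map_one, div_one, e.symm_apply_apply]
      exact h1.symm

end GenericBranch
end

/-! ### Linear systems solvable uniformly over all algebras. -/

noncomputable section

/-- A surjective family of linear forms on the vectors supported in `T` can be completed, by
constant linear forms, to a system with a unique solution over every commutative `ℂ`-algebra. -/
theorem exists_complementary_forms {V J : Type} [Fintype V] [Fintype J]
    (T : Finset V) (L : J → V → ℂ)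
    (hL : ∀ c : J → ℂ, ∃ v : V → ℂ, (∀ r, r ∉ T → v r = 0) ∧ ∀ j, ∑ r, L j r • v r = c j) :
    ∃ N : ℕ, N + Fintype.card J = T.card ∧ ∃ P : Fin N → V → ℂ,
      ∀ (A : Type) [CommRing A] [Algebra ℂ A] (c : J → A) (p : Fin N → A),
        ∃! v : V → A, (∀ r, r ∉ T → v r = 0) ∧ (∀ j, ∑ r, L j r • v r = c j) ∧
          ∀ i, ∑ r, P i r • v r = p i := by
  classical
  let M : Matrix J T ℂ := Matrix.of fun j r => L j r
  have hsum : ∀ (A : Type) [CommRing A] [Algebra ℂ A] (ℓ : V → ℂ) (v : V → A),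
      (∀ r, r ∉ T → v r = 0) → ∑ r, ℓ r • v r = ∑ r : T, ℓ r • v r := by
    intro A _ _ ℓ v hv
    rw [Finset.sum_coe_sort T fun r => ℓ r • v r]
    exact (Finset.sum_subset (Finset.subset_univ _) fun r _ hr => by rw [hv r hr, smul_zero]).symm
  have hsurj : Function.Surjective M.mulVecLin := by
    intro c
    obtain ⟨v, hv, hc⟩ := hL c
    refine ⟨fun r => v r, funext fun j => ?_⟩
    rw [← hc j, hsum ℂ _ v hv]
    rfl
  let K := LinearMap.ker M.mulVecLin
  have hfin : Module.finrank ℂ K + Fintype.card J = T.card := by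
    have h := M.mulVecLin.finrank_range_add_finrank_ker
    rw [LinearMap.range_eq_top.2 hsurj, finrank_top] at h
    simp only [Module.finrank_fintype_fun_eq_card, Fintype.card_coe] at h
    rw [add_comm]; exact h
  -- Coordinates of a projection onto the kernel are the complementary forms.
  obtain ⟨pr, hpr⟩ := K.subtype.exists_leftInverse_of_injective K.ker_subtype
  let eK : K ≃ₗ[ℂ] (Fin (Module.finrank ℂ K) → ℂ) := (Module.finBasis ℂ K).equivFun
  let F : (T → ℂ) →ₗ[ℂ] (J ⊕ Fin (Module.finrank ℂ K) → ℂ) :=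
    (LinearEquiv.sumArrowLequivProdArrow J (Fin (Module.finrank ℂ K)) ℂ ℂ).symm.toLinearMap ∘ₗ
      (M.mulVecLin.prod (eK.toLinearMap ∘ₗ pr))
  have hFinj : Function.Injective F := by
    refine (injective_iff_map_eq_zero F).2 fun v hv => ?_
    have h0 := (LinearEquiv.map_eq_zero_iff
      (LinearEquiv.sumArrowLequivProdArrow J (Fin (Module.finrank ℂ K)) ℂ ℂ).symm).1 hv
    have h1 : v ∈ K := congrArg Prod.fst h0
    have h2 : pr v = 0 := (LinearEquiv.map_eq_zero_iff eK).1 (congrArg Prod.snd h0)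
    have h3 : pr (K.subtype ⟨v, h1⟩) = ⟨v, h1⟩ := LinearMap.congr_fun hpr _
    have h4 : (⟨v, h1⟩ : K) = 0 := h3.symm.trans h2
    exact congrArg Subtype.val h4
  have hdim : Module.finrank ℂ (T → ℂ) =
      Module.finrank ℂ (J ⊕ Fin (Module.finrank ℂ K) → ℂ) := by
    simp only [Module.finrank_fintype_fun_eq_card, Fintype.card_coe, Fintype.card_sum,
      Fintype.card_fin]
    omega
  let e := LinearEquiv.ofInjectiveOfFinrankEq F hFinj hdim
  have heF : ∀ v, e v = F v := fun v => rfl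
  let M₁ := LinearMap.toMatrix' e.toLinearMap
  let M₂ := LinearMap.toMatrix' e.symm.toLinearMap
  have h12 : M₁ * M₂ = 1 := by
    rw [← LinearMap.toMatrix'_comp, LinearEquiv.comp_symm, LinearMap.toMatrix'_id]
  have h21 : M₂ * M₁ = 1 := by
    rw [← LinearMap.toMatrix'_comp, LinearEquiv.symm_comp, LinearMap.toMatrix'_id]
  have hM₁ : ∀ j r, M₁ (Sum.inl j) r = L j r := by
    intro j r
    refine (LinearMap.toMatrix'_apply _ _ _).trans ?_
    exact congrFun (Matrix.mulVec_single_one M r) j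
  refine ⟨Module.finrank ℂ K, hfin,
    fun i r => if h : r ∈ T then M₁ (Sum.inr i) ⟨r, h⟩ else 0, fun A _ _ c p => ?_⟩
  -- The extended matrix has an inverse over ℂ, and both map to mutually inverse matrices over `A`.
  let φ := algebraMap ℂ A
  have h12A : M₁.map φ * M₂.map φ = 1 := by
    rw [← Matrix.map_mul, h12, Matrix.map_one _ (map_zero _) (map_one _)]
  have h21A : M₂.map φ * M₁.map φ = 1 := by
    rw [← Matrix.map_mul, h21, Matrix.map_one _ (map_zero _) (map_one _)]
  have hiff : ∀ v : V → A, (∀ r, r ∉ T → v r = 0) →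
      (((∀ j, ∑ r, L j r • v r = c j) ∧
          ∀ i, ∑ r, (if h : r ∈ T then M₁ (Sum.inr i) ⟨r, h⟩ else 0) • v r = p i) ↔
        (M₁.map φ).mulVec (fun r : T => v r) = Sum.elim c p) := by
    intro v hv
    have e1 : ∀ j, ∑ r, L j r • v r = (M₁.map φ).mulVec (fun r : T => v r) (Sum.inl j) := by
      intro j
      rw [hsum A _ v hv]
      simp only [Matrix.mulVec, dotProduct, Matrix.map_apply, hM₁, φ, Algebra.smul_def]
    have e2 : ∀ i, ∑ r, (if h : r ∈ T then M₁ (Sum.inr i) ⟨r, h⟩ else 0) • v r =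
        (M₁.map φ).mulVec (fun r : T => v r) (Sum.inr i) := by
      intro i
      rw [hsum A _ v hv]
      simp [Matrix.mulVec, dotProduct, φ, Algebra.smul_def]
    constructor
    · rintro ⟨h1, h2⟩
      funext j
      cases j with
      | inl j => rw [← e1, h1]; rfl
      | inr i => rw [← e2, h2]; rfl
    · intro h
      exact ⟨fun j => by rw [e1, h]; rfl, fun i => by rw [e2, h]; rfl⟩
  refine ⟨fun r => if h : r ∈ T then (M₂.map φ).mulVec (Sum.elim c p) ⟨r, h⟩ else 0, ?_, ?_⟩
  · refine ⟨fun r hr => dif_neg hr, ?_⟩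
    rw [hiff _ fun r hr => dif_neg hr]
    have : (fun r : T => if h : (r : V) ∈ T then (M₂.map φ).mulVec (Sum.elim c p) ⟨r, h⟩ else 0) =
        (M₂.map φ).mulVec (Sum.elim c p) := by
      funext r
      simp
    rw [this, Matrix.mulVec_mulVec, h12A, Matrix.one_mulVec]
  · rintro v ⟨hv, h⟩
    have h1 := (hiff v hv).1 h
    funext r
    by_cases hr : r ∈ T
    · rw [dif_pos hr, ← h1, Matrix.mulVec_mulVec, h21A, Matrix.one_mulVec]
    · rw [dif_neg hr, hv r hr]

/-- Prescribed differences along a map whose orbits all leave `S`. -/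
theorem exists_prescribed_differences {α : Type} (f : α → α) (S : Set α)
    (h : ∀ a, ∃ j, f^[j] a ∉ S) (c : α → ℂ) : ∃ v : α → ℂ, ∀ a ∈ S, v a - v (f a) = c a := by
  classical
  -- Sum `c` along the orbit up to the first exit from `S`; consecutive sums differ by one term.
  refine ⟨fun a => ∑ j ∈ Finset.range (Nat.find (h a)), c (f^[j] a), fun a ha => ?_⟩
  have h1 : Nat.find (h a) = Nat.find (h (f a)) + 1 := by
    refine (Nat.find_eq_iff _).2 ⟨Nat.find_spec (h (f a)), fun n hn => ?_⟩
    cases n with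
    | zero => simpa using ha
    | succ n => exact Nat.find_min (h (f a)) (Nat.lt_of_succ_lt_succ hn)
  simp only [h1, Finset.sum_range_succ', Function.iterate_succ_apply, Function.iterate_zero_apply]
  ring

/-! ### Reduction with respect to a triangular family -/

variable {G A A' : Type} [CommRing G] [CommRing A] [CommRing A']

/-- The coordinates of `t^s ∑ h_ℓ t^ℓ` in the family `F_b = t^b ∑ Λ_b^ℓ t^ℓ`, where the index `b`
is reduced to `G`. -/
def red (Λ : G → ℕ → A) (s : G) (h : ℕ → A) (l : ℕ) : A :=
  h l - ∑ j : Fin l, red Λ s h j * Λ (s + ((j : ℕ) : G)) (l - j)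
termination_by l
decreasing_by exact j.2

theorem red_eq (Λ : G → ℕ → A) (s : G) (h : ℕ → A) (l : ℕ) :
    red Λ s h l = h l - ∑ j ∈ Finset.range l, red Λ s h j * Λ (s + (j : G)) (l - j) := by
  rw [red, Fin.sum_univ_eq_sum_range fun j => red Λ s h j * Λ (s + (j : G)) (l - j)]

theorem red_zero (Λ : G → ℕ → A) (s : G) (h : ℕ → A) : red Λ s h 0 = h 0 := by
  rw [red_eq]
  simp

/-- Only the levels `l - j ≥ 1` of the family enter the recursion, whence the restriction `1 ≤ j`.
-/
theorem red_congr {Λ Λ' : G → ℕ → A} (s : G) {h h' : ℕ → A} (l : ℕ)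
    (hh : ∀ j ≤ l, h j = h' j) (hΛ : ∀ r, ∀ j ≤ l, 1 ≤ j → Λ r j = Λ' r j) :
    red Λ s h l = red Λ' s h' l := by
  induction l using Nat.strong_induction_on with
  | _ l ih =>
    rw [red_eq, red_eq, hh l le_rfl]
    congr 1
    refine Finset.sum_congr rfl fun j hj => ?_
    have hj := Finset.mem_range.1 hj
    rw [ih j hj (fun i hi => hh i (hi.trans hj.le)) fun r i hi h1 => hΛ r i (hi.trans hj.le) h1,
      hΛ _ _ (Nat.sub_le _ _) (by omega)]

theorem red_map (f : A →+* A') (Λ : G → ℕ → A) (s : G) (h : ℕ → A) (l : ℕ) :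
    f (red Λ s h l) = red (fun r j => f (Λ r j)) s (fun j => f (h j)) l := by
  induction l using Nat.strong_induction_on with
  | _ l ih =>
    rw [red_eq, red_eq, map_sub, map_sum]
    congr 1
    refine Finset.sum_congr rfl fun j hj => ?_
    rw [map_mul, ih j (Finset.mem_range.1 hj)]

theorem red_add (Λ : G → ℕ → A) (s : G) (h h' : ℕ → A) (l : ℕ) :
    red Λ s (fun j => h j + h' j) l = red Λ s h l + red Λ s h' l := by
  induction l using Nat.strong_induction_on with
  | _ l ih =>
    rw [red_eq, red_eq Λ s h, red_eq Λ s h']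
    have : ∑ j ∈ Finset.range l, red Λ s (fun j => h j + h' j) j * Λ (s + (j : G)) (l - j) =
        ∑ j ∈ Finset.range l, red Λ s h j * Λ (s + (j : G)) (l - j) +
        ∑ j ∈ Finset.range l, red Λ s h' j * Λ (s + (j : G)) (l - j) := by
      rw [← Finset.sum_add_distrib]
      refine Finset.sum_congr rfl fun j hj => ?_
      rw [ih j (Finset.mem_range.1 hj), add_mul]
    rw [this]
    ring

theorem red_mul (Λ : G → ℕ → A) (s : G) (a : A) (h : ℕ → A) (l : ℕ) :
    red Λ s (fun j => a * h j) l = a * red Λ s h l := by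
  induction l using Nat.strong_induction_on with
  | _ l ih =>
    rw [red_eq, red_eq Λ s h, mul_sub, Finset.mul_sum]
    congr 1
    refine Finset.sum_congr rfl fun j hj => ?_
    rw [ih j (Finset.mem_range.1 hj), mul_assoc]

/-- If two families agree below level `l`, the reductions at level `l` differ by leading terms. -/
theorem red_sub_red {Λ Λ' : G → ℕ → A} (s : G) {h h' : ℕ → A} {l : ℕ} (hl : 1 ≤ l)
    (hh : ∀ j < l, h' j = h j) (hΛ : ∀ r, ∀ j < l, Λ' r j = Λ r j) :
    red Λ' s h' l = red Λ s h l + (h' l - h l) - h 0 * (Λ' s l - Λ s l) := by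
  obtain ⟨l, rfl⟩ : ∃ k, l = k + 1 := ⟨l - 1, by omega⟩
  rw [red_eq, red_eq Λ, Finset.sum_range_succ', Finset.sum_range_succ', red_zero, red_zero,
    hh 0 (by omega)]
  have : ∑ k ∈ Finset.range l, red Λ' s h' (k + 1) * Λ' (s + ((k + 1 : ℕ) : G)) (l + 1 - (k + 1)) =
      ∑ k ∈ Finset.range l, red Λ s h (k + 1) * Λ (s + ((k + 1 : ℕ) : G)) (l + 1 - (k + 1)) := by
    refine Finset.sum_congr rfl fun j hj => ?_
    have hj := Finset.mem_range.1 hj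
    rw [hΛ _ (l + 1 - (j + 1)) (by omega),
      red_congr (Λ' := Λ) s (h' := h) (j + 1) (fun i hi => hh i (by omega))
        fun r i hi _ => hΛ r i (by omega)]
  rw [this]
  simp only [Nat.cast_zero, add_zero, Nat.sub_zero]
  ring

variable [Algebra ℂ A] [Algebra ℂ A']

/-- The coefficients of a product of a complex power series and a power series over `A`. -/
def conv (y : ℕ → ℂ) (a : ℕ → A) (l : ℕ) : A := ∑ j ∈ Finset.range (l + 1), y (l - j) • a j

/-- The reduction of `y F_r`, where `y` has leading exponent `w` modulo `G`. -/
def kap (y : ℕ → ℂ) (w : G) (Λ : G → ℕ → A) (r : G) (l : ℕ) : A :=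
  red Λ (r + w) (conv y (Λ r)) l

theorem kap_map (f : A →ₐ[ℂ] A') (y : ℕ → ℂ) (w : G) (Λ : G → ℕ → A) (r : G) (l : ℕ) :
    f (kap y w Λ r l) = kap y w (fun r j => f (Λ r j)) r l := by
  rw [kap, ← RingHom.coe_coe f, red_map]
  congr 1
  funext j
  simp [conv, map_sum]

theorem kap_congr (y : ℕ → ℂ) (w : G) {Λ Λ' : G → ℕ → A} (r : G) (l : ℕ)
    (hΛ : ∀ r, ∀ j ≤ l, Λ r j = Λ' r j) : kap y w Λ r l = kap y w Λ' r l := by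
  refine red_congr _ _ (fun j hj => ?_) fun r j hj _ => hΛ r j hj
  refine Finset.sum_congr rfl fun i hi => ?_
  rw [hΛ r i (by have := Finset.mem_range.1 hi; omega)]

section

variable {y : ℕ → ℂ} {w : G} {Λ Λ' : G → ℕ → A}

theorem kap_zero (hy : y 0 = 1) (h0 : ∀ r, Λ r 0 = 1) (r : G) : kap y w Λ r 0 = 1 := by
  simp [kap, red_zero, conv, hy, h0]

theorem conv_sub_conv {a a' : ℕ → A} {k : ℕ} (h : ∀ j < k, a' j = a j) :
    conv y a' k = conv y a k + y 0 • (a' k - a k) := by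
  rw [conv, conv, Finset.sum_range_succ, Finset.sum_range_succ]
  rw [Finset.sum_congr rfl fun j hj => by rw [h j (Finset.mem_range.1 hj)]]
  simp only [Nat.sub_self, smul_sub]
  ring

theorem conv_congr {a a' : ℕ → A} {k : ℕ} (h : ∀ j ≤ k, a' j = a j) : conv y a' k = conv y a k :=
  Finset.sum_congr rfl fun j hj => by rw [h j (Nat.lt_succ_iff.1 (Finset.mem_range.1 hj))]

/-- Level `k` enters twice, both times linearly: through F_r itself and through the subtraction of
the leading term F_{r+w}. This is the source of the graph with edges from r to r + w. -/
theorem kap_change (hy : y 0 = 1) (h0 : ∀ r, Λ r 0 = 1) {k : ℕ} (hk : 1 ≤ k)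
    (h : ∀ r, ∀ j < k, Λ' r j = Λ r j) (r : G) :
    kap y w Λ' r k = kap y w Λ r k + (Λ' r k - Λ r k) - (Λ' (r + w) k - Λ (r + w) k) := by
  rw [kap, red_sub_red (Λ := Λ) (r + w) hk
    (fun j hj => conv_congr fun i hi => h r i (by omega)) h, conv_sub_conv (h r), hy, ← kap]
  simp [conv, hy, h0]

theorem kap_one (hy : y 0 = 1) (h0 : ∀ r, Λ r 0 = 1) (r : G) :
    kap y w Λ r 1 = algebraMap ℂ A (y 1) + Λ r 1 - Λ (r + w) 1 := by
  simp [kap, red_eq _ _ _ 1, red_zero, conv, Finset.sum_range_succ, hy, h0, Algebra.smul_def]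

/-- The second order effect of a change at level `k`. -/
theorem kap_succ_change (hy : y 0 = 1) (h0 : ∀ r, Λ r 0 = 1) {k : ℕ} (hk : 1 ≤ k) (σ : G → A)
    (h : ∀ r, ∀ j < k, Λ' r j = Λ r j) (hσ : ∀ r, Λ' r k = Λ r k + σ r) (r : G) :
    kap y w Λ' r (k + 1) = kap y w Λ r (k + 1) + (Λ' r (k + 1) - Λ r (k + 1)) -
      (Λ' (r + w) (k + 1) - Λ (r + w) (k + 1)) + y 1 • σ r - kap y w Λ r 1 * σ (r + w + 1) -
      (σ r - σ (r + w)) * Λ (r + w + (k : G)) 1 -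
      if k = 1 then (σ r - σ (r + w)) * σ (r + w + 1) else 0 := by
  have h0' : ∀ r, Λ' r 0 = 1 := fun r => by rw [h r 0 (by omega), h0]
  have hc : conv y (Λ' r) (k + 1) = conv y (Λ r) (k + 1) + (Λ' r (k + 1) - Λ r (k + 1)) +
      y 1 • σ r := by
    simp only [conv, Finset.sum_range_succ _ k, Finset.sum_range_succ _ (k + 1)]
    rw [Finset.sum_congr rfl fun j hj => by rw [h r j (Finset.mem_range.1 hj)], hσ]
    simp only [Nat.sub_self, hy, one_smul, Nat.add_sub_cancel_left, smul_add]
    ring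
  have hk1 := kap_change (w := w) (Λ' := Λ') hy h0 hk h r
  have hlt : ∀ j < k, kap y w Λ' r j = kap y w Λ r j := fun j hj =>
    kap_congr y w r j fun r i hi => h r i (by omega)
  have e : ∀ Λ : G → ℕ → A, kap y w Λ r (k + 1) = conv y (Λ r) (k + 1) -
      ∑ j ∈ Finset.range (k + 1), kap y w Λ r j * Λ (r + w + (j : G)) (k + 1 - j) :=
    fun Λ => red_eq _ _ _ _
  rw [e Λ', e Λ, hc]
  -- In the recursive sum only the terms j = 0, 1, k feel the change. For k = 1 the last two
  -- coincide, which produces the quadratic correction.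
  rcases Nat.lt_or_eq_of_le hk with hk2 | rfl
  · obtain ⟨k, rfl⟩ : ∃ i, k = i + 2 := ⟨k - 2, by omega⟩
    have hmid : ∀ j ∈ Finset.range k,
        kap y w Λ' r (j + 1 + 1) * Λ' (r + w + ((j + 1 + 1 : ℕ) : G)) (k + 2 + 1 - (j + 1 + 1)) =
        kap y w Λ r (j + 1 + 1) * Λ (r + w + ((j + 1 + 1 : ℕ) : G)) (k + 2 + 1 - (j + 1 + 1)) := by
      intro j hj
      have hj := Finset.mem_range.1 hj
      rw [hlt _ (by omega), h _ _ (by omega)]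
    have h1 : kap y w Λ' r (0 + 1) = kap y w Λ r (0 + 1) := hlt 1 (by omega)
    rw [Finset.sum_range_succ, Finset.sum_range_succ _ (k + 2), Finset.sum_range_succ',
      Finset.sum_range_succ', Finset.sum_range_succ' _ (k + 1), Finset.sum_range_succ' _ k,
      Finset.sum_congr rfl hmid, h1, kap_zero hy h0, kap_zero hy h0', hk1]
    have e1 : k + 2 + 1 - (0 + 1) = k + 2 := by omega
    have e2 : k + 2 + 1 - (k + 2) = 1 := by omega
    rw [e1, e2, hσ, hσ, hσ, h _ 1 (by omega), if_neg (by omega)]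
    simp only [Nat.cast_zero, add_zero, zero_add, Nat.cast_one, Nat.sub_zero]
    ring
  · rw [Finset.sum_range_succ, Finset.sum_range_succ, Finset.sum_range_zero,
      Finset.sum_range_succ, Finset.sum_range_succ, Finset.sum_range_zero, kap_zero hy h0,
      kap_zero hy h0', hk1, if_pos rfl]
    simp only [Nat.add_sub_cancel, hσ, Nat.cast_zero, add_zero, zero_add, Nat.cast_one,
      Nat.sub_zero]
    ring

end

end

/-! ### Level systems: cycles, complete classes and their sums. -/

noncomputable section

set_option linter.unusedSectionVars false

/-- The combinatorial data of a system of equations that is solved level by level: at level `k`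
the unknowns are indexed by `T k`, the equations by `E k`. -/
structure LevelSystem (G H : Type) [CommRing G] [CommRing H] where
  cl : G →+* H
  w : G
  T : ℕ → Finset G
  E : ℕ → Finset G
  pin : ℕ → Prop
  base : G
  y : ℕ → ℂ
  y_zero : y 0 = 1
  y_one : y 1 ≠ 0
  cl_w : cl w = 0
  orbit : ∀ r r', cl r = cl r' → ∃ j : ℕ, r' = r + j • w
  step : ∀ i i' : H, ∃ j : ℕ, i' = i + j
  left_mem : ∀ k, ∀ r ∈ E k, r ∈ T k
  right_mem : ∀ k, ∀ r ∈ E k, r + w ∈ T k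
  exists_incomplete : ∀ k, ∃ r, ∀ r', cl r' = cl r → ∃ r'', cl r'' = cl r ∧ r'' ∉ E k
  incomplete_one : ∀ i, ∃ r, cl r = i ∧ r ∉ E 1
  mem_left_of_complete : ∀ k r, 1 ≤ k → (∀ r', cl r' = cl r → r' ∈ E (k + 1)) →
    r + (k : G) ∉ E 1 → r ∈ T k
  mem_right_of_complete : ∀ k r, 1 ≤ k → (∀ r', cl r' = cl r → r' ∈ E (k + 1)) →
    r ∉ E 1 → r + w + 1 ∈ T k
  pin_mem : ∀ k, pin k → base ∈ T k

namespace LevelSystem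

variable {G H : Type} [CommRing G] [CommRing H] [Fintype G] [Fintype H] (S : LevelSystem G H)

open Classical in
/-- The classes all of whose members carry an equation. -/
def B (k : ℕ) : Finset H := {i | ∀ r, S.cl r = i → r ∈ S.E k}

theorem mem_B {k : ℕ} {i : H} : i ∈ S.B k ↔ ∀ r, S.cl r = i → r ∈ S.E k := by
  simp [B]

theorem cl_add_w (r : G) : S.cl (r + S.w) = S.cl r := by rw [map_add, S.cl_w, add_zero]

theorem exists_notMem_B (k : ℕ) : ∃ i, i ∉ S.B k := by
  obtain ⟨r, hr⟩ := S.exists_incomplete k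
  obtain ⟨r', h1, h2⟩ := hr r rfl
  exact ⟨S.cl r, fun h => h2 (S.mem_B.1 h r' h1)⟩

/-- Admissibility in abstract form: the induction on levels starts without obstruction. -/
theorem B_one : S.B 1 = ∅ := by
  refine Finset.eq_empty_of_forall_notMem fun i hi => ?_
  obtain ⟨r, h1, h2⟩ := S.incomplete_one i
  exact h2 (S.mem_B.1 hi r h1)

open Classical in
/-- The classes that contain an unknown. -/
def I (k : ℕ) : Finset H := (S.T k).image S.cl

theorem mem_I_of_mem {k : ℕ} {r : G} (h : r ∈ S.T k) : S.cl r ∈ S.I k := by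
  classical
  exact Finset.mem_image_of_mem _ h

open Classical in
/-- An unknown in each class that has one. -/
def root (k : ℕ) (i : H) : G := if h : ∃ r ∈ S.T k, S.cl r = i then h.choose else 0

theorem root_spec {k : ℕ} {i : H} (h : i ∈ S.I k) :
    S.root k i ∈ S.T k ∧ S.cl (S.root k i) = i := by
  classical
  have h' : ∃ r ∈ S.T k, S.cl r = i := by simpa [I] using h
  rw [root, dif_pos h']
  exact h'.choose_spec

theorem B_subset_I (k : ℕ) : S.B k ⊆ S.I k := by
  intro i hi
  obtain ⟨r, rfl, -⟩ := S.incomplete_one i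
  exact S.mem_I_of_mem (S.left_mem k r (S.mem_B.1 hi r rfl))

/-- The two constants that are to remove the obstruction of the class `i` at level `k + 1` are
available at level `k`. -/
theorem mem_I_of_mem_B_succ {k : ℕ} (hk : 1 ≤ k) {i : H} (hi : i ∈ S.B (k + 1)) :
    i ∈ S.I k ∧ i + 1 ∈ S.I k := by
  obtain ⟨r, hr, hr1⟩ := S.incomplete_one (i + k)
  obtain ⟨r', hr', hr1'⟩ := S.incomplete_one i
  constructor
  · have h1 : S.cl (r - k) = i := by rw [map_sub, hr, map_natCast, add_sub_cancel_right]
    have := S.mem_I_of_mem (S.mem_left_of_complete k (r - k) hk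
      (fun r'' h => S.mem_B.1 hi r'' (h.trans h1)) (by rwa [sub_add_cancel]))
    rwa [h1] at this
  · have := S.mem_I_of_mem (S.mem_right_of_complete k r' hk
      (fun r'' h => S.mem_B.1 hi r'' (h.trans hr')) hr1')
    rwa [map_add, cl_add_w, hr', map_one] at this

open Classical in
/-- The equations left when one is dropped in each complete class. -/
def E' (k : ℕ) : Finset G := (S.E k) \ (S.B k).image (S.root k)

theorem mem_E' {k : ℕ} {r : G} : r ∈ S.E' k ↔ r ∈ S.E k ∧ ∀ i ∈ S.B k, S.root k i ≠ r := by
  simp [E']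

theorem card_E' (k : ℕ) : (S.E' k).card + (S.B k).card = (S.E k).card := by
  classical
  have h1 : ((S.B k).image (S.root k)).card = (S.B k).card := by
    refine Finset.card_image_of_injOn fun i hi j hj hij => ?_
    rw [← (S.root_spec (S.B_subset_I k hi)).2, ← (S.root_spec (S.B_subset_I k hj)).2]
    exact congrArg _ hij
  have h2 : (S.B k).image (S.root k) ⊆ S.E k := by
    refine Finset.image_subset_iff.2 fun i hi => ?_
    exact S.mem_B.1 hi _ (S.root_spec (S.B_subset_I k hi)).2
  rw [← h1]
  exact Finset.card_sdiff_add_card_eq_card h2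

/-- Each class is a single orbit of `r ↦ r + w`, and at least one of its edges is missing: either by
incompleteness or because it was dropped. -/
theorem exists_iterate_notMem_E' (k : ℕ) (r : G) : ∃ j, (fun r => r + S.w)^[j] r ∉ S.E' k := by
  have key : ∃ r', S.cl r = S.cl r' ∧ r' ∉ S.E' k := by
    by_cases h : S.cl r ∈ S.B k
    · exact ⟨_, (S.root_spec (S.B_subset_I k h)).2.symm, fun h' => (S.mem_E'.1 h').2 _ h rfl⟩
    · rw [mem_B] at h
      push Not at h
      obtain ⟨r', h1, h2⟩ := h
      exact ⟨r', h1.symm, fun h' => h2 (S.mem_E'.1 h').1⟩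
  obtain ⟨r', h1, h2⟩ := key
  obtain ⟨j, rfl⟩ := S.orbit r r' h1
  exact ⟨j, by simpa using h2⟩

/-- Differences along paths can be prescribed freely, and a constant added on a class adjusts the
value at its root without disturbing them. So edges and roots give independent forms. -/
theorem exists_edge_forms (k : ℕ) : ∃ N : ℕ, N + (S.E' k).card + (S.I k).card = (S.T k).card ∧
    ∃ P : Fin N → G → ℂ, ∀ (A : Type) [CommRing A] [Algebra ℂ A] (c : G → A) (p : Fin N → A),
      ∃! v : G → A, (∀ r, r ∉ S.T k → v r = 0) ∧ (∀ r ∈ S.E' k, v r - v (r + S.w) = c r) ∧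
        (∀ i ∈ S.I k, v (S.root k i) = 0) ∧ ∀ i, ∑ r, P i r • v r = p i := by
  classical
  let L : S.E' k ⊕ S.I k → G → ℂ := Sum.elim
    (fun r x => (if x = r then 1 else 0) - (if x = r + S.w then 1 else 0))
    (fun i x => if x = S.root k i then 1 else 0)
  have hl : ∀ (A : Type) [CommRing A] [Algebra ℂ A] (v : G → A) (r : S.E' k),
      ∑ x, L (Sum.inl r) x • v x = v r - v (r + S.w) := by
    intro A _ _ v r
    simp [L, sub_smul, Finset.sum_sub_distrib, ite_smul]
  have hr : ∀ (A : Type) [CommRing A] [Algebra ℂ A] (v : G → A) (i : S.I k),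
      ∑ x, L (Sum.inr i) x • v x = v (S.root k i) := by
    intro A _ _ v r
    simp [L, ite_smul]
  obtain ⟨N, hN, P, hP⟩ := exists_complementary_forms (S.T k) L (by
    intro c
    let c' : G → ℂ := fun r => if h : r ∈ S.E' k then c (Sum.inl ⟨r, h⟩) else 0
    let b : H → ℂ := fun i => if h : i ∈ S.I k then c (Sum.inr ⟨i, h⟩) else 0
    obtain ⟨u, hu⟩ := exists_prescribed_differences (fun r => r + S.w) (S.E' k : Set G)
      (fun r => S.exists_iterate_notMem_E' k r) c'
    refine ⟨fun r => if r ∈ S.T k then u r - u (S.root k (S.cl r)) + b (S.cl r) else 0,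
      fun r hr => if_neg hr, ?_⟩
    rintro (⟨r, hrE⟩ | ⟨i, hi⟩)
    · rw [hl ℂ]
      have h1 := (S.mem_E'.1 hrE).1
      have h2 := hu r hrE
      rw [if_pos (S.left_mem k r h1), if_pos (S.right_mem k r h1), cl_add_w]
      have h3 : c' r = c (Sum.inl ⟨r, hrE⟩) := dif_pos hrE
      rw [← h3, ← h2]
      ring
    · rw [hr ℂ]
      have h1 := S.root_spec hi
      have h3 : b i = c (Sum.inr ⟨i, hi⟩) := dif_pos hi
      simp only [h1.1, h1.2, if_true, sub_self, zero_add, h3])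
  refine ⟨N, by simpa [add_assoc] using hN, P, fun A _ _ c p => ?_⟩
  have h := hP A (Sum.elim (fun r => c r) 0) p
  refine (existsUnique_congr fun v => ?_).1 h
  constructor
  · rintro ⟨h1, h2, h3⟩
    exact ⟨h1, fun r hr => (hl A v ⟨r, hr⟩).symm.trans (h2 (Sum.inl ⟨r, hr⟩)),
      fun i hi => (hr A v ⟨i, hi⟩).symm.trans (h2 (Sum.inr ⟨i, hi⟩)), h3⟩
  · rintro ⟨h1, h2, h3, h4⟩
    refine ⟨h1, ?_, h4⟩
    rintro (⟨r, hrE⟩ | ⟨i, hi⟩)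
    · exact (hl A v _).trans (h2 r hrE)
    · exact (hr A v _).trans (h3 i hi)

-- The same argument one storey higher, on classes with edges i → i + 1. Complete classes never fill
-- `H`, so the orbits escape; a global constant then meets the condition at the class of `base`.
open Classical in
theorem exists_class_forms (k : ℕ) (hk : 1 ≤ k) : ∃ N : ℕ,
    N + (S.B (k + 1)).card + (if S.pin k then 1 else 0) = (S.I k).card ∧
    ∃ P : Fin N → H → ℂ, ∀ (A : Type) [CommRing A] [Algebra ℂ A] (c : H → A) (a : A)
      (p : Fin N → A), ∃! s : H → A, (∀ i, i ∉ S.I k → s i = 0) ∧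
        (∀ i ∈ S.B (k + 1), s i - s (i + 1) = c i) ∧ (S.pin k → s (S.cl S.base) = a) ∧
        ∀ i, ∑ r, P i r • s r = p i := by
  let L : S.B (k + 1) ⊕ {_u : Unit // S.pin k} → H → ℂ := Sum.elim
    (fun r x => (if x = r then 1 else 0) - (if x = r + 1 then 1 else 0))
    (fun _ x => if x = S.cl S.base then 1 else 0)
  have hl : ∀ (A : Type) [CommRing A] [Algebra ℂ A] (v : H → A) (r : S.B (k + 1)),
      ∑ x, L (Sum.inl r) x • v x = v r - v (r + 1) := by
    intro A _ _ v r
    simp [L, sub_smul, Finset.sum_sub_distrib, ite_smul]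
  have hr : ∀ (A : Type) [CommRing A] [Algebra ℂ A] (v : H → A) u,
      ∑ x, L (Sum.inr u) x • v x = v (S.cl S.base) := by
    intro A _ _ v r
    simp [L, ite_smul]
  have hit : ∀ (j : ℕ) (i : H), (fun i : H => i + 1)^[j] i = i + j := by
    intro j i
    induction j generalizing i with
    | zero => simp
    | succ j ih => rw [Function.iterate_succ_apply, ih]; push_cast; ring
  obtain ⟨N, hN, P, hP⟩ := exists_complementary_forms (S.I k) L (by
    intro c
    let c' : H → ℂ := fun r => if h : r ∈ S.B (k + 1) then c (Sum.inl ⟨r, h⟩) else 0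
    let b : ℂ := if h : S.pin k then c (Sum.inr ⟨(), h⟩) else 0
    obtain ⟨u, hu⟩ := exists_prescribed_differences (fun i : H => i + 1) (S.B (k + 1) : Set H)
      (fun i => by
        obtain ⟨i₀, h₀⟩ := S.exists_notMem_B (k + 1)
        obtain ⟨j, rfl⟩ := S.step i i₀
        exact ⟨j, by rw [hit]; simpa using h₀⟩) c'
    refine ⟨fun i => if i ∈ S.I k then u i - u (S.cl S.base) + b else 0,
      fun r hr => if_neg hr, ?_⟩
    rintro (⟨i, hi⟩ | ⟨u', hp⟩)
    · rw [hl ℂ]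
      have h1 := S.mem_I_of_mem_B_succ hk hi
      have h2 := hu i hi
      rw [if_pos h1.1, if_pos h1.2]
      have h3 : c' i = c (Sum.inl ⟨i, hi⟩) := dif_pos hi
      rw [← h3, ← h2]
      ring
    · rw [hr ℂ, if_pos (S.mem_I_of_mem (S.pin_mem k hp))]
      have h3 : b = c (Sum.inr ⟨(), hp⟩) := dif_pos hp
      rw [h3, sub_self, zero_add])
  have hcard : Fintype.card {_u : Unit // S.pin k} = if S.pin k then 1 else 0 := by
    by_cases h : S.pin k <;> simp [h, Fintype.card_subtype]
  refine ⟨N, ?_, P, fun A _ _ c a p => ?_⟩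
  · rw [Fintype.card_sum, hcard, Fintype.card_coe] at hN
    rw [← hN, add_assoc]
  have h := hP A (Sum.elim (fun r => c r) fun _ => a) p
  refine (existsUnique_congr fun v => ?_).1 h
  constructor
  · rintro ⟨h1, h2, h3⟩
    exact ⟨h1, fun r hr => (hl A v ⟨r, hr⟩).symm.trans (h2 (Sum.inl ⟨r, hr⟩)),
      fun hp => (hr A v ⟨(), hp⟩).symm.trans (h2 (Sum.inr ⟨(), hp⟩)), h3⟩
  · rintro ⟨h1, h2, h3, h4⟩
    refine ⟨h1, ?_, h4⟩
    rintro (⟨r, hrE⟩ | ⟨u, hp⟩)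
    · exact (hl A v _).trans (h2 r hrE)
    · exact (hr A v _).trans (h3 hp)

/-! ### The equations -/

open Classical in
/-- The sum over a class. -/
def clSum {A : Type} [AddCommMonoid A] (i : H) (f : G → A) : A := ∑ r with S.cl r = i, f r

section

variable {A : Type} [CommRing A] [Algebra ℂ A]

theorem clSum_congr {i : H} {f g : G → A} (h : ∀ r, S.cl r = i → f r = g r) :
    S.clSum i f = S.clSum i g := by
  classical
  exact Finset.sum_congr rfl fun r hr => h r (Finset.mem_filter.1 hr).2

theorem clSum_add (i : H) (f g : G → A) :
    S.clSum i (fun r => f r + g r) = S.clSum i f + S.clSum i g := Finset.sum_add_distrib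

theorem clSum_sub (i : H) (f g : G → A) :
    S.clSum i (fun r => f r - g r) = S.clSum i f - S.clSum i g := Finset.sum_sub_distrib _ _

theorem clSum_mul (i : H) (a : A) (f : G → A) :
    S.clSum i (fun r => a * f r) = a * S.clSum i f := (Finset.mul_sum _ _ _).symm

theorem clSum_shift (i : H) (f : G → A) : S.clSum i (fun r => f (r + S.w)) = S.clSum i f := by
  refine Finset.sum_equiv (Equiv.addRight S.w) (fun r => ?_) fun r _ => rfl
  simp [cl_add_w]

/-- The family cancels around the class; only the subleading coefficient of y survives, and this
value is independent of the solution. -/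
theorem clSum_kap_one {Λ : G → ℕ → A} (h0 : ∀ r, Λ r 0 = 1) (i : H) (a : G) :
    S.clSum i (fun r => kap S.y S.w Λ (r + a) 1) = algebraMap ℂ A (S.clSum i (fun _ => S.y 1)) := by
  have : (fun r => kap S.y S.w Λ (r + a) 1) = fun r =>
      algebraMap ℂ A (S.y 1) + (Λ (r + a) 1 - Λ (r + S.w + a) 1) := by
    funext r
    rw [kap_one S.y_zero h0, add_right_comm r S.w a]
    ring
  rw [this, clSum_add, clSum_sub, S.clSum_shift i fun r => Λ (r + a) 1, sub_self, add_zero]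
  simp [clSum]

theorem clSum_y_ne_zero (i : H) : S.clSum i (fun _ => S.y 1) ≠ 0 := by
  classical
  obtain ⟨r, hr, -⟩ := S.incomplete_one i
  rw [clSum, Finset.sum_const, nsmul_eq_mul]
  refine mul_ne_zero (Nat.cast_ne_zero.2 (Finset.card_ne_zero.2 ⟨r, ?_⟩)) S.y_one
  simpa using hr

/-- The effect on a class sum at level `k + 1` of a change at level `k`. -/
theorem clSum_kap_change {Λ Λ' : G → ℕ → A} (h0 : ∀ r, Λ r 0 = 1) {k : ℕ} (hk : 1 ≤ k)
    (σ : G → A) (h : ∀ r, ∀ j < k, Λ' r j = Λ r j) (hσ : ∀ r, Λ' r k = Λ r k + σ r) (i : H) :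
    S.clSum i (fun r => kap S.y S.w Λ' r (k + 1)) = S.clSum i (fun r => kap S.y S.w Λ r (k + 1)) +
      S.clSum i (fun r => σ r * kap S.y S.w Λ (r + k) 1) -
      S.clSum i (fun r => kap S.y S.w Λ r 1 * σ (r + S.w + 1)) -
      S.clSum i (fun r => if k = 1 then (σ r - σ (r + S.w)) * σ (r + S.w + 1) else 0) := by
  have e : (fun r => kap S.y S.w Λ' r (k + 1)) = fun r => kap S.y S.w Λ r (k + 1) +
      ((Λ' r (k + 1) - Λ r (k + 1)) - (Λ' (r + S.w) (k + 1) - Λ (r + S.w) (k + 1)) +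
      (S.y 1 • σ r - kap S.y S.w Λ r 1 * σ (r + S.w + 1) -
      (σ r * Λ (r + S.w + k) 1 - σ (r + S.w) * Λ (r + S.w + k) 1) -
      if k = 1 then (σ r - σ (r + S.w)) * σ (r + S.w + 1) else 0)) := by
    funext r
    rw [kap_succ_change S.y_zero h0 hk σ h hσ]
    ring
  have e2 : (fun r => σ r * kap S.y S.w Λ (r + k) 1) = fun r =>
      S.y 1 • σ r - (σ r * Λ (r + S.w + k) 1 - σ r * Λ (r + k) 1) := by
    funext r
    rw [kap_one S.y_zero h0, Algebra.smul_def, add_right_comm r S.w]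
    ring
  rw [e, e2]
  simp only [clSum_add, clSum_sub]
  rw [S.clSum_shift i fun r => Λ' r (k + 1), S.clSum_shift i fun r => Λ r (k + 1),
    S.clSum_shift i fun r => σ r * Λ (r + k) 1]
  ring

open Classical in
/-- The extension of a function on classes to the unknowns. -/
def ext (k : ℕ) (s : H → A) (r : G) : A := if r ∈ S.T k then s (S.cl r) else 0

/-- Where the extension of `s` is cut off to zero, the factor at level 1 multiplying it vanishes, by
completeness of the class. So `s` may be treated as constant on whole classes, and `clSum_kap_one`
evaluates both linear terms. The resulting coefficient of `s i - s (i + 1)` is nonzero by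
`clSum_y_ne_zero`. -/
theorem clSum_kap_ext {Λ Λ' : G → ℕ → A} (h0 : ∀ r, Λ r 0 = 1) {k : ℕ} (hk : 1 ≤ k)
    (s : H → A) (hE : ∀ r ∈ S.E 1, kap S.y S.w Λ r 1 = 0) (h : ∀ r, ∀ j < k, Λ' r j = Λ r j)
    (hσ : ∀ r, Λ' r k = Λ r k + S.ext k s r) {i : H} (hi : i ∈ S.B (k + 1)) :
    S.clSum i (fun r => kap S.y S.w Λ' r (k + 1)) = S.clSum i (fun r => kap S.y S.w Λ r (k + 1)) +
      algebraMap ℂ A (S.clSum i (fun _ => S.y 1)) * (s i - s (i + 1)) := by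
  have hB := S.mem_B.1 hi
  rw [S.clSum_kap_change h0 hk _ h hσ]
  have e1 : S.clSum i (fun r => S.ext k s r * kap S.y S.w Λ (r + k) 1) =
      S.clSum i (fun r => s i * kap S.y S.w Λ (r + k) 1) := by
    refine S.clSum_congr fun r hr => ?_
    by_cases hrT : r ∈ S.T k
    · rw [ext, if_pos hrT, hr]
    · rw [hE, mul_zero, mul_zero]
      by_contra hc
      exact hrT (S.mem_left_of_complete k r hk (fun r' h => hB r' (h.trans hr)) hc)
  have hcl : ∀ r, S.cl (r + S.w + 1) = S.cl r + 1 := fun r => by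
    rw [map_add, cl_add_w, map_one]
  have e2 : S.clSum i (fun r => kap S.y S.w Λ r 1 * S.ext k s (r + S.w + 1)) =
      S.clSum i (fun r => s (i + 1) * kap S.y S.w Λ (r + 0) 1) := by
    refine S.clSum_congr fun r hr => ?_
    rw [add_zero]
    by_cases hrT : r + S.w + 1 ∈ S.T k
    · rw [ext, if_pos hrT, hcl, hr, mul_comm]
    · rw [hE, zero_mul, mul_zero]
      by_contra hc
      exact hrT (S.mem_right_of_complete k r hk (fun r' h => hB r' (h.trans hr)) hc)
  -- For the quadratic term: either the last factor is the constant `s (i + 1)` and the differences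
  -- telescope around the class, or `r` carries an equation at level 1 and the difference itself is
  -- zero.
  have e3 : S.clSum i (fun r => if k = 1 then
      (S.ext k s r - S.ext k s (r + S.w)) * S.ext k s (r + S.w + 1) else 0) = 0 := by
    by_cases h1 : k = 1
    · subst h1
      have : S.clSum i (fun r => if 1 = 1 then
          (S.ext 1 s r - S.ext 1 s (r + S.w)) * S.ext 1 s (r + S.w + 1) else 0) =
          S.clSum i (fun r => s (i + 1) * (S.ext 1 s r - S.ext 1 s (r + S.w))) := by
        refine S.clSum_congr fun r hr => ?_
        rw [if_pos rfl]
        by_cases hrT : r + S.w + 1 ∈ S.T 1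
        · rw [mul_comm]
          congr 1
          rw [ext, if_pos hrT, hcl, hr]
        · have hrE : r ∈ S.E 1 := by
            by_contra hc
            exact hrT (S.mem_right_of_complete 1 r hk (fun r' h => hB r' (h.trans hr)) hc)
          rw [ext, ext, if_pos (S.left_mem 1 r hrE), if_pos (S.right_mem 1 r hrE), cl_add_w,
            sub_self, zero_mul, mul_zero]
      rw [this, clSum_mul, clSum_sub, S.clSum_shift i (S.ext 1 s), sub_self, mul_zero]
    · simp [h1, clSum]
  rw [e1, e2, e3, clSum_mul, clSum_mul, S.clSum_kap_one h0, S.clSum_kap_one h0]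
  ring

/-- The equations at level `k`, with the solvability conditions they imply at level `k + 1`. -/
structure IsLevel (Λ : G → ℕ → A) (k : ℕ) : Prop where
  supp : ∀ r, r ∉ S.T k → Λ r k = 0
  edge : ∀ r ∈ S.E k, kap S.y S.w Λ r k = 0
  pinned : S.pin k → red Λ S.base (fun j => if j = 0 then 1 else 0) k = 0
  sum : ∀ i ∈ S.B (k + 1), S.clSum i (fun r => kap S.y S.w Λ r (k + 1)) = 0

/-- The unknowns of level `k + 1` cancel around a class. The solvability condition for level `k + 1`
is therefore a condition on lower levels, which allows `IsLevel` to include it at level `k`. -/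
theorem clSum_kap_succ_congr {Λ Λ' : G → ℕ → A} (h0 : ∀ r, Λ r 0 = 1) {k : ℕ}
    (h : ∀ r, ∀ j ≤ k, Λ' r j = Λ r j) (i : H) :
    S.clSum i (fun r => kap S.y S.w Λ' r (k + 1)) =
      S.clSum i (fun r => kap S.y S.w Λ r (k + 1)) := by
  have e : (fun r => kap S.y S.w Λ' r (k + 1)) = fun r => kap S.y S.w Λ r (k + 1) +
      ((Λ' r (k + 1) - Λ r (k + 1)) - (Λ' (r + S.w) (k + 1) - Λ (r + S.w) (k + 1))) := by
    funext r
    rw [kap_change (Λ' := Λ') S.y_zero h0 (by omega) fun r j hj => h r j (by omega)]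
    ring
  rw [e, clSum_add, clSum_sub]
  rw [S.clSum_shift i fun r => Λ' r (k + 1) - Λ r (k + 1), sub_self, add_zero]

theorem IsLevel.congr {S : LevelSystem G H} {Λ Λ' : G → ℕ → A} (h0 : ∀ r, Λ r 0 = 1) {k : ℕ}
    (hΛ : S.IsLevel Λ k) (h : ∀ r, ∀ j ≤ k, Λ' r j = Λ r j) : S.IsLevel Λ' k where
  supp r hr := by rw [h r k le_rfl, hΛ.supp r hr]
  edge r hr := by rw [kap_congr _ _ _ _ h, hΛ.edge r hr]
  pinned hp := by
    rw [red_congr (Λ' := Λ) _ _ (fun j _ => rfl) fun r j hj _ => h r j hj, hΛ.pinned hp]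
  sum i hi := by rw [S.clSum_kap_succ_congr h0 h, hΛ.sum i hi]

theorem IsLevel.map {S : LevelSystem G H} {A' : Type} [CommRing A'] [Algebra ℂ A']
    (f : A →ₐ[ℂ] A') {Λ : G → ℕ → A} {k : ℕ}
    (hΛ : S.IsLevel Λ k) : S.IsLevel (fun r j => f (Λ r j)) k where
  supp r hr := by rw [hΛ.supp r hr, map_zero]
  edge r hr := by rw [← kap_map, hΛ.edge r hr, map_zero]
  pinned hp := by
    have h := congrArg f (hΛ.pinned hp)
    rw [map_zero, ← RingHom.coe_coe f, red_map] at h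
    refine Eq.trans ?_ h
    congr 1
    funext j
    split_ifs <;> simp
  sum i hi := by
    have h := congrArg f (hΛ.sum i hi)
    rw [map_zero, clSum, map_sum] at h
    rw [← h]
    exact S.clSum_congr fun r _ => (kap_map f _ _ _ _ _).symm

end

end LevelSystem

end

/-! ### Solving one level and assembling the levels. -/

noncomputable section

set_option linter.unusedSectionVars false

namespace LevelSystem

variable {G H : Type} [CommRing G] [CommRing H] [Fintype G] [Fintype H] (S : LevelSystem G H)

section

variable {A : Type} [CommRing A] [Algebra ℂ A]

/-- Around a complete cycle the differences of `v` sum to zero, so the dropped equation is minus the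
sum of the others. -/
theorem edge_of_E' {k : ℕ} (ε v : G → A) (hε : ∀ i ∈ S.B k, S.clSum i ε = 0)
    (h : ∀ r ∈ S.E' k, ε r + v r - v (r + S.w) = 0) :
    ∀ r ∈ S.E k, ε r + v r - v (r + S.w) = 0 := by
  classical
  intro r hr
  by_cases hr' : r ∈ S.E' k
  · exact h r hr'
  · have h1 : ∃ i ∈ S.B k, S.root k i = r := by
      by_contra hc
      push Not at hc
      exact hr' (S.mem_E'.2 ⟨hr, hc⟩)
    obtain ⟨i, hi, rfl⟩ := h1
    have h2 : S.clSum i (fun r => ε r + v r - v (r + S.w)) = 0 := by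
      rw [clSum_sub, clSum_add, S.clSum_shift i v, hε i hi, zero_add, sub_self]
    rw [clSum, Finset.sum_eq_single (S.root k i)] at h2
    · exact h2
    · intro r hri hne
      have hri : S.cl r = i := (Finset.mem_filter.1 hri).2
      refine h r (S.mem_E'.2 ⟨S.mem_B.1 hi r hri, fun j hj hjr => hne ?_⟩)
      have h3 := (S.root_spec (S.B_subset_I k hj)).2
      rw [hjr, hri] at h3
      rw [h3, hjr]
    · intro hc
      exact (hc (Finset.mem_filter.2 ⟨Finset.mem_univ _,
        (S.root_spec (S.B_subset_I k hi)).2⟩)).elim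

theorem ext_sub_ext {k : ℕ} (s : H → A) {r : G} (hr : r ∈ S.E k) :
    S.ext k s r - S.ext k s (r + S.w) = 0 := by
  rw [ext, ext, if_pos (S.left_mem k r hr), if_pos (S.right_mem k r hr), cl_add_w, sub_self]

/-- Replacing level `k`. -/
def upd (Λ : G → ℕ → A) (k : ℕ) (v : G → A) (r : G) (j : ℕ) : A := if j = k then v r else Λ r j

theorem upd_of_lt (Λ : G → ℕ → A) {k : ℕ} (v : G → A) (r : G) {j : ℕ} (h : j < k) :
    upd Λ k v r j = Λ r j := if_neg h.ne

theorem upd_self (Λ : G → ℕ → A) (k : ℕ) (v : G → A) (r : G) : upd Λ k v r k = v r := if_pos rfl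

/-- The level `k` equations in terms of a vector vanishing at the roots and a function on
classes. -/
theorem isLevel_upd_iff {k : ℕ} (hk : 1 ≤ k) {Λ : G → ℕ → A} (h0 : ∀ r, Λ r 0 = 1)
    (hΛ : ∀ j, 1 ≤ j → j < k → S.IsLevel Λ j) (v₀ : G → A) (s : H → A)
    (hv₀ : ∀ r, r ∉ S.T k → v₀ r = 0) :
    S.IsLevel (upd Λ k fun r => v₀ r + S.ext k s r) k ↔
      (∀ r ∈ S.E' k, v₀ r - v₀ (r + S.w) = - kap S.y S.w (upd Λ k 0) r k) ∧
      (∀ i ∈ S.B (k + 1), s i - s (i + 1) = -((S.clSum i (fun _ => S.y 1))⁻¹ •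
        S.clSum i (fun r => kap S.y S.w (upd Λ k v₀) r (k + 1)))) ∧
      (S.pin k → s (S.cl S.base) =
        red (upd Λ k 0) S.base (fun j => if j = 0 then 1 else 0) k - v₀ S.base) := by
  set v : G → A := fun r => v₀ r + S.ext k s r with hv
  have hupd0 : ∀ v : G → A, ∀ r, upd Λ k v r 0 = 1 := fun v r => by
    rw [upd_of_lt Λ v r (by omega), h0]
  have hkap : ∀ v : G → A, ∀ r, kap S.y S.w (upd Λ k v) r k =
      kap S.y S.w (upd Λ k 0) r k + v r - v (r + S.w) := by
    intro v r
    rw [kap_change (Λ := upd Λ k 0) S.y_zero (hupd0 0) hk fun r j hj => by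
      rw [upd_of_lt _ _ _ hj, upd_of_lt _ _ _ hj]]
    simp only [upd_self, Pi.zero_apply]
    ring
  have hε : ∀ i ∈ S.B k, S.clSum i (fun r => kap S.y S.w (upd Λ k 0) r k) = 0 := by
    intro i hi
    obtain ⟨k, rfl⟩ : ∃ j, k = j + 1 := ⟨k - 1, by omega⟩
    rw [S.clSum_kap_succ_congr h0 fun r j hj => upd_of_lt _ _ _ (by omega)]
    -- At level 1 there are no complete classes; later, the condition was secured at the preceding
    -- level.
    rcases Nat.eq_zero_or_pos k with rfl | hk0
    · rw [zero_add, B_one] at hi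
      exact absurd hi (Finset.notMem_empty _)
    · exact (hΛ k hk0 (by omega)).sum i hi
  have hred : red (upd Λ k v) S.base (fun j => if j = 0 then 1 else 0) k =
      red (upd Λ k 0) S.base (fun j => if j = 0 then 1 else 0) k - v S.base := by
    rw [red_sub_red (Λ := upd Λ k 0) S.base hk (fun j _ => rfl) fun r j hj => by
      rw [upd_of_lt _ _ _ hj, upd_of_lt _ _ _ hj]]
    simp [upd_self]
  have hext : ∀ r ∈ S.E k, v r - v (r + S.w) = v₀ r - v₀ (r + S.w) := by
    intro r hr
    have := S.ext_sub_ext s hr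
    simp only [hv]
    linear_combination this
  have hsupp : ∀ r, r ∉ S.T k → v r = 0 := by
    intro r hr
    simp [hv, hv₀ r hr, ext, hr]
  have hsum : (∀ r ∈ S.E k, kap S.y S.w (upd Λ k v₀) r k = 0) → ∀ i ∈ S.B (k + 1),
      (S.clSum i (fun r => kap S.y S.w (upd Λ k v) r (k + 1)) = 0 ↔
        s i - s (i + 1) = -((S.clSum i (fun _ => S.y 1))⁻¹ •
        S.clSum i (fun r => kap S.y S.w (upd Λ k v₀) r (k + 1)))) := by
    intro hE i hi
    have hE1 : ∀ r ∈ S.E 1, kap S.y S.w (upd Λ k v₀) r 1 = 0 := by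
      -- The formula for class sums needs the equations of level 1. For `k = 1` these are the
      -- equations being solved, which is why `hE` is assumed.
      rcases Nat.lt_or_eq_of_le hk with h | rfl
      · intro r hr
        rw [kap_congr (Λ' := Λ) _ _ _ _ fun r j hj => upd_of_lt _ _ _ (by omega)]
        exact (hΛ 1 le_rfl h).edge r hr
      · exact hE
    rw [S.clSum_kap_ext (Λ := upd Λ k v₀) (Λ' := upd Λ k v) (hupd0 _) hk s hE1
      (fun r j hj => by rw [upd_of_lt _ _ _ hj, upd_of_lt _ _ _ hj])
      (fun r => by rw [upd_self, upd_self]) hi]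
    have hne := S.clSum_y_ne_zero i
    set a := S.clSum i (fun _ => S.y 1)
    set K := S.clSum i (fun r => kap S.y S.w (upd Λ k v₀) r (k + 1))
    have ha : algebraMap ℂ A a⁻¹ * algebraMap ℂ A a = 1 := by
      rw [← map_mul, inv_mul_cancel₀ hne, map_one]
    rw [Algebra.smul_def]
    constructor
    · intro h
      linear_combination (algebraMap ℂ A a⁻¹) * h - (s i - s (i + 1)) * ha
    · intro h
      linear_combination (algebraMap ℂ A a) * h - K * ha
  constructor
  · intro h
    have hE : ∀ r ∈ S.E k, v₀ r - v₀ (r + S.w) = - kap S.y S.w (upd Λ k 0) r k := by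
      intro r hr
      have h1 := h.edge r hr
      rw [hkap] at h1
      rw [← hext r hr]
      linear_combination h1
    have hE₀ : ∀ r ∈ S.E k, kap S.y S.w (upd Λ k v₀) r k = 0 := by
      intro r hr
      rw [hkap]
      linear_combination hE r hr
    refine ⟨fun r hr => hE r (S.mem_E'.1 hr).1, fun i hi => (hsum hE₀ i hi).1 (h.sum i hi), ?_⟩
    intro hp
    have h1 := h.pinned hp
    rw [hred] at h1
    have h2 : v S.base = v₀ S.base + s (S.cl S.base) := by
      simp [hv, ext, S.pin_mem k hp]
    rw [h2] at h1
    linear_combination -h1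
  · rintro ⟨h1, h2, h3⟩
    have hE := S.edge_of_E' (fun r => kap S.y S.w (upd Λ k 0) r k) v₀ hε fun r hr => by
      linear_combination h1 r hr
    have hE₀ : ∀ r ∈ S.E k, kap S.y S.w (upd Λ k v₀) r k = 0 := by
      intro r hr
      rw [hkap]
      exact hE r hr
    refine ⟨fun r hr => by rw [upd_self, hsupp r hr], fun r hr => ?_, fun hp => ?_,
      fun i hi => (hsum hE₀ i hi).2 (h2 i hi)⟩
    · rw [hkap]
      linear_combination hE r hr + hext r hr
    · have h4 : v S.base = v₀ S.base + s (S.cl S.base) := by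
        simp [hv, ext, S.pin_mem k hp]
      rw [hred, h4, h3 hp]
      ring

end

open Classical in
/-- Linear forms parametrizing the solutions at level `k` over a solution at lower levels. -/
theorem exists_level_forms (k : ℕ) (hk : 1 ≤ k) : ∃ (ι : Type) (_ : Fintype ι),
    (Fintype.card ι : ℤ) = (S.T k).card - (S.E k).card + (S.B k).card - (S.B (k + 1)).card -
      (if S.pin k then 1 else 0) ∧
    ∃ P : ι → G → ℂ, ∀ (A : Type) [CommRing A] [Algebra ℂ A] (Λ : G → ℕ → A),
      (∀ r, Λ r 0 = 1) → (∀ j, 1 ≤ j → j < k → S.IsLevel Λ j) → ∀ p : ι → A,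
        ∃! v : G → A, S.IsLevel (upd Λ k v) k ∧ ∀ i, ∑ r, P i r • v r = p i := by
  obtain ⟨Nu, hNu, Pu, hPu⟩ := S.exists_edge_forms k
  obtain ⟨Ns, hNs, Ps, hPs⟩ := S.exists_class_forms k hk
  -- A solution splits as `v₀ + ext s`, where `s` records the values at the roots. The edge forms
  -- are applied to `v₀`, the class forms to `s`, and both are rewritten as forms in the sum.
  refine ⟨Fin Nu ⊕ Fin Ns, inferInstance, ?_, Sum.elim
    (fun a x => Pu a x - ∑ r ∈ S.T k, if S.root k (S.cl r) = x then Pu a r else 0)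
    (fun b x => ∑ i ∈ S.I k, if S.root k i = x then Ps b i else 0), ?_⟩
  · have h1 := S.card_E' k
    rw [Fintype.card_sum, Fintype.card_fin, Fintype.card_fin]
    zify at h1 hNu hNs
    push_cast
    linarith
  intro A _ _ Λ h0 hΛ p
  let sOf : (G → A) → H → A := fun v i => if i ∈ S.I k then v (S.root k i) else 0
  have hPinl : ∀ (v : G → A) a,
      ∑ x, (Pu a x - ∑ r ∈ S.T k, if S.root k (S.cl r) = x then Pu a r else 0) • v x =
      ∑ x, Pu a x • (v x - S.ext k (sOf v) x) := by
    intro v a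
    simp only [sub_smul, smul_sub, Finset.sum_sub_distrib]
    congr 1
    simp only [Finset.sum_smul, ite_smul, zero_smul]
    rw [Finset.sum_comm]
    simp only [Finset.sum_ite_eq, Finset.mem_univ, if_true]
    rw [← Finset.sum_subset (Finset.subset_univ (S.T k))]
    · refine Finset.sum_congr rfl fun r hr => ?_
      simp [ext, hr, sOf, S.mem_I_of_mem hr]
    · intro r _ hr
      simp [ext, hr]
  have hPinr : ∀ (v : G → A) b, ∑ x, (∑ i ∈ S.I k, if S.root k i = x then Ps b i else 0) • v x =
      ∑ i, Ps b i • sOf v i := by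
    intro v a
    simp only [Finset.sum_smul, ite_smul, zero_smul]
    rw [Finset.sum_comm]
    simp only [Finset.sum_ite_eq, Finset.mem_univ, if_true]
    rw [← Finset.sum_subset (Finset.subset_univ (S.I k))]
    · refine Finset.sum_congr rfl fun r hr => ?_
      simp [hr, sOf]
    · intro r _ hr
      simp [hr, sOf]
  have hsOf : ∀ (v₀ : G → A) (s : H → A), (∀ i ∈ S.I k, v₀ (S.root k i) = 0) →
      (∀ i, i ∉ S.I k → s i = 0) → sOf (fun r => v₀ r + S.ext k s r) = s := by
    intro v₀ s h1 h2
    funext i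
    by_cases hi : i ∈ S.I k
    · have h3 := S.root_spec hi
      simp [sOf, hi, h1 i hi, ext, h3.1, h3.2]
    · simp [sOf, hi, h2 i hi]
  obtain ⟨v₀, ⟨hv1, hv2, hv3, hv4⟩, hvu⟩ := hPu A
    (fun r => - kap S.y S.w (upd Λ k 0) r k) (fun a => p (Sum.inl a))
  obtain ⟨s, ⟨hs1, hs2, hs3, hs4⟩, hsu⟩ := hPs A
    (fun i => -((S.clSum i (fun _ => S.y 1))⁻¹ •
        S.clSum i (fun r => kap S.y S.w (upd Λ k v₀) r (k + 1))))
    (red (upd Λ k 0) S.base (fun j => if j = 0 then 1 else 0) k - v₀ S.base)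
    (fun b => p (Sum.inr b))
  refine ⟨fun r => v₀ r + S.ext k s r, ⟨?_, ?_⟩, ?_⟩
  · exact (S.isLevel_upd_iff hk h0 hΛ v₀ s hv1).2 ⟨hv2, hs2, hs3⟩
  · rintro (a | b)
    · simp only [Sum.elim_inl]
      rw [hPinl, hsOf v₀ s hv3 hs1, ← hv4 a]
      simp
    · simp only [Sum.elim_inr]
      rw [hPinr, hsOf v₀ s hv3 hs1, ← hs4 b]
  · rintro v ⟨hv, hp⟩
    have hdec : v = fun r => (v r - S.ext k (sOf v) r) + S.ext k (sOf v) r := by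
      funext r; ring
    have hz : ∀ r, r ∉ S.T k → v r - S.ext k (sOf v) r = 0 := by
      intro r hr
      have := hv.supp r hr
      rw [upd_self] at this
      simp [this, ext, hr]
    rw [hdec] at hv
    obtain ⟨h1, h2, h3⟩ := (S.isLevel_upd_iff hk h0 hΛ _ (sOf v) hz).1 hv
    have e1 : (fun r => v r - S.ext k (sOf v) r) = v₀ := by
      refine hvu _ ⟨hz, h1, fun i hi => ?_, fun a => ?_⟩
      · have h3 := S.root_spec hi
        simp [ext, h3.1, h3.2, sOf, hi]
      · rw [← hPinl]
        exact hp (Sum.inl a)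
    rw [e1] at h2
    have e2 : sOf v = s := by
      refine hsu _ ⟨fun i hi => if_neg hi, h2, fun hpin => ?_, fun b => ?_⟩
      · rw [h3 hpin, ← e1]
      · rw [← hPinr]
        exact hp (Sum.inr b)
    rw [hdec, e2]
    funext r
    rw [← congrFun e1 r, e2]

/-- A solution at all levels. -/
structure IsSolution {A : Type} [CommRing A] [Algebra ℂ A] (Λ : G → ℕ → A) : Prop where
  zero : ∀ r, Λ r 0 = 1
  level : ∀ k, 1 ≤ k → S.IsLevel Λ k

theorem IsSolution.map {S : LevelSystem G H} {A A' : Type} [CommRing A] [Algebra ℂ A]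
    [CommRing A'] [Algebra ℂ A'] (f : A →ₐ[ℂ] A') {Λ : G → ℕ → A} (h : S.IsSolution Λ) :
    S.IsSolution (fun r j => f (Λ r j)) :=
  ⟨fun r => by rw [h.zero, map_one], fun k hk => (h.level k hk).map f⟩

-- The terms |B k| - |B (k + 1)| telescope, starting from B 1 = ∅. The forms are chosen before the
-- algebra, so they serve all algebras at once. Uniqueness concerns levels up to `K` only.
open Classical in
theorem exists_forms_upto (K : ℕ) : ∃ (ι : Type) (_ : Fintype ι),
    (Fintype.card ι : ℤ) = ∑ k ∈ Finset.Icc 1 K, (((S.T k).card : ℤ) - (S.E k).card -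
      (if S.pin k then 1 else 0)) - (S.B (K + 1)).card ∧
    ∃ P : ι → ℕ → G → ℂ, ∀ (A : Type) [CommRing A] [Algebra ℂ A] (p : ι → A),
      (∃ Λ : G → ℕ → A, (∀ r, Λ r 0 = 1) ∧ (∀ j, 1 ≤ j → j ≤ K → S.IsLevel Λ j) ∧
        (∀ i, ∑ k ∈ Finset.Icc 1 K, ∑ r, P i k r • Λ r k = p i) ∧ ∀ r j, K < j → Λ r j = 0) ∧
      ∀ Λ Λ' : G → ℕ → A, (∀ r, Λ r 0 = 1) → (∀ j, 1 ≤ j → j ≤ K → S.IsLevel Λ j) →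
        (∀ r, Λ' r 0 = 1) → (∀ j, 1 ≤ j → j ≤ K → S.IsLevel Λ' j) →
        (∀ i, ∑ k ∈ Finset.Icc 1 K, ∑ r, P i k r • Λ r k = p i) →
        (∀ i, ∑ k ∈ Finset.Icc 1 K, ∑ r, P i k r • Λ' r k = p i) →
        ∀ r, ∀ j ≤ K, Λ r j = Λ' r j := by
  induction K with
  | zero =>
    refine ⟨Empty, inferInstance, by simp [B_one], fun i => i.elim, fun A _ _ p => ⟨?_, ?_⟩⟩
    · refine ⟨fun r j => if j = 0 then 1 else 0, fun r => rfl, fun j h1 h2 => by omega,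
        fun i => i.elim, fun r j hj => if_neg (by omega)⟩
    · intro Λ Λ' h0 _ h0' _ _ _ r j hj
      obtain rfl : j = 0 := by omega
      rw [h0, h0']
  | succ K ih =>
    obtain ⟨ι, _, hcard, P, hP⟩ := ih
    obtain ⟨ι', _, hcard', P', hP'⟩ := S.exists_level_forms (K + 1) (by omega)
    refine ⟨ι ⊕ ι', inferInstance, ?_, Sum.elim (fun i k r => if k ≤ K then P i k r else 0)
      (fun i k r => if k = K + 1 then P' i r else 0), fun A _ _ p => ?_⟩
    · rw [Fintype.card_sum, Finset.sum_Icc_succ_top (by omega)]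
      push_cast
      rw [hcard, hcard']
      ring
    have e1 : ∀ (Λ : G → ℕ → A) i, ∑ k ∈ Finset.Icc 1 (K + 1),
        ∑ r, (if k ≤ K then P i k r else 0) • Λ r k =
        ∑ k ∈ Finset.Icc 1 K, ∑ r, P i k r • Λ r k := by
      intro Λ i
      rw [Finset.sum_Icc_succ_top (by omega)]
      simp only [Nat.not_succ_le_self, if_false, zero_smul, Finset.sum_const_zero, add_zero]
      refine Finset.sum_congr rfl fun k hk => ?_
      simp [(Finset.mem_Icc.1 hk).2]
    have e2 : ∀ (Λ : G → ℕ → A) i, ∑ k ∈ Finset.Icc 1 (K + 1),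
        ∑ r, (if k = K + 1 then P' i r else 0) • Λ r k = ∑ r, P' i r • Λ r (K + 1) := by
      intro Λ i
      rw [Finset.sum_Icc_succ_top (by omega), Finset.sum_eq_zero, zero_add]
      · simp
      · intro k hk
        have : k ≠ K + 1 := by have := (Finset.mem_Icc.1 hk).2; omega
        simp [this]
    obtain ⟨hex, huniq⟩ := hP A fun i => p (Sum.inl i)
    constructor
    · obtain ⟨Λ, h0, hlev, hp, hvan⟩ := hex
      obtain ⟨v, ⟨hv, hvp⟩, -⟩ := hP' A Λ h0 (fun j h1 h2 => hlev j h1 (by omega))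
        fun i => p (Sum.inr i)
      refine ⟨upd Λ (K + 1) v, fun r => ?_, fun j h1 h2 => ?_, ?_, fun r j hj => ?_⟩
      · rw [upd_of_lt _ _ _ (by omega), h0]
      · rcases Nat.lt_or_eq_of_le h2 with h | rfl
        · exact (hlev j h1 (by omega)).congr h0 fun r i hi => upd_of_lt _ _ _ (by omega)
        · exact hv
      · rintro (i | i)
        · simp only [Sum.elim_inl]
          rw [e1, ← hp i]
          refine Finset.sum_congr rfl fun k hk => ?_
          have := (Finset.mem_Icc.1 hk).2
          refine Finset.sum_congr rfl fun r _ => ?_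
          rw [upd_of_lt _ _ _ (by omega)]
        · simp only [Sum.elim_inr]
          rw [e2, ← hvp i]
          simp only [upd_self]
      · rw [upd, if_neg (by omega), hvan r j (by omega)]
    · intro Λ Λ' h0 hlev h0' hlev' hp hp' r j hj
      have hlow : ∀ r, ∀ j ≤ K, Λ r j = Λ' r j := by
        refine huniq Λ Λ' h0 (fun j h1 h2 => hlev j h1 (by omega)) h0'
          (fun j h1 h2 => hlev' j h1 (by omega)) (fun i => ?_) (fun i => ?_)
        · rw [← e1]; exact hp (Sum.inl i)
        · rw [← e1]; exact hp' (Sum.inl i)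
      rcases Nat.lt_or_eq_of_le hj with h | rfl
      · exact hlow r j (by omega)
      · have hu := hP' A Λ h0 (fun j h1 h2 => hlev j h1 (by omega)) fun i => p (Sum.inr i)
        refine congrFun (hu.unique (y₁ := fun r => Λ r (K + 1)) (y₂ := fun r => Λ' r (K + 1))
          ⟨?_, fun i => ?_⟩ ⟨?_, fun i => ?_⟩) r
        · refine (hlev (K + 1) (by omega) le_rfl).congr h0 fun r j hj => ?_
          rw [upd]; split_ifs with h
          · rw [h]
          · rfl
        · rw [← e2]; exact hp (Sum.inr i)
        · refine (hlev' (K + 1) (by omega) le_rfl).congr h0' fun r j hj => ?_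
          rw [upd]; split_ifs with h
          · rw [h]
          · exact hlow r j (by omega)
        · rw [← e2]; exact hp' (Sum.inr i)

open Classical in
/-- If there are no unknowns beyond level `K`, the solutions over every algebra are parametrized
by linear forms. -/
theorem exists_forms (K : ℕ) (hK : ∀ k, K < k → S.T k = ∅) : ∃ (N : ℕ),
    (N : ℤ) = ∑ k ∈ Finset.Icc 1 K, (((S.T k).card : ℤ) - (S.E k).card -
      (if S.pin k then 1 else 0)) ∧
    ∃ P : Fin N → ℕ → G → ℂ, ∀ (A : Type) [CommRing A] [Algebra ℂ A] (p : Fin N → A),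
      ∃! Λ : G → ℕ → A, S.IsSolution Λ ∧
        ∀ i, ∑ k ∈ Finset.Icc 1 K, ∑ r, P i k r • Λ r k = p i := by
  obtain ⟨ι, _, hcard, P, hP⟩ := S.exists_forms_upto K
  have hE : ∀ k, K < k → ∀ r, r ∉ S.E k := by
    intro k hk r hr
    have := S.left_mem k r hr
    rw [hK k hk] at this
    exact absurd this (Finset.notMem_empty _)
  have hB : ∀ k, K < k → S.B k = ∅ := by
    intro k hk
    refine Finset.eq_empty_of_forall_notMem fun i hi => ?_
    obtain ⟨r, hr, -⟩ := S.incomplete_one i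
    exact hE k hk r (S.mem_B.1 hi r hr)
  refine ⟨Fintype.card ι, by rw [hcard, hB (K + 1) (by omega)]; simp,
    fun i => P ((Fintype.equivFin ι).symm i), fun A _ _ p => ?_⟩
  obtain ⟨⟨Λ, h0, hlev, hp, hvan⟩, huniq⟩ := hP A fun i => p (Fintype.equivFin ι i)
  have hvac : ∀ Λ : G → ℕ → A, (∀ r j, K < j → Λ r j = 0) → ∀ k, K < k → S.IsLevel Λ k := by
    intro Λ hvan k hk
    refine ⟨fun r _ => hvan r k hk, fun r hr => (hE k hk r hr).elim, fun hpin => ?_,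
      fun i hi => ?_⟩
    · have := S.pin_mem k hpin
      rw [hK k hk] at this
      exact absurd this (Finset.notMem_empty _)
    · rw [hB (k + 1) (by omega)] at hi
      exact absurd hi (Finset.notMem_empty _)
  refine ⟨Λ, ⟨⟨h0, fun k hk => ?_⟩, fun i => ?_⟩, ?_⟩
  · by_cases h : k ≤ K
    · exact hlev k hk h
    · exact hvac Λ hvan k (by omega)
  · rw [hp]; simp
  · rintro Λ' ⟨h', hp'⟩
    funext r j
    by_cases hj : j ≤ K
    · refine huniq Λ' Λ h'.zero (fun j h1 _ => h'.level j h1) h0 hlev (fun i => ?_) hp r j hj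
      have := hp' (Fintype.equivFin ι i)
      simpa using this
    · rw [hvan r j (by omega)]
      exact (h'.level j (by omega)).supp r (by rw [hK j (by omega)]; simp)

end LevelSystem

end

/-! ### Polynomial parametrization of the complex solutions. -/

noncomputable section

set_option linter.unusedSectionVars false

namespace LevelSystem

variable {G H : Type} [CommRing G] [CommRing H] [Fintype G] [Fintype H] (S : LevelSystem G H)

open Classical in
/-- The complex solutions form an affine space, with polynomial parametrization and linear
coordinates. -/
theorem exists_parametrization (K : ℕ) (hK : ∀ k, K < k → S.T k = ∅) : ∃ (N : ℕ),
    (N : ℤ) = ∑ k ∈ Finset.Icc 1 K, (((S.T k).card : ℤ) - (S.E k).card -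
      (if S.pin k then 1 else 0)) ∧
    ∃ (Q : G → ℕ → MvPolynomial (Fin N) ℂ) (P : Fin N → ℕ → G → ℂ),
      (∀ p, S.IsSolution fun r j => MvPolynomial.eval p (Q r j)) ∧
      (∀ p i, ∑ k ∈ Finset.Icc 1 K, ∑ r, P i k r • MvPolynomial.eval p (Q r k) = p i) ∧
      ∀ Λ : G → ℕ → ℂ, S.IsSolution Λ → ∀ r j,
        MvPolynomial.eval (fun i => ∑ k ∈ Finset.Icc 1 K, ∑ r, P i k r • Λ r k) (Q r j) =
          Λ r j := by
  obtain ⟨N, hN, P, hP⟩ := S.exists_forms K hK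
  -- The universal solution: the parameters are the variables of a polynomial ring, and every
  -- complex solution is a specialization.
  obtain ⟨Q, ⟨hQ, hQp⟩, -⟩ := hP (MvPolynomial (Fin N) ℂ) MvPolynomial.X
  have h1 : ∀ p : Fin N → ℂ, S.IsSolution fun r j => MvPolynomial.eval p (Q r j) := fun p => by
    simpa [MvPolynomial.coe_aeval_eq_eval] using hQ.map (MvPolynomial.aeval p)
  have h2 : ∀ (p : Fin N → ℂ) i,
      ∑ k ∈ Finset.Icc 1 K, ∑ r, P i k r • MvPolynomial.eval p (Q r k) = p i := by
    intro p i
    have h := congrArg (MvPolynomial.eval p) (hQp i)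
    rw [MvPolynomial.eval_X] at h
    rw [← h]
    simp only [map_sum, MvPolynomial.smul_eval, smul_eq_mul]
  refine ⟨N, hN, Q, P, h1, h2, fun Λ hΛ r j => ?_⟩
  have hu := (hP ℂ fun i => ∑ k ∈ Finset.Icc 1 K, ∑ r, P i k r • Λ r k).unique
    ⟨h1 _, h2 _⟩ ⟨hΛ, fun i => rfl⟩
  exact congrFun (congrFun hu r) j

end LevelSystem

/-! ### Triangular families of power series -/

theorem red_shift {G A : Type} [CommRing G] [CommRing A] (Λ : G → ℕ → A) (s : G) (b : ℕ)
    (h : ℕ → A) (e : ℕ) :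
    red Λ s (fun j => if j < b then 0 else h (j - b)) e =
      if e < b then 0 else red Λ (s + b) h (e - b) := by
  induction e using Nat.strong_induction_on with
  | _ e ih =>
    rw [red_eq, Finset.sum_congr rfl fun j hj => by rw [ih j (Finset.mem_range.1 hj)]]
    by_cases he : e < b
    · rw [if_pos he, if_pos he, Finset.sum_eq_zero, sub_zero]
      intro j hj
      rw [if_pos ((Finset.mem_range.1 hj).trans he), zero_mul]
    · rw [if_neg he, if_neg he, red_eq]
      congr 1
      obtain ⟨e, rfl⟩ : ∃ k, e = b + k := ⟨e - b, by omega⟩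
      rw [Finset.sum_range_add, Finset.sum_eq_zero, zero_add, Nat.add_sub_cancel_left]
      · refine Finset.sum_congr rfl fun j _ => ?_
        rw [if_neg (by omega), Nat.add_sub_cancel_left, Nat.add_sub_add_left, Nat.cast_add,
          add_assoc]
      · intro j hj
        rw [if_pos (Finset.mem_range.1 hj), zero_mul]

theorem red_self {G A : Type} [CommRing G] [CommRing A] {Λ : G → ℕ → A} (h0 : ∀ r, Λ r 0 = 1)
    (s : G) (e : ℕ) : red Λ s (Λ s) e = if e = 0 then 1 else 0 := by
  induction e using Nat.strong_induction_on with
  | _ e ih =>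
    rw [red_eq, Finset.sum_congr rfl fun j hj => by rw [ih j (Finset.mem_range.1 hj)]]
    rcases Nat.eq_zero_or_pos e with rfl | he
    · simp [h0]
    · rw [if_neg he.ne', Finset.sum_eq_single 0]
      · simp
      · intro j _ hj
        rw [if_neg hj, zero_mul]
      · intro h
        exact absurd (Finset.mem_range.2 he) h

section

variable {q : ℕ} (Λ : ZMod q → ℕ → ℂ)

/-- The coordinates of a power series in the family `F_b`. -/
def coord (e : ℕ) : ℂ⟦X⟧ →ₗ[ℂ] ℂ where
  toFun h := red Λ 0 (fun j => PowerSeries.coeff j h) e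
  map_add' h h' := by simpa using red_add Λ 0 _ _ e
  map_smul' a h := by simpa using red_mul Λ 0 a (fun j => PowerSeries.coeff j h) e

/-- `F_b = t^b ∑ Λ_b^ℓ t^ℓ`. -/
def fam (b : ℕ) : ℂ⟦X⟧ := PowerSeries.X ^ b * PowerSeries.mk (Λ b)

theorem coord_X_pow_mul (b : ℕ) (h : ℂ⟦X⟧) (e : ℕ) :
    coord Λ e (PowerSeries.X ^ b * h) =
      if e < b then 0 else red Λ (b : ZMod q) (fun j => PowerSeries.coeff j h) (e - b) := by
  have h1 : (fun j => PowerSeries.coeff j (PowerSeries.X ^ b * h)) =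
      fun j => if j < b then 0 else PowerSeries.coeff (j - b) h := by
    funext j
    rw [PowerSeries.coeff_X_pow_mul']
    split_ifs <;> first | rfl | omega
  change red Λ 0 (fun j => PowerSeries.coeff j (PowerSeries.X ^ b * h)) e = _
  rw [h1, red_shift Λ 0 b fun j => PowerSeries.coeff j h, zero_add]

theorem coord_eq_zero_of_dvd {N : ℕ} {h : ℂ⟦X⟧} (hN : PowerSeries.X ^ N ∣ h) {e : ℕ} (he : e < N) :
    coord Λ e h = 0 := by
  obtain ⟨g, rfl⟩ := hN
  rw [coord_X_pow_mul, if_pos he]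

theorem coord_sub_coeff_of_dvd {N : ℕ} {h : ℂ⟦X⟧} (hN : PowerSeries.X ^ N ∣ h) :
    coord Λ N h = PowerSeries.coeff N h := by
  obtain ⟨g, rfl⟩ := hN
  rw [coord_X_pow_mul, if_neg (lt_irrefl _), Nat.sub_self, red_zero,
    PowerSeries.coeff_X_pow_mul', if_pos le_rfl, Nat.sub_self]

/-- The family is indexed by residues mod `q`, so multiplication by x maps F_b to F_{b+q}. -/
theorem coord_X_pow_q (h : ℂ⟦X⟧) (e : ℕ) : coord Λ (e + q) (PowerSeries.X ^ q * h) =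
    coord Λ e h := by
  rw [coord_X_pow_mul, if_neg (by omega), Nat.add_sub_cancel, ZMod.natCast_self]
  rfl

variable {Λ}

theorem coord_fam (h0 : ∀ r, Λ r 0 = 1) (b e : ℕ) :
    coord Λ e (fam Λ b) = if e = b then 1 else 0 := by
  rw [fam, coord_X_pow_mul]
  simp only [PowerSeries.coeff_mk]
  split_ifs with h1 h2 h2
  · omega
  · rfl
  · rw [red_self h0, if_pos (by omega)]
  · rw [red_self h0, if_neg (by omega)]

theorem X_pow_dvd_fam (b : ℕ) : PowerSeries.X ^ b ∣ fam Λ b := ⟨_, rfl⟩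

theorem coeff_fam_self (h0 : ∀ r, Λ r 0 = 1) (b : ℕ) : PowerSeries.coeff b (fam Λ b) = 1 := by
  rw [fam, PowerSeries.coeff_X_pow_mul', if_pos le_rfl, Nat.sub_self, PowerSeries.coeff_mk, h0]

theorem fam_add_mul (b a : ℕ) : fam Λ (b + q * a) = PowerSeries.X ^ (q * a) * fam Λ b := by
  rw [fam, fam, pow_add, Nat.cast_add, Nat.cast_mul, ZMod.natCast_self, zero_mul, add_zero]
  ring

/-- Every power series is, modulo high powers of `t`, the expansion given by its coordinates. -/
theorem X_pow_dvd_sub_sum (h0 : ∀ r, Λ r 0 = 1) (h : ℂ⟦X⟧) (N : ℕ) :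
    PowerSeries.X ^ N ∣ h - ∑ b ∈ Finset.range N, coord Λ b h • fam Λ b := by
  induction N with
  | zero => simp
  | succ N ih =>
    rw [Finset.sum_range_succ, ← sub_sub]
    set g := h - ∑ b ∈ Finset.range N, coord Λ b h • fam Λ b with hg
    have h1 : coord Λ N g = coord Λ N h := by
      rw [hg, map_sub, map_sum, Finset.sum_eq_zero, sub_zero]
      intro b hb
      rw [map_smul, coord_fam h0, if_neg (Finset.mem_range.1 hb).ne', smul_zero]
    rw [← h1, coord_sub_coeff_of_dvd Λ ih, PowerSeries.X_pow_dvd_iff]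
    intro m hm
    rcases Nat.lt_or_eq_of_le (Nat.lt_succ_iff.1 hm) with h | rfl
    · rw [map_sub, map_smul, PowerSeries.X_pow_dvd_iff.1 ih m h,
        PowerSeries.X_pow_dvd_iff.1 (X_pow_dvd_fam N) m h, smul_zero, sub_zero]
    · rw [map_sub, map_smul, coeff_fam_self h0, smul_eq_mul, mul_one, sub_self]

variable (Λ)

/-- The closed span of the `F_b`, `b ∈ D`. -/
def famSpan (D : Set ℕ) : Submodule ℂ ℂ⟦X⟧ := ⨅ e ∈ Dᶜ, LinearMap.ker (coord Λ e)

variable {Λ}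

theorem mem_famSpan {D : Set ℕ} {h : ℂ⟦X⟧} : h ∈ famSpan Λ D ↔ ∀ e, e ∉ D → coord Λ e h = 0 := by
  simp [famSpan]

theorem fam_mem_famSpan (h0 : ∀ r, Λ r 0 = 1) {D : Set ℕ} {b : ℕ} (hb : b ∈ D) :
    fam Λ b ∈ famSpan Λ D := by
  rw [mem_famSpan]
  intro e he
  rw [coord_fam h0, if_neg (by rintro rfl; exact he hb)]

theorem mem_famSpan_of_dvd {D : Set ℕ} {N : ℕ} (hN : ∀ e, N ≤ e → e ∈ D) {h : ℂ⟦X⟧}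
    (hh : PowerSeries.X ^ N ∣ h) : h ∈ famSpan Λ D := by
  rw [mem_famSpan]
  intro e he
  refine coord_eq_zero_of_dvd Λ hh ?_
  by_contra hc
  exact he (hN e (by omega))

theorem mem_of_mem_famSpan {D : Set ℕ} {h : ℂ⟦X⟧} (hh : h ∈ famSpan Λ D) {a : ℕ}
    (ha : PowerSeries.X ^ a ∣ h) (hne : PowerSeries.coeff a h ≠ 0) : a ∈ D := by
  by_contra hc
  exact hne ((coord_sub_coeff_of_dvd Λ ha).symm.trans (mem_famSpan.1 hh a hc))

theorem X_pow_q_mul_mem_famSpan {D : Set ℕ} (hD : ∀ e ∈ D, e + q ∈ D) {h : ℂ⟦X⟧}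
    (hh : h ∈ famSpan Λ D) : PowerSeries.X ^ q * h ∈ famSpan Λ D := by
  rw [mem_famSpan] at *
  intro e he
  by_cases heq : e < q
  · exact coord_eq_zero_of_dvd Λ ⟨h, rfl⟩ heq
  · obtain ⟨e, rfl⟩ : ∃ k, e = k + q := ⟨e - q, by omega⟩
    rw [coord_X_pow_q]
    exact hh e fun h => he (hD e h)

theorem X_pow_q_pow_mul_mem_famSpan {D : Set ℕ} (hD : ∀ e ∈ D, e + q ∈ D) {h : ℂ⟦X⟧}
    (hh : h ∈ famSpan Λ D) (a : ℕ) : PowerSeries.X ^ (q * a) * h ∈ famSpan Λ D := by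
  induction a with
  | zero => simpa using hh
  | succ a ih =>
    rw [mul_add, mul_one, add_comm, pow_add, mul_assoc]
    exact X_pow_q_mul_mem_famSpan hD ih

/-- Stability of the closed span under multiplication can be tested on the family. -/
theorem mul_mem_famSpan (h0 : ∀ r, Λ r 0 = 1) {D D' : Set ℕ} {u : ℂ⟦X⟧}
    (hu : ∀ b ∈ D, u * fam Λ b ∈ famSpan Λ D') {h : ℂ⟦X⟧} (hh : h ∈ famSpan Λ D) :
    u * h ∈ famSpan Λ D' := by
  rw [mem_famSpan]
  intro e he
  -- The coordinate at `e` ignores multiples of t^{e+1}, which reduces the claim to a finite sum.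
  obtain ⟨g, hg⟩ := X_pow_dvd_sub_sum h0 h (e + 1)
  have h1 : u * h = PowerSeries.X ^ (e + 1) * (u * g) +
      ∑ b ∈ Finset.range (e + 1), coord Λ b h • (u * fam Λ b) := by
    rw [sub_eq_iff_eq_add] at hg
    rw [hg, mul_add, Finset.mul_sum, ← hg]
    simp only [mul_smul_comm]
    ring
  rw [h1, map_add, coord_eq_zero_of_dvd Λ ⟨_, rfl⟩ (Nat.lt_succ_self e), zero_add, map_sum]
  refine Finset.sum_eq_zero fun b _ => ?_
  rw [map_smul]
  by_cases hb : b ∈ D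
  · rw [mem_famSpan.1 (hu b hb) e he, smul_zero]
  · rw [mem_famSpan.1 hh b hb, zero_smul]

/-- The bridge to level systems: stability of the span under y becomes the vanishing of `kap`. -/
theorem coord_mul_fam (y : ℂ⟦X⟧) (w b e : ℕ) :
    coord Λ e (PowerSeries.X ^ w * y * fam Λ b) = if e < b + w then 0 else
      kap (fun j => PowerSeries.coeff j y) (w : ZMod q) Λ b (e - (b + w)) := by
  have h1 : PowerSeries.X ^ w * y * fam Λ b =
      PowerSeries.X ^ (b + w) * (y * PowerSeries.mk (Λ b)) := by
    rw [fam]; ring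
  rw [h1, coord_X_pow_mul, Nat.cast_add]
  have h2 : (fun j => PowerSeries.coeff j (y * PowerSeries.mk (Λ b))) =
      conv (fun j => PowerSeries.coeff j y) (Λ b) := by
    funext j
    rw [PowerSeries.coeff_mul, conv, ← Finset.Nat.sum_antidiagonal_eq_sum_range_succ
      (fun i j => PowerSeries.coeff j y • Λ b i), ← Finset.Nat.sum_antidiagonal_swap]
    simp
  rw [h2]
  rfl

theorem coord_X_pow (b e : ℕ) :
    coord Λ e (PowerSeries.X ^ b) = if e < b then 0 else
      red Λ (b : ZMod q) (fun j => if j = 0 then 1 else 0) (e - b) := by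
  have h1 : (PowerSeries.X ^ b : ℂ⟦X⟧) = PowerSeries.X ^ b * 1 := (mul_one _).symm
  rw [h1, coord_X_pow_mul]
  simp only [PowerSeries.coeff_one]

/-- The quotient by the closed span has the missing exponents as a basis. -/
theorem finrank_quotient_famSpan (h0 : ∀ r, Λ r 0 = 1) {D : Set ℕ} {N : ℕ}
    (hN : ∀ e, N ≤ e → e ∈ D) : Module.finrank ℂ (ℂ⟦X⟧ ⧸ famSpan Λ D) = Dᶜ.ncard := by
  classical
  have hfin : (Dᶜ : Set ℕ).Finite := (Set.finite_lt_nat N).subset fun e he => by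
    by_contra hc
    exact he (hN e (not_lt.1 hc))
  have : Fintype (Dᶜ : Set ℕ) := hfin.fintype
  let f : ℂ⟦X⟧ →ₗ[ℂ] ((Dᶜ : Set ℕ) → ℂ) := LinearMap.pi fun e => coord Λ (e : ℕ)
  have hker : LinearMap.ker f = famSpan Λ D := by
    ext h
    rw [LinearMap.mem_ker, mem_famSpan]
    exact ⟨fun h e he => congrFun h ⟨e, he⟩, fun h => funext fun e => h e e.2⟩
  have hsurj : Function.Surjective f := by
    intro c
    refine ⟨∑ b : (Dᶜ : Set ℕ), c b • fam Λ b, funext fun e => ?_⟩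
    change coord Λ e _ = _
    rw [map_sum, Finset.sum_eq_single e]
    · rw [map_smul, coord_fam h0, if_pos rfl, smul_eq_mul, mul_one]
    · intro b _ hb
      rw [map_smul, coord_fam h0, if_neg fun h => hb (Subtype.ext h.symm), smul_zero]
    · intro h
      exact absurd (Finset.mem_univ _) h
  rw [← hker, (f.quotKerEquivOfSurjective hsurj).finrank_eq, Module.finrank_fintype_fun_eq_card,
    ← Nat.card_eq_fintype_card, Nat.card_coe_set_eq]

end

end

noncomputable section

namespace GenericBranch

variable (C : GenericBranch)

/-- The multiplicity, `ord x`. -/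
abbrev q : ℕ := C.d * C.n

/-- The order of `y`. -/
abbrev w : ℕ := C.d * C.m

theorem q_pos : 0 < C.q := Nat.mul_pos C.d_pos C.n_pos

instance : NeZero C.q := ⟨C.q_pos.ne'⟩

/-! ### The ring `R` -/

theorem x_mem : (PowerSeries.X ^ C.q : ℂ⟦X⟧) ∈ C.R :=
  ⟨MvPowerSeries.X 0, MvPowerSeries.substAlgHom_X C.hasSubst_xy 0⟩

theorem y_mem : C.y ∈ C.R :=
  ⟨MvPowerSeries.X 1, MvPowerSeries.substAlgHom_X C.hasSubst_xy 1⟩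

/-- `R` is an image of power series in two variables, so it contains all power series in x, not just
polynomials. -/
theorem expand_mem (p : ℂ⟦X⟧) : PowerSeries.expand C.q C.q_pos.ne' p ∈ C.R := by
  have ha : MvPowerSeries.HasSubst (fun _ : Unit => (MvPowerSeries.X 0 : MvPowerSeries (Fin 2) ℂ)) :=
    MvPowerSeries.hasSubst_of_constantCoeff_zero fun _ => by simp
  refine ⟨MvPowerSeries.subst (fun _ : Unit => (MvPowerSeries.X 0 : MvPowerSeries (Fin 2) ℂ)) p, ?_⟩
  refine (MvPowerSeries.substAlgHom_apply C.hasSubst_xy _).trans ?_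
  rw [MvPowerSeries.subst_comp_subst_apply ha C.hasSubst_xy, PowerSeries.expand_apply,
    PowerSeries.subst]
  congr 1
  funext _
  rw [← MvPowerSeries.substAlgHom_apply C.hasSubst_xy, MvPowerSeries.substAlgHom_X C.hasSubst_xy]
  rfl

/-- Elements of `R` are polynomials in `x`, `y` up to high order. -/
theorem exists_adjoin_sub {f : ℂ⟦X⟧} (hf : f ∈ C.R) (N : ℕ) :
    ∃ p ∈ Algebra.adjoin ℂ {PowerSeries.X ^ C.q, C.y}, PowerSeries.X ^ N ∣ f - p := by
  obtain ⟨Φ, rfl⟩ := hf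
  -- Both substituted series have positive order, so terms of total degree at least `N` contribute
  -- only multiples of t^N.
  let T := MvPowerSeries.truncTotal N Φ
  refine ⟨MvPolynomial.aeval C.xy T, ?_, ?_⟩
  · have h1 : MvPolynomial.aeval C.xy T ∈ Algebra.adjoin ℂ (Set.range C.xy) := by
      rw [Algebra.adjoin_range_eq_range_aeval]
      exact ⟨T, rfl⟩
    refine Algebra.adjoin_mono ?_ h1
    rintro _ ⟨i, rfl⟩
    fin_cases i
    · exact Or.inl rfl
    · exact Or.inr rfl
  · have h1 : MvPowerSeries.substAlgHom C.hasSubst_xy Φ - MvPolynomial.aeval C.xy T =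
        MvPowerSeries.subst C.xy (Φ - (T : MvPowerSeries (Fin 2) ℂ)) := by
      rw [← MvPowerSeries.substAlgHom_apply C.hasSubst_xy, map_sub,
        MvPowerSeries.substAlgHom_coe C.hasSubst_xy]
    refine PowerSeries.X_pow_dvd_iff.2 fun m hm => ?_
    change PowerSeries.coeff m (MvPowerSeries.substAlgHom C.hasSubst_xy Φ -
      MvPolynomial.aeval C.xy T) = 0
    rw [h1]
    refine MvPowerSeries.coeff_of_lt_order (lt_of_lt_of_le ?_
      (MvPowerSeries.le_order_subst C.hasSubst_xy _))
    have h2 : (1 : ℕ∞) ≤ ⨅ i, MvPowerSeries.order (C.xy i) := by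
      refine le_iInf fun i => MvPowerSeries.one_le_order_iff_constCoeff_eq_zero.2 ?_
      fin_cases i
      · change PowerSeries.constantCoeff (PowerSeries.X ^ C.q : ℂ⟦X⟧) = 0
        simp [C.q_pos.ne']
      · change PowerSeries.constantCoeff C.y = 0
        rw [← PowerSeries.coeff_zero_eq_constantCoeff_apply]
        exact C.coeff_lt 0 (Nat.mul_pos C.d_pos (C.n_pos.trans C.n_lt_m))
    have h3 : (N : ℕ∞) ≤ (Φ - (T : MvPowerSeries (Fin 2) ℂ)).order := by
      refine MvPowerSeries.nat_le_order fun e he => ?_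
      rw [map_sub, MvPolynomial.coeff_coe, MvPowerSeries.coeff_truncTotal _ he, sub_self]
    calc ((Finsupp.single () m).degree : ℕ∞) < N := by simpa using hm
      _ = 1 * N := (one_mul _).symm
      _ ≤ _ := mul_le_mul' h2 h3

/-! ### The topological basis x^a y^i z^j of the ring. -/

/-- `y / t^{dm}`. -/
def y' : ℂ⟦X⟧ := PowerSeries.mk fun k => PowerSeries.coeff (k + C.w) C.y

theorem y_eq : C.y = PowerSeries.X ^ C.w * C.y' := by
  ext k
  rw [PowerSeries.coeff_X_pow_mul']
  split_ifs with h
  · rw [y', PowerSeries.coeff_mk, Nat.sub_add_cancel h]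
  · exact C.coeff_lt k (not_le.1 h)

theorem coeff_zero_y' : PowerSeries.coeff 0 C.y' = 1 := by
  rw [y', PowerSeries.coeff_mk, zero_add]
  exact C.coeff_dm

theorem coeff_one_y' : PowerSeries.coeff 1 C.y' ≠ 0 := by
  rw [y', PowerSeries.coeff_mk, add_comm]
  exact C.coeff_succ

/-- `n λ`, the leading coefficient of `y^n - x^m`. -/
def c₁ : ℂ := C.n * PowerSeries.coeff 1 C.y'

theorem c₁_ne_zero : C.c₁ ≠ 0 :=
  mul_ne_zero (Nat.cast_ne_zero.2 C.n_pos.ne') C.coeff_one_y'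

/-- The unit part of `y^n - x^m`. -/
def z' : ℂ⟦X⟧ := PowerSeries.mk fun k => C.c₁⁻¹ * PowerSeries.coeff (k + 1) (C.y' ^ C.n)

theorem coeff_zero_z' : PowerSeries.coeff 0 C.z' = 1 := by
  rw [z', PowerSeries.coeff_mk, zero_add, PowerSeries.coeff_one_pow,
    ← PowerSeries.coeff_zero_eq_constantCoeff_apply, coeff_zero_y', one_pow, mul_one]
  exact inv_mul_cancel₀ C.c₁_ne_zero

theorem y'_pow : C.y' ^ C.n = 1 + C.c₁ • (PowerSeries.X * C.z') := by
  ext k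
  rcases k with _ | k
  · have : PowerSeries.constantCoeff C.y' = 1 := by
      rw [← PowerSeries.coeff_zero_eq_constantCoeff_apply, coeff_zero_y']
    simp [this]
  · rw [map_add, PowerSeries.coeff_smul, PowerSeries.coeff_succ_X_mul, z', PowerSeries.coeff_mk,
      PowerSeries.coeff_one, if_neg (Nat.succ_ne_zero k), zero_add,
      smul_eq_mul, mul_inv_cancel_left₀ C.c₁_ne_zero]

/-- The normalization of `y^n - x^m`. -/
def z : ℂ⟦X⟧ := PowerSeries.X ^ (C.q * C.m + 1) * C.z'

theorem y_pow : C.y ^ C.n = PowerSeries.X ^ (C.q * C.m) + C.c₁ • C.z := by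
  have : C.w * C.n = C.q * C.m := by simp only [w, q]; ring
  rw [y_eq, mul_pow, y'_pow, mul_add, mul_one, ← pow_mul, this, z, mul_smul_comm,
    pow_succ, mul_assoc (PowerSeries.X ^ (C.q * C.m)) PowerSeries.X]

theorem z_mem : C.z ∈ C.R := by
  have h : C.z = C.c₁⁻¹ • (C.y ^ C.n - (PowerSeries.X ^ C.q) ^ C.m) := by
    rw [y_pow, ← pow_mul, add_sub_cancel_left, smul_smul, inv_mul_cancel₀ C.c₁_ne_zero, one_smul]
  rw [h]
  exact C.R.smul_mem (C.R.sub_mem (C.R.pow_mem C.y_mem _) (C.R.pow_mem C.x_mem _)) _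

/-- The order of `y^i z^j`. -/
def wt (ij : Fin C.n × Fin C.d) : ℕ := ij.1 * C.w + ij.2 * (C.q * C.m + 1)

/-- Modulo d the weight is j. Once j is known, i·m modulo n remains, and m is invertible modulo n.
-/
theorem wt_injective : Function.Injective fun ij => (C.wt ij : ZMod C.q) := by
  rintro ⟨i, j⟩ ⟨i', j'⟩ h
  have h1 : C.wt (i, j) ≡ C.wt (i', j') [MOD C.d * C.n] := (ZMod.natCast_eq_natCast_iff _ _ _).1 h
  have h2 : ∀ i j : ℕ, i * C.w + j * (C.q * C.m + 1) = C.d * (i * C.m + j * C.n * C.m) + j := by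
    intro i j; simp only [w, q]; ring
  have hj : j = j' := by
    have h3 : C.wt (i, j) ≡ C.wt (i', j') [MOD C.d] := h1.of_mul_right _
    simp only [wt, h2, Nat.ModEq, Nat.mul_add_mod] at h3
    rw [Nat.mod_eq_of_lt j.2, Nat.mod_eq_of_lt j'.2] at h3
    exact Fin.ext h3
  subst hj
  have h4 : (i : ℕ) * C.w ≡ i' * C.w [MOD C.d * C.n] := Nat.ModEq.add_right_cancel' _ h1
  have h5 : C.d * (i * C.m) ≡ C.d * (i' * C.m) [MOD C.d * C.n] := by
    simp only [w] at h4
    convert h4 using 1 <;> ring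
  have h6 := Nat.ModEq.mul_left_cancel' C.d_pos.ne' h5
  have h7 : (i : ℕ) ≡ i' [MOD C.n] := Nat.ModEq.cancel_right_of_coprime C.coprime h6
  rw [Nat.ModEq, Nat.mod_eq_of_lt i.2, Nat.mod_eq_of_lt i'.2] at h7
  rw [Fin.ext h7]

/-- Residues modulo `ord x` correspond to the elements `y^i z^j`. -/
def idx : Fin C.n × Fin C.d ≃ ZMod C.q :=
  Equiv.ofBijective _ ((Fintype.bijective_iff_injective_and_card _).2
    ⟨C.wt_injective, by simp [ZMod.card, mul_comm]⟩)

/-- The Apéry set of the semigroup of `R`. -/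
def ap (r : ZMod C.q) : ℕ := C.wt (C.idx.symm r)

theorem natCast_ap (r : ZMod C.q) : (C.ap r : ZMod C.q) = r := C.idx.apply_symm_apply r

theorem ap_wt (ij) : C.ap (C.wt ij : ZMod C.q) = C.wt ij := by
  change C.wt (C.idx.symm (C.idx ij)) = _
  rw [C.idx.symm_apply_apply]

/-- The semigroup of `R`, as a set of natural numbers. -/
def GamN : Set ℕ := {e | C.ap e ≤ e}

theorem wt_mem (ij) : C.wt ij ∈ C.GamN := (C.ap_wt ij).le

theorem exists_of_mem_GamN {e : ℕ} (he : e ∈ C.GamN) : ∃ ij a, e = C.wt ij + C.q * a := by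
  have h1 : C.ap e ≡ e [MOD C.q] := (ZMod.natCast_eq_natCast_iff _ _ _).1 (C.natCast_ap e)
  obtain ⟨a, ha⟩ := (Nat.modEq_iff_dvd' he).1 h1
  exact ⟨C.idx.symm e, a, by rw [← ha]; exact (Nat.add_sub_cancel' he).symm⟩

theorem natCast_wt_add (ij) (a : ℕ) : ((C.wt ij + C.q * a : ℕ) : ZMod C.q) = (C.wt ij : ZMod C.q) := by
  rw [Nat.cast_add, Nat.cast_mul, ZMod.natCast_self, zero_mul, add_zero]

theorem wt_add_mem (ij) (a : ℕ) : C.wt ij + C.q * a ∈ C.GamN := by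
  change C.ap _ ≤ _
  rw [natCast_wt_add, ap_wt]
  exact Nat.le_add_right _ _

theorem add_q_mem_GamN : ∀ e ∈ C.GamN, e + C.q ∈ C.GamN := by
  intro e he
  obtain ⟨ij, a, rfl⟩ := C.exists_of_mem_GamN he
  rw [add_assoc, ← Nat.mul_succ]
  exact C.wt_add_mem ij (a + 1)

/-- The largest element of the Apéry set. -/
def wtMax : ℕ := (C.n - 1) * C.w + (C.d - 1) * (C.q * C.m + 1)

theorem wt_le_wtMax (ij) : C.wt ij ≤ C.wtMax :=
  Nat.add_le_add (Nat.mul_le_mul_right _ (Nat.le_sub_one_of_lt ij.1.2))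
    (Nat.mul_le_mul_right _ (Nat.le_sub_one_of_lt ij.2.2))

theorem mem_GamN_of_lt {e : ℕ} (he : C.wtMax < e + C.q) : e ∈ C.GamN := by
  change C.ap e ≤ e
  by_contra hc
  have h1 : e ≡ C.ap e [MOD C.q] := ((ZMod.natCast_eq_natCast_iff _ _ _).1 (C.natCast_ap e)).symm
  have h2 := (Nat.modEq_iff_dvd' (not_le.1 hc).le).1 h1
  have h3 := Nat.le_of_dvd (by omega) h2
  have h4 : C.ap e ≤ C.wtMax := C.wt_le_wtMax _
  omega

/-- So z^d has order beyond the conductor, and no explicit relation for z^d is needed. -/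
theorem wtMax_lt : C.wtMax < C.d * (C.q * C.m + 1) + C.q := by
  have h1 : (C.n - 1) * C.w ≤ C.q * C.m := by
    calc (C.n - 1) * C.w ≤ C.n * C.w := Nat.mul_le_mul_right _ (Nat.sub_le _ _)
      _ = C.q * C.m := by simp only [w, q]; ring
  have h2 : (C.d - 1) * (C.q * C.m + 1) + (C.q * C.m + 1) = C.d * (C.q * C.m + 1) := by
    rw [← Nat.succ_mul, Nat.succ_eq_add_one, Nat.sub_add_cancel C.d_pos]
  have := C.q_pos
  rw [wtMax]
  omega

/-- The coefficients of the unit parts of the `y^i z^j`. -/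
def lamR (r : ZMod C.q) (k : ℕ) : ℂ :=
  PowerSeries.coeff k (C.y' ^ ((C.idx.symm r).1 : ℕ) * C.z' ^ ((C.idx.symm r).2 : ℕ))

theorem lamR_zero (r : ZMod C.q) : C.lamR r 0 = 1 := by
  have h1 : PowerSeries.constantCoeff C.y' = 1 := by
    rw [← PowerSeries.coeff_zero_eq_constantCoeff_apply, coeff_zero_y']
  have h2 : PowerSeries.constantCoeff C.z' = 1 := by
    rw [← PowerSeries.coeff_zero_eq_constantCoeff_apply, coeff_zero_z']
  simp [lamR, h1, h2]

theorem fam_lamR_wt (ij) :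
    fam C.lamR (C.wt ij) = C.y ^ (ij.1 : ℕ) * C.z ^ (ij.2 : ℕ) := by
  have h1 : PowerSeries.mk (C.lamR (C.wt ij)) = C.y' ^ (ij.1 : ℕ) * C.z' ^ (ij.2 : ℕ) := by
    ext k
    have : C.idx.symm (C.wt ij) = ij := C.idx.symm_apply_apply ij
    rw [PowerSeries.coeff_mk, lamR, this]
  rw [fam, h1, wt, y_eq, z]
  ring

theorem X_pow_mul_mem_famSpan {h : ℂ⟦X⟧} (hh : h ∈ famSpan C.lamR C.GamN) (a : ℕ) :
    PowerSeries.X ^ (C.q * a) * h ∈ famSpan C.lamR C.GamN :=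
  X_pow_q_pow_mul_mem_famSpan C.add_q_mem_GamN hh a

theorem y_pow_mul_z_pow_mem {i j : ℕ} (hi : i < C.n) (hj : j ≤ C.d) (hj' : j < C.d ∨ i = 0) :
    C.y ^ i * C.z ^ j ∈ famSpan C.lamR C.GamN := by
  rcases Nat.lt_or_eq_of_le hj with h | rfl
  · rw [← C.fam_lamR_wt (⟨i, hi⟩, ⟨j, h⟩)]
    exact fam_mem_famSpan C.lamR_zero (C.wt_mem _)
  · obtain rfl : i = 0 := hj'.resolve_left (lt_irrefl _)
    refine mem_famSpan_of_dvd (N := C.d * (C.q * C.m + 1)) (fun e he => C.mem_GamN_of_lt ?_) ?_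
    · have := C.wtMax_lt
      omega
    · rw [pow_zero, one_mul, z, mul_pow, ← pow_mul, mul_comm C.d]
      exact ⟨_, rfl⟩

/-- Only i = n - 1 needs an argument, where y^n is rewritten as x^m plus a multiple of z. -/
theorem y_mul_mem_famSpan {h : ℂ⟦X⟧} (hh : h ∈ famSpan C.lamR C.GamN) :
    C.y * h ∈ famSpan C.lamR C.GamN := by
  refine mul_mem_famSpan C.lamR_zero (fun b hb => ?_) hh
  obtain ⟨⟨i, j⟩, a, rfl⟩ := C.exists_of_mem_GamN hb
  rw [fam_add_mul, mul_left_comm, fam_lamR_wt]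
  refine C.X_pow_mul_mem_famSpan ?_ a
  have hj := j.2
  rw [← mul_assoc, ← pow_succ']
  rcases Nat.lt_or_ge ((i : ℕ) + 1) C.n with hi | hi
  · exact C.y_pow_mul_z_pow_mem hi hj.le (Or.inl hj)
  · have hi' : (i : ℕ) + 1 = C.n := le_antisymm i.2 hi
    change C.y ^ ((i : ℕ) + 1) * C.z ^ (j : ℕ) ∈ _
    rw [hi', y_pow, add_mul, smul_mul_assoc, ← pow_succ']
    refine Submodule.add_mem _ (C.X_pow_mul_mem_famSpan ?_ C.m) (Submodule.smul_mem _ _ ?_)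
    · simpa using C.y_pow_mul_z_pow_mem (i := 0) C.n_pos hj.le (Or.inl hj)
    · simpa using C.y_pow_mul_z_pow_mem (i := 0) C.n_pos hj (Or.inr rfl)

theorem coord_expand_mul_fam {q : ℕ} (hq : q ≠ 0) {Λ : ZMod q → ℕ → ℂ} (h0 : ∀ r, Λ r 0 = 1)
    (p : ℂ⟦X⟧) (b e : ℕ) : coord Λ e (PowerSeries.expand q hq p * fam Λ b) =
      ∑ a ∈ Finset.range (e + 1), if e = b + q * a then PowerSeries.coeff a p else 0 := by
  have h1 : PowerSeries.X ^ (e + 1) ∣ PowerSeries.expand q hq p -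
      ∑ a ∈ Finset.range (e + 1), PowerSeries.coeff a p • (PowerSeries.X ^ (q * a) : ℂ⟦X⟧) := by
    refine PowerSeries.X_pow_dvd_iff.2 fun m hm => ?_
    rw [map_sub, map_sum, sub_eq_zero, PowerSeries.coeff_expand]
    simp only [PowerSeries.coeff_smul, PowerSeries.coeff_X_pow, smul_eq_mul, mul_ite, mul_one,
      mul_zero]
    split_ifs with h
    · obtain ⟨a, rfl⟩ := h
      rw [Nat.mul_div_cancel_left _ (Nat.pos_of_ne_zero hq), Finset.sum_eq_single a]
      · rw [if_pos rfl]
      · intro a' _ ha'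
        rw [if_neg fun h => ha' (Nat.eq_of_mul_eq_mul_left (Nat.pos_of_ne_zero hq) h).symm]
      · intro ha
        have := Nat.le_mul_of_pos_left a (Nat.pos_of_ne_zero hq)
        exact absurd (Finset.mem_range.2 (by omega)) ha
    · refine (Finset.sum_eq_zero fun a _ => if_neg ?_).symm
      rintro rfl
      exact h (dvd_mul_right _ _)
  obtain ⟨g, hg⟩ := h1
  rw [sub_eq_iff_eq_add] at hg
  rw [hg, add_mul, map_add, mul_assoc, coord_eq_zero_of_dvd Λ ⟨_, rfl⟩ (Nat.lt_succ_self e),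
    zero_add, Finset.sum_mul, map_sum]
  refine Finset.sum_congr rfl fun a _ => ?_
  rw [smul_mul_assoc, map_smul, ← fam_add_mul, coord_fam h0]
  simp

theorem eq_of_coord_eq {q : ℕ} {Λ : ZMod q → ℕ → ℂ} (h0 : ∀ r, Λ r 0 = 1) {h h' : ℂ⟦X⟧}
    (hc : ∀ e, coord Λ e h = coord Λ e h') : h = h' := by
  rw [← sub_eq_zero]
  ext e
  have h1 := X_pow_dvd_sub_sum h0 (h - h') (e + 1)
  rw [Finset.sum_eq_zero fun b _ => by rw [map_sub, hc b, sub_self, zero_smul], sub_zero] at h1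
  simpa using PowerSeries.X_pow_dvd_iff.1 h1 e (Nat.lt_succ_self e)

/-- `R` is the closed span of the elements `x^a y^i z^j`. -/
theorem mem_R_iff {f : ℂ⟦X⟧} : f ∈ C.R ↔ f ∈ famSpan C.lamR C.GamN := by
  constructor
  · intro hf
    obtain ⟨p, hp, hd⟩ := C.exists_adjoin_sub hf (C.wtMax + 1)
    have h1 : f - p ∈ famSpan C.lamR C.GamN :=
      mem_famSpan_of_dvd (fun e he => C.mem_GamN_of_lt (by omega)) hd
    have h2 : ∀ h ∈ famSpan C.lamR C.GamN, p * h ∈ famSpan C.lamR C.GamN := by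
      clear hd h1
      induction hp using Algebra.adjoin_induction with
      | mem x hx =>
        rcases hx with rfl | rfl
        · intro h hh
          simpa using C.X_pow_mul_mem_famSpan hh 1
        · intro h hh
          exact C.y_mul_mem_famSpan hh
      | algebraMap r =>
        intro h hh
        rw [← Algebra.smul_def]
        exact Submodule.smul_mem _ _ hh
      | add x y _ _ hx hy =>
        intro h hh
        rw [add_mul]
        exact Submodule.add_mem _ (hx h hh) (hy h hh)
      | mul x y _ _ hx hy =>
        intro h hh
        rw [mul_assoc]
        exact hx _ (hy h hh)
    have h3 : (1 : ℂ⟦X⟧) ∈ famSpan C.lamR C.GamN := by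
      simpa using C.y_pow_mul_z_pow_mem (i := 0) (j := 0) C.n_pos (Nat.zero_le _) (Or.inr rfl)
    simpa using Submodule.add_mem _ h1 (h2 1 h3)
  · intro hf
    -- Grouping the coordinates of `f` by residue mod q gives for each y^i z^j a power series in x
    -- as coefficient.
    have h1 : f = ∑ ij, PowerSeries.expand C.q C.q_pos.ne'
        (PowerSeries.mk fun a => coord C.lamR (C.wt ij + C.q * a) f) * fam C.lamR (C.wt ij) := by
      refine eq_of_coord_eq C.lamR_zero fun e => ?_
      rw [map_sum]
      simp only [coord_expand_mul_fam C.q_pos.ne' C.lamR_zero, PowerSeries.coeff_mk]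
      by_cases he : e ∈ C.GamN
      · obtain ⟨ij, a, rfl⟩ := C.exists_of_mem_GamN he
        rw [Finset.sum_eq_single ij, Finset.sum_eq_single a]
        · rw [if_pos rfl]
        · intro a' _ ha'
          rw [if_neg fun h => ha' (Nat.eq_of_mul_eq_mul_left C.q_pos (Nat.add_left_cancel h)).symm]
        · intro ha
          have := Nat.le_mul_of_pos_left a C.q_pos
          exact absurd (Finset.mem_range.2 (by omega)) ha
        · intro ij' _ hne
          refine Finset.sum_eq_zero fun a' _ => if_neg fun h => hne ?_
          have h2 := congrArg (fun e : ℕ => (e : ZMod C.q)) h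
          simp only [natCast_wt_add] at h2
          exact (C.wt_injective h2).symm
        · intro h
          exact absurd (Finset.mem_univ _) h
      · rw [mem_famSpan.1 hf e he]
        refine (Finset.sum_eq_zero fun ij _ => Finset.sum_eq_zero fun a _ => if_neg ?_).symm
        rintro rfl
        exact he (C.wt_add_mem ij a)
    rw [h1]
    refine C.R.sum_mem fun ij _ => C.R.mul_mem (C.expand_mem _) ?_
    rw [fam_lamR_wt]
    exact C.R.mul_mem (C.R.pow_mem C.y_mem _) (C.R.pow_mem C.z_mem _)

theorem toSubmodule_R : Subalgebra.toSubmodule C.R = famSpan C.lamR C.GamN :=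
  Submodule.ext fun _ => C.mem_R_iff

theorem mem_R_of_dvd {f : ℂ⟦X⟧} {N : ℕ} (hN : C.wtMax < N + C.q) (hf : PowerSeries.X ^ N ∣ f) :
    f ∈ C.R :=
  C.mem_R_iff.2 (mem_famSpan_of_dvd (fun e he => C.mem_GamN_of_lt (by omega)) hf)

theorem delta_eq : C.delta = (C.GamN)ᶜ.ncard := by
  rw [delta, toSubmodule_R, finrank_quotient_famSpan C.lamR_zero (N := C.wtMax + 1)
    fun e he => C.mem_GamN_of_lt (by omega)]

/-! ### Symmetry of the value semigroup. -/

/-- The Frobenius number of the semigroup. -/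
def frob : ℤ := C.wtMax - C.q

/-- Membership in the semigroup, for integers. -/
def GamZ : Set ℤ := {e | 0 ≤ e ∧ e.toNat ∈ C.GamN}

theorem wt_add_mem_GamZ_iff (ij) (t : ℤ) : (C.wt ij + C.q * t : ℤ) ∈ C.GamZ ↔ 0 ≤ t := by
  constructor
  · rintro ⟨h1, h2⟩
    by_contra hc
    have h3 : ((C.wt ij + C.q * t : ℤ).toNat : ℤ) = C.wt ij + C.q * t := Int.toNat_of_nonneg h1
    have h4 : (((C.wt ij + C.q * t : ℤ).toNat : ℕ) : ZMod C.q) = (C.wt ij : ZMod C.q) := by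
      rw [← Int.cast_natCast, h3]
      rw [Int.cast_add, Int.cast_mul, Int.cast_natCast, Int.cast_natCast, ZMod.natCast_self,
        zero_mul, add_zero]
    have h5 : C.ap ((C.wt ij + C.q * t : ℤ).toNat : ZMod C.q) ≤ (C.wt ij + C.q * t : ℤ).toNat := h2
    rw [h4, ap_wt] at h5
    have h6 : (C.q : ℤ) * t < 0 := mul_neg_of_pos_of_neg (by exact_mod_cast C.q_pos) (not_le.1 hc)
    omega
  · intro ht
    obtain ⟨a, rfl⟩ := Int.eq_ofNat_of_zero_le ht
    refine ⟨by positivity, ?_⟩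
    have : (C.wt ij + C.q * (a : ℤ) : ℤ).toNat = C.wt ij + C.q * a := by
      rw [← Nat.cast_mul, ← Nat.cast_add, Int.toNat_natCast]
    rw [this]
    exact C.wt_add_mem ij a

/-- The semigroup is symmetric. -/
theorem frob_sub_mem_iff (b : ℤ) : C.frob - b ∈ C.GamZ ↔ b ∉ C.GamZ := by
  obtain ⟨⟨i, j⟩, hij⟩ := C.idx.surjective (b : ZMod C.q)
  have h1 : ((C.wt (i, j) : ℤ) : ZMod C.q) = (b : ZMod C.q) := by rw [← hij]; simp [idx]
  obtain ⟨t, ht⟩ := (ZMod.intCast_eq_intCast_iff_dvd_sub _ _ _).1 h1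
  have hb : b = C.wt (i, j) + C.q * t := by linarith
  have hi := i.2
  have hj := j.2
  -- The reflection (i, j) ↦ (n - 1 - i, d - 1 - j) pairs weights with sum `wtMax`, and `t ≥ 0`
  -- turns into `-1 - t < 0`.
  have h2 : C.frob - b = C.wt (⟨C.n - 1 - i, by omega⟩, ⟨C.d - 1 - j, by omega⟩) +
      C.q * (-1 - t) := by
    rw [hb, frob]
    have h3 : ((C.n - 1 - i : ℕ) : ℤ) = (C.n - 1 : ℕ) - (i : ℕ) := by omega
    have h4 : ((C.d - 1 - j : ℕ) : ℤ) = (C.d - 1 : ℕ) - (j : ℕ) := by omega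
    simp only [wtMax, wt]
    push_cast only [Nat.cast_add, Nat.cast_mul, h3, h4]
    ring
  rw [h2, wt_add_mem_GamZ_iff, hb, wt_add_mem_GamZ_iff]
  omega

end GenericBranch

end

noncomputable section

/-! ### Orders of Laurent series -/

/-- The Laurent series of order at least `p`. -/
def ordGE (p : ℤ) : Submodule ℂ (LaurentSeries ℂ) where
  carrier := {z | ∀ i < p, z.coeff i = 0}
  add_mem' hz hz' i hi := by rw [HahnSeries.coeff_add, hz i hi, hz' i hi, add_zero]
  zero_mem' _ _ := rfl
  smul_mem' a z hz i hi := by rw [HahnSeries.coeff_smul, hz i hi, smul_zero]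

theorem ordGE_anti {p p' : ℤ} (h : p ≤ p') {z : LaurentSeries ℂ} (hz : z ∈ ordGE p') :
    z ∈ ordGE p := fun i hi => hz i (hi.trans_le h)

theorem mem_ordGE_succ {p : ℤ} {z : LaurentSeries ℂ} (hz : z ∈ ordGE p) (h : z.coeff p = 0) :
    z ∈ ordGE (p + 1) := by
  intro i hi
  rcases lt_or_eq_of_le (Int.lt_add_one_iff.1 hi) with h' | rfl
  · exact hz i h'
  · exact h

/-- The power series with coefficients shifted by `p`. -/
def tail (p : ℤ) (z : LaurentSeries ℂ) : ℂ⟦X⟧ := PowerSeries.mk fun k => z.coeff (p + k)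

theorem single_mul_tail {p : ℤ} {z : LaurentSeries ℂ} (hz : z ∈ ordGE p) :
    HahnSeries.single p (1 : ℂ) * HahnSeries.ofPowerSeries ℤ ℂ (tail p z) = z := by
  ext i
  rw [HahnSeries.coeff_single_mul, one_mul, PowerSeries.coeff_coe]
  split_ifs with h
  · exact (hz i (by omega)).symm
  · rw [tail, PowerSeries.coeff_mk]
    congr 1
    omega

theorem coe_mem_ordGE_zero (h : ℂ⟦X⟧) : HahnSeries.ofPowerSeries ℤ ℂ h ∈ ordGE 0 := by
  intro i hi
  rw [PowerSeries.coeff_coe, if_pos hi]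

theorem coe_mem_ordGE_iff {h : ℂ⟦X⟧} {N : ℕ} :
    HahnSeries.ofPowerSeries ℤ ℂ h ∈ ordGE N ↔ PowerSeries.X ^ N ∣ h := by
  rw [PowerSeries.X_pow_dvd_iff]
  constructor
  · intro hz m hm
    rw [← LaurentSeries.coeff_coe_powerSeries]
    exact hz m (by exact_mod_cast hm)
  · intro hz i hi
    rw [PowerSeries.coeff_coe]
    split_ifs with h
    · rfl
    · exact hz _ (by omega)

theorem single_mul_mem_ordGE {p : ℤ} {z : LaurentSeries ℂ} (k : ℤ) (a : ℂ) (hz : z ∈ ordGE p) :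
    HahnSeries.single k a * z ∈ ordGE (k + p) := by
  intro i hi
  rw [HahnSeries.coeff_single_mul, hz _ (by omega), mul_zero]

theorem single_mem_ordGE (k : ℤ) (a : ℂ) : HahnSeries.single k a ∈ ordGE k :=
  fun _ hi => HahnSeries.coeff_single_of_ne hi.ne

theorem mul_eq_single_mul {p p' : ℤ} {z z' : LaurentSeries ℂ} (hz : z ∈ ordGE p)
    (hz' : z' ∈ ordGE p') : z * z' = HahnSeries.single (p + p') (1 : ℂ) *
      HahnSeries.ofPowerSeries ℤ ℂ (tail p z * tail p' z') := by
  have h : HahnSeries.single (p + p') (1 : ℂ) = HahnSeries.single p 1 * HahnSeries.single p' 1 := by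
    rw [HahnSeries.single_mul_single, one_mul]
  conv_lhs => rw [← single_mul_tail hz, ← single_mul_tail hz']
  rw [h, map_mul]
  ring

theorem mul_mem_ordGE {p p' : ℤ} {z z' : LaurentSeries ℂ} (hz : z ∈ ordGE p)
    (hz' : z' ∈ ordGE p') : z * z' ∈ ordGE (p + p') := by
  rw [mul_eq_single_mul hz hz']
  simpa using single_mul_mem_ordGE (p + p') 1 (coe_mem_ordGE_zero (tail p z * tail p' z'))

theorem coeff_mul_add {p p' : ℤ} {z z' : LaurentSeries ℂ} (hz : z ∈ ordGE p)
    (hz' : z' ∈ ordGE p') : (z * z').coeff (p + p') = z.coeff p * z'.coeff p' := by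
  rw [mul_eq_single_mul hz hz', HahnSeries.coeff_single_mul, sub_self, one_mul,
    ← Nat.cast_zero, LaurentSeries.coeff_coe_powerSeries]
  simp [tail, PowerSeries.coeff_mul]

theorem exists_mem_ordGE (z : LaurentSeries ℂ) : ∃ p, z ∈ ordGE p :=
  ⟨z.order, fun _ hi => HahnSeries.coeff_eq_zero_of_lt_order hi⟩

/-- A subspace that contains all elements of high order and elements of each order of `Q`
contains `Q`. -/
theorem le_of_forall_order {Q W : Submodule ℂ (LaurentSeries ℂ)} (c : ℤ) (hc : ordGE c ≤ W)
    (h : ∀ z ∈ Q, ∀ p, z ∈ ordGE p → z.coeff p ≠ 0 → ∃ w ∈ W ⊓ Q, w ∈ ordGE p ∧ w.coeff p ≠ 0) :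
    Q ≤ W := by
  have key : ∀ n : ℕ, ∀ z ∈ Q, z ∈ ordGE (c - n) → z ∈ W := by
    intro n
    induction n with
    | zero => intro z _ hz; exact hc (by simpa using hz)
    | succ n ih =>
      intro z hzQ hz
      have e : c - ((n + 1 : ℕ) : ℤ) + 1 = c - n := by push_cast; ring
      by_cases h0 : z.coeff (c - ((n + 1 : ℕ) : ℤ)) = 0
      · exact ih z hzQ (e ▸ mem_ordGE_succ hz h0)
      · obtain ⟨w, ⟨hwW, hwQ⟩, hw, hw0⟩ := h z hzQ _ hz h0
        set p := c - ((n + 1 : ℕ) : ℤ)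
        have h1 : z - (z.coeff p / w.coeff p) • w ∈ W := by
          refine ih _ (Q.sub_mem hzQ (Q.smul_mem _ hwQ)) (e ▸ mem_ordGE_succ
            (Submodule.sub_mem _ hz (Submodule.smul_mem _ _ hw)) ?_)
          rw [HahnSeries.coeff_sub, HahnSeries.coeff_smul, smul_eq_mul, div_mul_cancel₀ _ hw0,
            sub_self]
        simpa using W.add_mem h1 (W.smul_mem (z.coeff p / w.coeff p) hwW)
  intro z hz
  obtain ⟨p, hp⟩ := exists_mem_ordGE z
  exact key (c - p).toNat z hz (ordGE_anti (by omega) hp)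

theorem mem_ordSet_iff {J : Set (LaurentSeries ℂ)} {a : ℤ} :
    a ∈ GenericBranch.ordSet J ↔ ∃ z ∈ J, z ∈ ordGE a ∧ z.coeff a ≠ 0 := by
  constructor
  · rintro ⟨z, hz, hz0, rfl⟩
    exact ⟨z, hz, fun _ hi => HahnSeries.coeff_eq_zero_of_lt_order hi,
      mt HahnSeries.coeff_order_eq_zero.1 hz0⟩
  · rintro ⟨z, hz, h1, h2⟩
    have hz0 : z ≠ 0 := by rintro rfl; exact h2 rfl
    refine ⟨z, hz, hz0, le_antisymm (HahnSeries.order_le_of_coeff_ne_zero h2) ?_⟩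
    by_contra hc
    exact hz0 <| HahnSeries.coeff_order_eq_zero.1 (h1 _ (not_le.1 hc))

namespace GenericBranch

variable (C : GenericBranch)

theorem algebraMap_R_apply (r : C.R) :
    algebraMap C.R E r = HahnSeries.ofPowerSeries ℤ ℂ (r : ℂ⟦X⟧) := rfl

theorem smul_E_def (r : C.R) (z : E) : r • z = HahnSeries.ofPowerSeries ℤ ℂ (r : ℂ⟦X⟧) * z := rfl

theorem csmul_mul (a : ℂ) (z w : E) : a • z * w = a • (z * w) := by
  rw [← HahnSeries.C_mul_eq_smul, ← HahnSeries.C_mul_eq_smul, mul_assoc]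

theorem mul_csmul (a : ℂ) (z w : E) : z * a • w = a • (z * w) := by
  rw [mul_comm, csmul_mul, mul_comm]

theorem algebraMap_smul_E (a : ℂ) (z : E) : (algebraMap ℂ C.R a) • z = a • z := by
  rw [smul_E_def]
  have : ((algebraMap ℂ C.R a : C.R) : ℂ⟦X⟧) = PowerSeries.C a := rfl
  rw [this, HahnSeries.ofPowerSeries_C, HahnSeries.C_mul_eq_smul]

theorem smul_mem_E (J : Submodule C.R E) (a : ℂ) {z : E} (hz : z ∈ J) : a • z ∈ J := by
  rw [← C.algebraMap_smul_E]
  exact J.smul_mem _ hz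

/-- The underlying complex vector space of an `R`-module in `E`. -/
def toC (J : Submodule C.R E) : Submodule ℂ E where
  carrier := J
  add_mem' := J.add_mem
  zero_mem' := J.zero_mem
  smul_mem' a _ := C.smul_mem_E J a

theorem coe_mul_mem {J : Submodule C.R E} {r : ℂ⟦X⟧} (hr : r ∈ C.R) {z : E} (hz : z ∈ J) :
    HahnSeries.ofPowerSeries ℤ ℂ r * z ∈ J :=
  J.smul_mem (⟨r, hr⟩ : C.R) hz

theorem mem_one_iff {z : E} :
    z ∈ (1 : Submodule C.R E) ↔ ∃ r ∈ C.R, HahnSeries.ofPowerSeries ℤ ℂ r = z := by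
  rw [Submodule.mem_one]
  exact ⟨fun ⟨r, hr⟩ => ⟨r, r.2, hr⟩, fun ⟨r, hr, h⟩ => ⟨⟨r, hr⟩, h⟩⟩

theorem zero_mem_GamZ : (0 : ℤ) ∈ C.GamZ := by
  refine ⟨le_rfl, C.mem_R_iff.1 C.R.one_mem |> fun h => mem_of_mem_famSpan h (a := 0) (by simp) ?_⟩
  simp

theorem neg_one_le_frob : -1 ≤ C.frob := by
  have h : C.frob - (-1) ∈ C.GamZ := (C.frob_sub_mem_iff _).2 fun h => by have := h.1; omega
  have := h.1
  omega

theorem mem_one_of_mem_ordGE {z : E} (hz : z ∈ ordGE (C.frob + 1)) :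
    z ∈ (1 : Submodule C.R E) := by
  have hf := C.neg_one_le_frob
  have h0 : z ∈ ordGE 0 := ordGE_anti (by omega) hz
  have h1 := single_mul_tail h0
  rw [HahnSeries.single_zero_one, one_mul] at h1
  refine C.mem_one_iff.2 ⟨tail 0 z, ?_, h1⟩
  rw [← h1] at hz
  have h2 : ((C.frob + 1).toNat : ℤ) = C.frob + 1 := Int.toNat_of_nonneg (by omega)
  rw [← h2] at hz
  refine C.mem_R_of_dvd ?_ (coe_mem_ordGE_iff.1 hz)
  have : C.frob = C.wtMax - C.q := rfl
  omega

theorem mem_GamZ_of_coeff_ne_zero {z : E} (hz : z ∈ (1 : Submodule C.R E)) {p : ℤ}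
    (hp : z ∈ ordGE p) (h0 : z.coeff p ≠ 0) : p ∈ C.GamZ := by
  obtain ⟨r, hr, rfl⟩ := C.mem_one_iff.1 hz
  have hp0 : 0 ≤ p := by
    by_contra hc
    exact h0 (coe_mem_ordGE_zero r p (not_le.1 hc))
  obtain ⟨a, rfl⟩ := Int.eq_ofNat_of_zero_le hp0
  refine ⟨hp0, mem_of_mem_famSpan (C.mem_R_iff.1 hr) (coe_mem_ordGE_iff.1 hp) ?_⟩
  rwa [← LaurentSeries.coeff_coe_powerSeries]

theorem exists_mem_one_of_mem_GamZ {p : ℤ} (hp : p ∈ C.GamZ) :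
    ∃ r : C.R, algebraMap C.R E r ∈ ordGE p ∧ (algebraMap C.R E r).coeff p = 1 := by
  obtain ⟨a, rfl⟩ := Int.eq_ofNat_of_zero_le hp.1
  refine ⟨⟨fam C.lamR a, C.mem_R_iff.2 (fam_mem_famSpan C.lamR_zero hp.2)⟩, ?_, ?_⟩
  · exact coe_mem_ordGE_iff.2 (X_pow_dvd_fam a)
  · exact (LaurentSeries.coeff_coe_powerSeries _ _).trans (coeff_fam_self C.lamR_zero a)

theorem Gam_eq : C.Gam = C.GamZ := by
  ext p
  rw [Gam, mem_ordSet_iff]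
  constructor
  · rintro ⟨_, ⟨r, rfl⟩, h1, h2⟩
    exact C.mem_GamZ_of_coeff_ne_zero (Submodule.mem_one.2 ⟨r, rfl⟩) h1 h2
  · intro hp
    obtain ⟨r, h1, h2⟩ := C.exists_mem_one_of_mem_GamZ hp
    exact ⟨_, ⟨r, rfl⟩, h1, by rw [h2]; exact one_ne_zero⟩

/-! ### Duality -/

/-- A functional that vanishes on `R` and is the leading coefficient at the Frobenius number. -/
theorem exists_functional : ∃ φ : E →ₗ[ℂ] ℂ, (∀ z ∈ (1 : Submodule C.R E), φ z = 0) ∧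
    φ (HahnSeries.single C.frob 1) = 1 := by
  -- By symmetry the Frobenius number is a gap, because 0 is not.
  have h1 : (HahnSeries.single C.frob (1 : ℂ) : E) ∉ C.toC 1 := by
    intro h
    have h2 := C.mem_GamZ_of_coeff_ne_zero h (single_mem_ordGE _ _) (by simp)
    have h3 := (C.frob_sub_mem_iff 0).1 (by simpa using h2)
    exact h3 C.zero_mem_GamZ
  obtain ⟨f, hf, hle⟩ := Submodule.exists_le_ker_of_notMem h1
  refine ⟨(f (HahnSeries.single C.frob 1))⁻¹ • f, fun z hz => ?_, ?_⟩
  · rw [LinearMap.smul_apply, show f z = 0 from hle hz, smul_zero]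
  · rw [LinearMap.smul_apply, smul_eq_mul, inv_mul_cancel₀ hf]

/-- The residue functional. -/
def resF : E →ₗ[ℂ] ℂ := C.exists_functional.choose

theorem resF_one {z : E} (hz : z ∈ (1 : Submodule C.R E)) : C.resF z = 0 :=
  C.exists_functional.choose_spec.1 z hz

theorem resF_high {z : E} (hz : z ∈ ordGE (C.frob + 1)) : C.resF z = 0 :=
  C.resF_one (C.mem_one_of_mem_ordGE hz)

theorem resF_of_mem {z : E} (hz : z ∈ ordGE C.frob) : C.resF z = z.coeff C.frob := by
  have h1 : z - z.coeff C.frob • HahnSeries.single C.frob (1 : ℂ) ∈ ordGE (C.frob + 1) := by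
    refine mem_ordGE_succ (Submodule.sub_mem _ hz
      (Submodule.smul_mem _ _ (single_mem_ordGE _ _))) ?_
    simp
  have h2 := C.resF_high h1
  have h3 : C.resF (HahnSeries.single C.frob 1) = 1 := C.exists_functional.choose_spec.2
  rw [map_sub, map_smul, h3, smul_eq_mul, mul_one, sub_eq_zero] at h2
  exact h2

theorem resF_mul_of_mem {p p' : ℤ} {z z' : E} (hz : z ∈ ordGE p) (hz' : z' ∈ ordGE p')
    (h : p + p' = C.frob) : C.resF (z * z') = z.coeff p * z'.coeff p' := by
  rw [C.resF_of_mem (h ▸ mul_mem_ordGE hz hz'), ← h, coeff_mul_add hz hz']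

theorem resF_mul_high {p p' : ℤ} {z z' : E} (hz : z ∈ ordGE p) (hz' : z' ∈ ordGE p')
    (h : C.frob < p + p') : C.resF (z * z') = 0 :=
  C.resF_high (ordGE_anti (by omega) (mul_mem_ordGE hz hz'))

/-- The Gorenstein property: R is its own annihilator. An order p outside Γ is impossible, since R
has an element of order `frob - p`, whose pairing with `z` is a nonzero leading coefficient.
Comparing orders then gives equality. -/
theorem mem_one_of_resF {z : E} (hz : ∀ r : C.R, C.resF (z * algebraMap C.R E r) = 0) :
    z ∈ (1 : Submodule C.R E) := by
  let Q : Submodule ℂ E := {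
    carrier := {z | ∀ r : C.R, C.resF (z * algebraMap C.R E r) = 0}
    add_mem' := fun h h' r => by rw [add_mul, map_add, h r, h' r, add_zero]
    zero_mem' := fun r => by rw [zero_mul, map_zero]
    smul_mem' := fun a z h r => by rw [csmul_mul, map_smul, h r, smul_zero] }
  have h1 : Q ≤ C.toC 1 := by
    refine le_of_forall_order (C.frob + 1) (fun z => C.mem_one_of_mem_ordGE) ?_
    intro z hz p hp h0
    have hpG : p ∈ C.GamZ := by
      by_contra hc
      obtain ⟨r, hr1, hr2⟩ := C.exists_mem_one_of_mem_GamZ ((C.frob_sub_mem_iff p).2 hc)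
      have := hz r
      rw [C.resF_mul_of_mem hp hr1 (by ring), hr2, mul_one] at this
      exact h0 this
    obtain ⟨r, hr1, hr2⟩ := C.exists_mem_one_of_mem_GamZ hpG
    refine ⟨algebraMap C.R E r, ⟨Submodule.mem_one.2 ⟨r, rfl⟩, fun s => ?_⟩, hr1,
      by rw [hr2]; exact one_ne_zero⟩
    rw [← map_mul]
    exact C.resF_one (Submodule.mem_one.2 ⟨_, rfl⟩)
  exact h1 hz

theorem mem_dual_iff {J : Submodule C.R E} {z : E} :
    z ∈ C.dual J ↔ ∀ y ∈ J, C.resF (z * y) = 0 := by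
  rw [dual, Submodule.mem_div_iff_forall_mul_mem]
  constructor
  · intro h y hy
    exact C.resF_one (h y hy)
  · intro h y hy
    refine C.mem_one_of_resF fun r => ?_
    rw [mul_assoc, mul_comm y, algebraMap_R_apply, ← smul_E_def]
    exact h _ (J.smul_mem r hy)

/-- Functionals that vanish on high orders are represented by the pairing. -/
theorem exists_resF_mul_eq (ψ : E →ₗ[ℂ] ℂ) (p : ℤ) (n : ℕ)
    (hψ : ∀ z ∈ ordGE (p + n), ψ z = 0) : ∃ g : E, ∀ u ∈ ordGE p, C.resF (g * u) = ψ u := by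
  -- The monomials t^{frob-p-k} and t^{p+j} pair unitriangularly, so the functional can be matched
  -- on the `n` exponents where it may be nonzero.
  let P : Matrix (Fin n) (Fin n) ℂ := Matrix.of fun j k =>
    C.resF (HahnSeries.single (C.frob - p - (k : ℕ)) 1 * HahnSeries.single (p + (j : ℕ)) 1)
  have hdet : P.det = 1 := by
    have ht : P.IsUpperTriangular := by
      intro j k (hjk : k < j)
      have : (k : ℕ) < j := hjk
      exact C.resF_mul_high (single_mem_ordGE _ _) (single_mem_ordGE _ _) (by omega)
    rw [Matrix.det_of_isUpperTriangular ht]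
    refine Finset.prod_eq_one fun j _ => ?_
    refine (C.resF_mul_of_mem (single_mem_ordGE _ _) (single_mem_ordGE _ _) (by ring)).trans ?_
    simp
  have hu : IsUnit P.det := by rw [hdet]; exact isUnit_one
  let c := P⁻¹.mulVec fun j : Fin n => ψ (HahnSeries.single (p + (j : ℕ)) 1)
  have hc : P.mulVec c = fun j : Fin n => ψ (HahnSeries.single (p + (j : ℕ)) 1) := by
    rw [Matrix.mulVec_mulVec, Matrix.mul_nonsing_inv _ hu, Matrix.one_mulVec]
  let g : E := ∑ k, c k • HahnSeries.single (C.frob - p - (k : ℕ)) 1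
  have hg : g ∈ ordGE (C.frob + 1 - (p + n)) := by
    refine Submodule.sum_mem _ fun k _ => Submodule.smul_mem _ _ (ordGE_anti ?_
      (single_mem_ordGE _ _))
    have := k.2
    omega
  have hgj : ∀ j : Fin n, C.resF (g * HahnSeries.single (p + (j : ℕ)) 1) =
      ψ (HahnSeries.single (p + (j : ℕ)) 1) := by
    intro j
    rw [← congrFun hc j, Finset.sum_mul, map_sum]
    refine Finset.sum_congr rfl fun k _ => ?_
    rw [csmul_mul, map_smul, smul_eq_mul, mul_comm]
    rfl
  refine ⟨g, fun u hu => ?_⟩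
  let u₁ : E := ∑ j : Fin n, u.coeff (p + (j : ℕ)) • HahnSeries.single (p + (j : ℕ)) 1
  have hu₂ : u - u₁ ∈ ordGE (p + n) := by
    intro i hi
    rw [HahnSeries.coeff_sub]
    have hs : u₁.coeff i = ∑ j : Fin n, if i = p + (j : ℕ) then u.coeff i else 0 := by
      rw [HahnSeries.coeff_sum]
      refine Finset.sum_congr rfl fun j _ => ?_
      rw [HahnSeries.coeff_smul, HahnSeries.coeff_single]
      split_ifs with h
      · rw [h, smul_eq_mul, mul_one]
      · rw [smul_zero]
    rw [hs]
    by_cases hip : i < p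
    · rw [hu i hip, Finset.sum_eq_zero, sub_zero]
      intro j _
      split_ifs <;> rfl
    · have hlt : (i - p).toNat < n := by omega
      rw [Finset.sum_eq_single ⟨(i - p).toNat, hlt⟩, if_pos (by simp; omega), sub_self]
      · intro j _ hj
        refine if_neg fun h => hj (Fin.ext ?_)
        simp only
        omega
      · intro h
        exact absurd (Finset.mem_univ _) h
  have h1 : C.resF (g * (u - u₁)) = 0 := C.resF_mul_high hg hu₂ (by omega)
  have h2 := hψ _ hu₂
  have h3 : C.resF (g * u₁) = ψ u₁ := by
    simp only [u₁, Finset.mul_sum, map_sum, mul_csmul, map_smul, hgj]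
  rw [mul_sub, map_sub, sub_eq_zero] at h1
  rw [map_sub, sub_eq_zero] at h2
  rw [h1, h2, h3]

/-- A point outside `J` is separated from `J` by a functional. It vanishes on high orders because
`J` contains them, hence is represented by an element of the dual. -/
theorem dual_dual {J : Submodule C.R E} {a b : ℤ} (ha : ordGE a ≤ C.toC J)
    (hb : C.toC J ≤ ordGE b) : C.dual (C.dual J) = J := by
  refine le_antisymm (fun z hz => ?_) fun z hz => C.mem_dual_iff.2 fun y hy => ?_
  · by_contra hc
    obtain ⟨ψ, hψ, hle⟩ := Submodule.exists_le_ker_of_notMem (p := C.toC J) (v := z) hc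
    obtain ⟨p, hp⟩ := exists_mem_ordGE z
    obtain ⟨g, hg⟩ := C.exists_resF_mul_eq ψ (min p b) (a - min p b).toNat fun u hu =>
      hle (ha (ordGE_anti (by omega) hu))
    have h1 : g ∈ C.dual J := C.mem_dual_iff.2 fun y hy => by
      rw [hg y (ordGE_anti (min_le_right _ _) (hb hy))]
      exact hle hy
    have h2 := C.mem_dual_iff.1 hz g h1
    rw [mul_comm, hg z (ordGE_anti (min_le_left _ _) hp)] at h2
    exact hψ h2
  · rw [mul_comm]
    exact C.mem_dual_iff.1 hy z hz

end GenericBranch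

end

noncomputable section

theorem LevelSystem.clSum_eq_zero {G H A : Type} [CommRing G] [CommRing H] [Fintype G]
    [CommRing A] (S : LevelSystem G H) {i : H} {f : G → A}
    (h : ∀ r, S.cl r = i → f r = 0) : S.clSum i f = 0 := by
  classical
  exact Finset.sum_eq_zero fun r hr => h r (by simpa using hr)

namespace GenericBranch

variable (C : GenericBranch)

instance : NeZero C.d := ⟨C.d_pos.ne'⟩

/-! ### The combinatorics of a semimodule -/

/-- Cofinite sets of exponents that contain `0` and are stable under adding the orders of `x`
and `y`. -/
structure IsExpSet (D : Set ℕ) : Prop where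
  zero_mem : 0 ∈ D
  add_q_mem : ∀ e ∈ D, e + C.q ∈ D
  add_w_mem : ∀ e ∈ D, e + C.w ∈ D
  exists_bound : ∃ N, ∀ e, N ≤ e → e ∈ D

/-- The smallest exponent in a residue class. -/
def gen (D : Set ℕ) (r : ZMod C.q) : ℕ := sInf {e | e ∈ D ∧ (e : ZMod C.q) = r}

variable {C} {D : Set ℕ}

theorem IsExpSet.add_q_mul_mem (hD : C.IsExpSet D) {e : ℕ} (he : e ∈ D) (a : ℕ) :
    e + C.q * a ∈ D := by
  induction a with
  | zero => exact he
  | succ a ih =>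
    rw [mul_add, mul_one, ← add_assoc]
    exact hD.add_q_mem _ ih

theorem IsExpSet.gen_spec (hD : C.IsExpSet D) (r : ZMod C.q) :
    C.gen D r ∈ D ∧ (C.gen D r : ZMod C.q) = r := by
  refine Nat.sInf_mem (s := {e | e ∈ D ∧ (e : ZMod C.q) = r}) ?_
  obtain ⟨N, hN⟩ := hD.exists_bound
  refine ⟨r.val + C.q * N, hN _ ?_, ?_⟩
  · have := Nat.le_mul_of_pos_left N C.q_pos
    omega
  · simp

theorem gen_le {e : ℕ} (he : e ∈ D) : C.gen D e ≤ e := Nat.sInf_le ⟨he, rfl⟩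

theorem IsExpSet.exists_eq_add (hD : C.IsExpSet D) {e : ℕ} (he : C.gen D e ≤ e) :
    ∃ a, e = C.gen D e + C.q * a := by
  have h1 : C.gen D e ≡ e [MOD C.q] := (ZMod.natCast_eq_natCast_iff _ _ _).1 (hD.gen_spec e).2
  obtain ⟨a, ha⟩ := (Nat.modEq_iff_dvd' he).1 h1
  exact ⟨a, by omega⟩

theorem IsExpSet.mem_iff (hD : C.IsExpSet D) {e : ℕ} : e ∈ D ↔ C.gen D e ≤ e := by
  refine ⟨gen_le, fun he => ?_⟩
  obtain ⟨a, ha⟩ := hD.exists_eq_add he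
  rw [ha]
  exact hD.add_q_mul_mem (hD.gen_spec _).1 a

theorem IsExpSet.add_mem (hD : C.IsExpSet D) {e k : ℕ} (he : e ∈ D) {r : ZMod C.q}
    (hr : (e : ZMod C.q) = r) (hk : C.gen D r + k ∈ D) : e + k ∈ D := by
  obtain ⟨a, ha⟩ := hD.exists_eq_add (gen_le he)
  rw [ha, hr, add_right_comm]
  exact hD.add_q_mul_mem hk a

theorem IsExpSet.add_mem_of_gen_le (hD : C.IsExpSet D) {e : ℕ}
    (he : ∀ r, C.gen D r ≤ e) : e ∈ D := hD.mem_iff.2 (he _)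

theorem exists_gen_max (D : Set ℕ) : ∃ r₀, ∀ r, C.gen D r ≤ C.gen D r₀ :=
  Finite.exists_max _

variable (C) in
/-- Reduction of residues modulo `d`. -/
def cl : ZMod C.q →+* ZMod C.d := ZMod.castHom (dvd_mul_right _ _) _

theorem cl_natCast (a : ℕ) : C.cl (a : ZMod C.q) = (a : ZMod C.d) := map_natCast _ _

theorem cl_w : C.cl (C.w : ZMod C.q) = 0 := by
  rw [cl_natCast, Nat.cast_mul, ZMod.natCast_self, zero_mul]

/-- After division by d the congruence reads j·m ≡ t mod n, solvable since gcd(n, m) = 1. Hence each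
class mod d is one cycle. -/
theorem cl_orbit (r r' : ZMod C.q) (h : C.cl r = C.cl r') : ∃ j : ℕ, r' = r + j • (C.w : ZMod C.q) := by
  obtain ⟨s, hs⟩ := ZMod.natCast_zmod_surjective (r' - r)
  have h1 : C.d ∣ s := by
    rw [← ZMod.natCast_eq_zero_iff, ← cl_natCast, hs, map_sub, h, sub_self]
  obtain ⟨t, rfl⟩ := h1
  have : NeZero C.n := ⟨C.n_pos.ne'⟩
  obtain ⟨j, hj⟩ := ZMod.natCast_zmod_surjective ((t : ZMod C.n) * (C.m : ZMod C.n)⁻¹)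
  refine ⟨j, ?_⟩
  have h2 : ((j * C.m : ℕ) : ZMod C.n) = (t : ℕ) := by
    rw [Nat.cast_mul, hj, mul_assoc, mul_comm _ (C.m : ZMod C.n),
      ZMod.coe_mul_inv_eq_one _ C.coprime.symm, mul_one]
  have h3 : C.d * (j * C.m) ≡ C.d * t [MOD C.q] :=
    Nat.ModEq.mul_left' C.d ((ZMod.natCast_eq_natCast_iff _ _ _).1 h2)
  have h4 := (ZMod.natCast_eq_natCast_iff _ _ _).2 h3
  rw [hs] at h4
  rw [← sub_eq_iff_eq_add', ← h4, nsmul_eq_mul, ← Nat.cast_mul]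
  congr 1
  simp only [w]
  ring

variable (C) in
/-- Every class modulo `d` has a generator `a` with `a + dm + 1` in the set. -/
def IsAdm (D : Set ℕ) : Prop :=
  ∀ i : ZMod C.d, ∃ r, C.cl r = i ∧ C.gen D r + C.w + 1 ∈ D

open Classical in
/-- The equations for the modules with a given set of orders that contain a given monomial. -/
def IsExpSet.levelSystem (hD : C.IsExpSet D) (hA : C.IsAdm D) {t : ℕ} (ht : t ∈ D) :
    LevelSystem (ZMod C.q) (ZMod C.d) where
  cl := C.cl
  w := C.w
  T k := {r | C.gen D r + k ∉ D}
  E k := {r | C.gen D r + C.w + k ∉ D}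
  pin k := t + k ∉ D
  base := t
  y k := PowerSeries.coeff k C.y'
  y_zero := C.coeff_zero_y'
  y_one := C.coeff_one_y'
  cl_w := cl_w
  orbit := cl_orbit
  step i i' := ⟨(i' - i).val, by simp⟩
  left_mem k r hr := by
    simp only [Finset.mem_filter, Finset.mem_univ, true_and] at *
    intro h
    refine hr ?_
    rw [add_right_comm]
    exact hD.add_w_mem _ h
  right_mem k r hr := by
    simp only [Finset.mem_filter, Finset.mem_univ, true_and] at *
    refine fun h => hr (hD.add_mem (hD.add_w_mem _ (hD.gen_spec r).1) ?_ h)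
    rw [Nat.cast_add, (hD.gen_spec r).2]
  -- Every exponent from the largest generator on lies in `D`, so the residue of that generator
  -- never carries an equation.
  exists_incomplete k := by
    obtain ⟨r, hr⟩ := C.exists_gen_max D
    refine ⟨r, fun r' hr' => ⟨r, rfl, ?_⟩⟩
    simp only [Finset.mem_filter, Finset.mem_univ, true_and, not_not]
    refine hD.add_mem_of_gen_le fun r' => ?_
    have := hr r'
    omega
  incomplete_one i := by simpa using hA i
  -- If gen r + k were in `D`, the missing equation of r + k at level 1 would put gen r + k + w + 1
  -- in `D`, against the equation of r at level k + 1.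
  mem_left_of_complete k r hk h hr := by
    simp only [Finset.mem_filter, Finset.mem_univ, true_and, not_not] at *
    intro hc
    refine h r rfl ?_
    have := hD.add_mem (k := C.w + 1) hc (r := r + k) (by rw [Nat.cast_add, (hD.gen_spec r).2])
      (by rwa [← add_assoc])
    convert this using 1
    omega
  mem_right_of_complete k r hk h hr := by
    simp only [Finset.mem_filter, Finset.mem_univ, true_and, not_not] at *
    intro hc
    refine h r rfl ?_
    have := hD.add_mem hr (k := k)
      (by rw [Nat.cast_add, Nat.cast_add, (hD.gen_spec r).2, Nat.cast_one]) hc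
    convert this using 1
    omega
  pin_mem k hk := by
    simp only [Finset.mem_filter, Finset.mem_univ, true_and]
    exact fun h => hk (hD.add_mem ht rfl h)

/-! ### Modules with a given set of orders -/

/-- The modules spanned by a triangular family are stable under `y`. -/
def IsYStable (C : GenericBranch) (D : Set ℕ) (Λ : ZMod C.q → ℕ → ℂ) : Prop :=
  ∀ r k, C.gen D r + C.w + k ∉ D →
    kap (fun j => PowerSeries.coeff j C.y') (C.w : ZMod C.q) Λ r k = 0

/-- If a class were not admissible, all its equations at level 1 would hold. Their sum, in which the
family cancels, is the size of the class times λ, which is nonzero. -/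
theorem IsYStable.isAdm {Λ : ZMod C.q → ℕ → ℂ} (h0 : ∀ r, Λ r 0 = 1)
    (hΛ : IsYStable C D Λ) : C.IsAdm D := by
  classical
  intro i
  by_contra! hc
  have h1 : ∑ r with C.cl r = i, kap (fun j => PowerSeries.coeff j C.y') (C.w : ZMod C.q) Λ r 1 =
      0 := Finset.sum_eq_zero fun r hr => hΛ r 1 (hc r (Finset.mem_filter.1 hr).2)
  have h2 : ∑ r with C.cl r = i, Λ (r + C.w) 1 = ∑ r with C.cl r = i, Λ r 1 := by
    refine Finset.sum_equiv (Equiv.addRight (C.w : ZMod C.q)) (fun r => ?_) fun r _ => rfl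
    simp
  simp only [kap_one (y := fun j => PowerSeries.coeff j C.y') C.coeff_zero_y' h0, Finset.sum_sub_distrib, Finset.sum_add_distrib, h2,
    add_sub_cancel_right, Finset.sum_const, nsmul_eq_mul] at h1
  rcases mul_eq_zero.1 h1 with h | h
  · have h3 : (Finset.univ.filter fun r : ZMod C.q => C.cl r = i) = ∅ := by
      exact Finset.card_eq_zero.1 (by exact_mod_cast h)
    have h4 : ((i.val : ℕ) : ZMod C.q) ∈ (Finset.univ.filter fun r : ZMod C.q => C.cl r = i) := by
      rw [Finset.mem_filter, cl_natCast]
      simp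
    rw [h3] at h4
    exact absurd h4 (Finset.notMem_empty _)
  · exact C.coeff_one_y' (by simpa using h)

theorem IsYStable.mul_mem (hD : C.IsExpSet D) {Λ : ZMod C.q → ℕ → ℂ} (h0 : ∀ r, Λ r 0 = 1)
    (hΛ : IsYStable C D Λ) {f h : ℂ⟦X⟧} (hf : f ∈ C.R) (hh : h ∈ famSpan Λ D) :
    f * h ∈ famSpan Λ D := by
  have hy : ∀ h ∈ famSpan Λ D, C.y * h ∈ famSpan Λ D := by
    intro h hh
    refine mul_mem_famSpan h0 (fun b hb => mem_famSpan.2 fun e he => ?_) hh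
    rw [y_eq, coord_mul_fam]
    split_ifs with hlt
    · rfl
    · refine hΛ _ _ fun hc => he ?_
      have h1 := hD.add_mem (k := C.w + (e - (b + C.w))) hb rfl (by rwa [← add_assoc])
      convert h1 using 1
      omega
  obtain ⟨N, hN⟩ := hD.exists_bound
  obtain ⟨p, hp, g, hg⟩ := C.exists_adjoin_sub hf N
  have h1 : (f - p) * h ∈ famSpan Λ D :=
    mem_famSpan_of_dvd hN ⟨g * h, by rw [hg, mul_assoc]⟩
  have h2 : ∀ h ∈ famSpan Λ D, p * h ∈ famSpan Λ D := by
    clear hg h1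
    induction hp using Algebra.adjoin_induction with
    | mem x hx =>
      rcases hx with rfl | rfl
      · exact fun h hh => X_pow_q_mul_mem_famSpan hD.add_q_mem hh
      · exact hy
    | algebraMap r =>
      intro h hh
      rw [← Algebra.smul_def]
      exact Submodule.smul_mem _ _ hh
    | add x y _ _ hx hy =>
      intro h hh
      rw [add_mul]
      exact Submodule.add_mem _ (hx h hh) (hy h hh)
    | mul x y _ _ hx hy =>
      intro h hh
      rw [mul_assoc]
      exact hx _ (hy h hh)
  have h3 := Submodule.add_mem _ h1 (h2 h hh)
  rwa [← add_mul, sub_add_cancel] at h3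

theorem IsExpSet.isYStable (hD : C.IsExpSet D) {Λ : ZMod C.q → ℕ → ℂ} (h0 : ∀ r, Λ r 0 = 1)
    (hy : ∀ h ∈ famSpan Λ D, C.y * h ∈ famSpan Λ D) : IsYStable C D Λ := by
  intro r k hk
  have h1 := mem_famSpan.1 (hy _ (fam_mem_famSpan h0 (hD.gen_spec r).1)) _ hk
  rwa [y_eq, coord_mul_fam, if_neg (by omega), (hD.gen_spec r).2, Nat.add_sub_cancel_left] at h1

theorem X_pow_mem_famSpan_iff {Λ : ZMod C.q → ℕ → ℂ} {t : ℕ} :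
    PowerSeries.X ^ t ∈ famSpan Λ D ↔ ∀ k, t + k ∉ D →
      red Λ (t : ZMod C.q) (fun j => if j = 0 then 1 else 0) k = 0 := by
  rw [mem_famSpan]
  constructor
  · intro h k hk
    have h1 := h _ hk
    rwa [coord_X_pow, if_neg (by omega), Nat.add_sub_cancel_left] at h1
  · intro h e he
    rw [coord_X_pow]
    split_ifs with hlt
    · rfl
    · exact h _ (by rwa [Nat.add_sub_cancel' (not_lt.1 hlt)])

theorem IsExpSet.isSolution_iff (hD : C.IsExpSet D) (hA : C.IsAdm D) {t : ℕ} (ht : t ∈ D)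
    {Λ : ZMod C.q → ℕ → ℂ} : (hD.levelSystem hA ht).IsSolution Λ ↔
      (∀ r, Λ r 0 = 1) ∧ (∀ r k, 1 ≤ k → C.gen D r + k ∈ D → Λ r k = 0) ∧ IsYStable C D Λ ∧
        PowerSeries.X ^ t ∈ famSpan Λ D := by
  have hE : ∀ k r, r ∈ (hD.levelSystem hA ht).E k ↔ C.gen D r + C.w + k ∉ D := by
    simp [levelSystem]
  have hT : ∀ k r, r ∉ (hD.levelSystem hA ht).T k ↔ C.gen D r + k ∈ D := by
    simp [levelSystem]
  constructor
  · intro h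
    refine ⟨h.zero, fun r k hk hr => (h.level k hk).supp r ((hT k r).2 hr), fun r k hr => ?_,
      X_pow_mem_famSpan_iff.2 fun k hk => ?_⟩
    · rcases Nat.eq_zero_or_pos k with rfl | hk
      · exact absurd (hD.add_w_mem _ (hD.gen_spec r).1) hr
      · exact (h.level k hk).edge r ((hE k r).2 hr)
    · rcases Nat.eq_zero_or_pos k with rfl | hk0
      · exact absurd ht hk
      · exact (h.level k hk0).pinned hk
  · rintro ⟨h0, h1, h2, h3⟩
    refine ⟨h0, fun k hk => ⟨fun r hr => h1 r k hk ((hT k r).1 hr),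
      fun r hr => h2 r k ((hE k r).1 hr), fun hp => X_pow_mem_famSpan_iff.1 h3 k hp,
      fun i hi => ?_⟩⟩
    -- The solvability conditions add nothing: they are sums of equations of the next level.
    exact LevelSystem.clSum_eq_zero _ fun r hr => h2 r (k + 1)
      ((hE _ r).1 ((hD.levelSystem hA ht).mem_B.1 hi r hr))

end GenericBranch

end

noncomputable section

namespace GenericBranch

variable {C : GenericBranch} {D : Set ℕ}

/-! ### Counting -/

open Classical in
/-- The number of free parameters. -/
theorem IsExpSet.sum_levels (hD : C.IsExpSet D) (hA : C.IsAdm D) {t : ℕ} (ht : t ∈ D) (K : ℕ) :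
    ∑ k ∈ Finset.Icc 1 K, ((((hD.levelSystem hA ht).T k).card : ℤ) -
      ((hD.levelSystem hA ht).E k).card - (if (hD.levelSystem hA ht).pin k then 1 else 0)) =
    (∑ r, (((Finset.Icc 1 K).filter fun k => C.gen D r + k ∉ D).card : ℤ)) -
    (∑ r, (((Finset.Icc 1 K).filter fun k => C.gen D r + C.w + k ∉ D).card : ℤ)) -
    ((Finset.Icc 1 K).filter fun k => t + k ∉ D).card := by
  have h : ∀ f : ZMod C.q → ℕ, ∑ r, (((Finset.Icc 1 K).filter fun k => f r + k ∉ D).card : ℤ) =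
      ∑ k ∈ Finset.Icc 1 K, ((Finset.univ.filter fun r => f r + k ∉ D).card : ℤ) := by
    intro f
    simp only [Finset.card_filter, Nat.cast_sum]
    rw [Finset.sum_comm]
  rw [h, h fun r => C.gen D r + C.w, Finset.card_filter, Nat.cast_sum, ← Finset.sum_sub_distrib,
    ← Finset.sum_sub_distrib]
  refine Finset.sum_congr rfl fun k _ => ?_
  congr 1
  simp only [levelSystem]
  by_cases h : t + k ∈ D <;> simp [h]

/-! ### Dictionary between semimodules and exponent sets. -/

/-- The natural numbers in a set of integers. -/
def natSet (Δ : Set ℤ) : Set ℕ := {e | (e : ℤ) ∈ Δ}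

variable {Δ : Set ℤ}

theorem IsNormalizedSemimodule.nonneg (hΔ : C.IsNormalizedSemimodule Δ) {a : ℤ} (ha : a ∈ Δ) :
    0 ≤ a := hΔ.isLeast.2 ha

theorem mem_GamZ_of_frob_lt {a : ℤ} (h : C.frob < a) : a ∈ C.GamZ := by
  rw [← not_not (a := a ∈ C.GamZ), ← C.frob_sub_mem_iff]
  intro h'
  have := h'.1
  omega

theorem natCast_mem_GamZ {e : ℕ} : (e : ℤ) ∈ C.GamZ ↔ e ∈ C.GamN := by
  simp [GamZ]

theorem natCast_q_mem : (C.q : ℤ) ∈ C.GamZ := by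
  have h := C.mem_R_iff.1 C.x_mem
  exact natCast_mem_GamZ.2 (mem_of_mem_famSpan h dvd_rfl (by simp))

theorem natCast_w_mem : (C.w : ℤ) ∈ C.GamZ := by
  have h := C.mem_R_iff.1 C.y_mem
  refine natCast_mem_GamZ.2 (mem_of_mem_famSpan h ⟨_, C.y_eq⟩ ?_)
  rw [C.coeff_dm]
  exact one_ne_zero

theorem IsNormalizedSemimodule.isExpSet (hΔ : C.IsNormalizedSemimodule Δ) :
    C.IsExpSet (natSet Δ) where
  zero_mem := hΔ.isLeast.1
  add_q_mem e he := by
    have := hΔ.add_mem _ (C.Gam_eq ▸ natCast_q_mem) _ he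
    rwa [add_comm, ← Nat.cast_add] at this
  add_w_mem e he := by
    have := hΔ.add_mem _ (C.Gam_eq ▸ natCast_w_mem) _ he
    rwa [add_comm, ← Nat.cast_add] at this
  exists_bound := by
    refine ⟨(C.frob + 1).toNat, fun e he => ?_⟩
    have := hΔ.add_mem (e : ℤ) (C.Gam_eq ▸ mem_GamZ_of_frob_lt (by omega)) 0 hΔ.isLeast.1
    rwa [add_zero] at this

theorem IsNormalizedSemimodule.gens_eq (hΔ : C.IsNormalizedSemimodule Δ) :
    C.gens Δ = Set.range fun r => (C.gen (natSet Δ) r : ℤ) := by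
  have hD := hΔ.isExpSet
  ext a
  constructor
  · rintro ⟨h1, h2⟩
    obtain ⟨b, rfl⟩ := Int.eq_ofNat_of_zero_le (hΔ.nonneg h1)
    refine ⟨b, ?_⟩
    obtain ⟨c, hc⟩ := hD.exists_eq_add (gen_le (C := C) (D := natSet Δ) h1)
    rcases c with _ | c
    · simp only
      omega
    · refine absurd (hD.add_q_mul_mem (hD.gen_spec b).1 c) fun h => h2 ?_
      change ((_ : ℕ) : ℤ) ∈ Δ at h
      convert h using 1
      rw [mul_add, mul_one] at hc
      change (b : ℤ) - ((C.q : ℕ) : ℤ) = _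
      omega
  · rintro ⟨r, rfl⟩
    refine ⟨(hD.gen_spec r).1, fun h => ?_⟩
    obtain ⟨b, hb⟩ := Int.eq_ofNat_of_zero_le (hΔ.nonneg h)
    rw [hb] at h
    have h1 := gen_le (C := C) (D := natSet Δ) h
    have h2 : C.gen (natSet Δ) r = b + C.q := by
      change (C.gen (natSet Δ) r : ℤ) - ((C.q : ℕ) : ℤ) = b at hb
      omega
    have h3 : ((b : ℕ) : ZMod C.q) = r := by
      rw [← (hD.gen_spec r).2, h2]
      simp
    rw [h3] at h1
    have := C.q_pos
    omega

theorem IsExpSet.gen_injective (hD : C.IsExpSet D) : Function.Injective (C.gen D) :=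
  fun r r' h => by rw [← (hD.gen_spec r).2, h, (hD.gen_spec r').2]

theorem IsNormalizedSemimodule.isAdmissible_iff (hΔ : C.IsNormalizedSemimodule Δ) :
    C.IsAdmissible Δ ↔ C.IsAdm (natSet Δ) := by
  have hD := hΔ.isExpSet
  have hcl : ∀ (r : ZMod C.q) (i : ℕ), (C.gen (natSet Δ) r : ℤ) ≡ (i : ℤ) [ZMOD (C.d : ℤ)] ↔
      C.cl r = i := by
    intro r i
    rw [← ZMod.intCast_eq_intCast_iff, Int.cast_natCast, Int.cast_natCast, ← cl_natCast,
      (hD.gen_spec r).2]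
  simp only [IsAdmissible, IsAdmissibleAt, hΔ.gens_eq, Set.exists_range_iff, hcl]
  constructor
  · intro h i
    obtain ⟨r, h1, h2⟩ := h i.val i.val_lt
    exact ⟨r, by simpa using h1, by exact_mod_cast h2⟩
  · intro h i _
    obtain ⟨r, h1, h2⟩ := h i
    exact ⟨r, h1, by exact_mod_cast h2⟩

-- The count may start at k = 1, as the levels do, because `a` itself is not a gap.
open Classical in
theorem ncard_gaps {K : ℕ} (hK : ∀ e, K < e → e ∈ natSet Δ) {a : ℕ} (ha : a ∈ natSet Δ) :
    (gaps Δ a).ncard = ((Finset.Icc 1 K).filter fun k => a + k ∉ natSet Δ).card := by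
  rw [← Set.ncard_coe_finset, ← Set.ncard_image_of_injective (f := fun k : ℕ => ((a + k : ℕ) : ℤ)) _
    fun k k' h => by simpa using h]
  congr 1
  ext b
  simp only [gaps, Set.mem_sdiff, Set.mem_Ici, Finset.coe_filter, Set.mem_image, Set.mem_ofPred_eq,
    Finset.mem_Icc]
  constructor
  · rintro ⟨h1, h2⟩
    obtain ⟨k, rfl⟩ : ∃ k : ℕ, b = ((a + k : ℕ) : ℤ) := ⟨(b - a).toNat, by omega⟩
    refine ⟨k, ⟨⟨?_, ?_⟩, h2⟩, rfl⟩
    · by_contra hc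
      obtain rfl : k = 0 := by omega
      exact h2 ha
    · by_contra hc
      exact h2 (hK _ (by omega))
  · rintro ⟨k, ⟨-, h2⟩, rfl⟩
    exact ⟨by omega, h2⟩

open Classical in
theorem IsNormalizedSemimodule.dimOf_eq (hΔ : C.IsNormalizedSemimodule Δ) {K : ℕ}
    (hK : ∀ e, K < e → e ∈ natSet Δ) : C.dimOf Δ =
    (∑ r, (((Finset.Icc 1 K).filter fun k => C.gen (natSet Δ) r + k ∉ natSet Δ).card : ℤ)) -
    ∑ r, (((Finset.Icc 1 K).filter fun k => C.gen (natSet Δ) r + C.w + k ∉ natSet Δ).card : ℤ) := by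
  have hD := hΔ.isExpSet
  have hi : Function.Injective fun r => (C.gen (natSet Δ) r : ℤ) :=
    Nat.cast_injective.comp hD.gen_injective
  rw [dimOf, hΔ.gens_eq, finsum_mem_range hi, finsum_mem_range hi, finsum_eq_sum_of_fintype,
    finsum_eq_sum_of_fintype]
  congr 1
  · exact Finset.sum_congr rfl fun r _ => by rw [ncard_gaps hK (hD.gen_spec r).1]
  · refine Finset.sum_congr rfl fun r _ => ?_
    rw [← Nat.cast_add, ncard_gaps hK (hD.add_w_mem _ (hD.gen_spec r).1)]

theorem deltaOf_eq : deltaOf Δ = (natSet Δ)ᶜ.ncard := by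
  rw [deltaOf, ← Set.ncard_image_of_injective (natSet Δ)ᶜ (Nat.cast_injective (R := ℤ))]
  congr 1
  ext b
  constructor
  · rintro ⟨h1, h2⟩
    obtain ⟨k, rfl⟩ := Int.eq_ofNat_of_zero_le h1
    exact ⟨k, h2, rfl⟩
  · rintro ⟨k, h, rfl⟩
    exact ⟨Int.natCast_nonneg k, h⟩

theorem IsExpSet.finite_compl (hD : C.IsExpSet D) : Dᶜ.Finite := by
  obtain ⟨N, hN⟩ := hD.exists_bound
  refine (Set.finite_lt_nat N).subset fun e he => ?_
  by_contra hc
  exact he (hN e (not_lt.1 hc))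

theorem finite_compl_GamN : C.GamNᶜ.Finite := by
  refine (Set.finite_lt_nat (C.wtMax + 1)).subset fun e he => ?_
  by_contra hc
  exact he (C.mem_GamN_of_lt (by have : ¬ e < C.wtMax + 1 := hc; omega))

/-- The exponents in `D` that are not in `t + Γ`. -/
def basisSet (C : GenericBranch) (D : Set ℕ) (t : ℕ) : Set ℕ :=
  {b | b ∈ D ∧ (b : ℤ) - t ∉ C.GamZ}

/-- Count the natural numbers outside t + Γ in two ways: those below t together with translated gaps
of Γ, or `basisSet` together with the gaps of `D`. For t = τ - e(Δ) this makes `basisSet` have τ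
elements. -/
theorem ncard_basisSet (hf : Dᶜ.Finite) {t : ℕ}
    (ht : ∀ b : ℕ, (b : ℤ) - t ∈ C.GamZ → b ∈ D) :
    (basisSet C D t).Finite ∧ (basisSet C D t).ncard + Dᶜ.ncard = t + C.delta := by
  have h1 : {b : ℕ | (b : ℤ) - t ∉ C.GamZ} = Set.Iio t ∪ (fun e => t + e) '' C.GamNᶜ := by
    ext b
    simp only [Set.mem_ofPred_eq, Set.mem_union, Set.mem_Iio, Set.mem_image, Set.mem_compl_iff]
    constructor
    · intro h
      rcases Nat.lt_or_ge b t with hb | hb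
      · exact Or.inl hb
      · refine Or.inr ⟨b - t, fun hc => h ?_, by omega⟩
        rw [← natCast_mem_GamZ] at hc
        rwa [← Nat.cast_sub hb]
    · rintro (h | ⟨e, he, rfl⟩) hc
      · have := hc.1
        omega
      · rw [Nat.cast_add, add_sub_cancel_left, natCast_mem_GamZ] at hc
        exact he hc
  have h2 : {b : ℕ | (b : ℤ) - t ∉ C.GamZ} = basisSet C D t ∪ Dᶜ := by
    ext b
    simp only [Set.mem_ofPred_eq, Set.mem_union, basisSet, Set.mem_compl_iff]
    have := ht b
    tauto
  have h3 : ((fun e => t + e) '' C.GamNᶜ).Finite := finite_compl_GamN.image _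
  have h4 : (basisSet C D t ∪ Dᶜ).Finite := by
    rw [← h2, h1]
    exact (Set.finite_Iio t).union h3
  have h5 := h4.subset Set.subset_union_left
  refine ⟨h5, ?_⟩
  rw [← Set.ncard_union_eq _ h5 hf, ← h2, h1, Set.ncard_union_eq _ (Set.finite_Iio t) h3,
    Set.ncard_image_of_injective _ (add_right_injective t), C.delta_eq]
  · congr 1
    rw [← Finset.coe_Iio, Set.ncard_coe_finset, Nat.card_Iio]
  · rw [Set.disjoint_left]
    rintro _ h ⟨e, -, rfl⟩
    simp at h
  · rw [Set.disjoint_left]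
    exact fun b h h' => h' h.1

end GenericBranch

/-! ### Reduced elements -/

theorem exists_reduced {V : Submodule ℂ ℂ⟦X⟧} {D : Set ℕ} {N : ℕ}
    (hN : ∀ h : ℂ⟦X⟧, PowerSeries.X ^ N ∣ h → h ∈ V)
    (hV : ∀ a ∈ D, ∃ h ∈ V, PowerSeries.X ^ a ∣ h ∧ PowerSeries.coeff a h = 1) {a : ℕ}
    (ha : a ∈ D) : ∃ h ∈ V, PowerSeries.X ^ a ∣ h ∧ PowerSeries.coeff a h = 1 ∧
      ∀ e ∈ D, a < e → PowerSeries.coeff e h = 0 := by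
  have key : ∀ K, ∃ h ∈ V, PowerSeries.X ^ a ∣ h ∧ PowerSeries.coeff a h = 1 ∧
      ∀ e ∈ D, a < e → e < K → PowerSeries.coeff e h = 0 := by
    intro K
    induction K with
    | zero =>
      obtain ⟨h, h1, h2, h3⟩ := hV a ha
      exact ⟨h, h1, h2, h3, fun e _ _ he => absurd he (Nat.not_lt_zero e)⟩
    | succ K ih =>
      obtain ⟨h, h1, h2, h3, h4⟩ := ih
      by_cases hK : K ∈ D ∧ a < K
      · obtain ⟨g, g1, g2, g3⟩ := hV K hK.1
        refine ⟨h - PowerSeries.coeff K h • g, V.sub_mem h1 (V.smul_mem _ g1),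
          dvd_sub h2 (dvd_smul_of_dvd _ ((pow_dvd_pow _ hK.2.le).trans g2)), ?_, fun e he hae heK => ?_⟩
        · rw [map_sub, PowerSeries.coeff_smul, PowerSeries.X_pow_dvd_iff.1 g2 a hK.2, h3,
            smul_zero, sub_zero]
        · rw [map_sub, PowerSeries.coeff_smul]
          rcases Nat.lt_or_eq_of_le (Nat.lt_succ_iff.1 heK) with h | rfl
          · rw [h4 e he hae h, PowerSeries.X_pow_dvd_iff.1 g2 e h, smul_zero, sub_zero]
          · rw [g3, smul_eq_mul, mul_one, sub_self]
      · refine ⟨h, h1, h2, h3, fun e he hae heK => ?_⟩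
        rcases Nat.lt_or_eq_of_le (Nat.lt_succ_iff.1 heK) with h | rfl
        · exact h4 e he hae h
        · exact absurd ⟨he, hae⟩ hK
  obtain ⟨h, h1, h2, h3, h4⟩ := key (max N (a + 1))
  refine ⟨(PowerSeries.trunc (max N (a + 1)) h : ℂ⟦X⟧), ?_, ?_, ?_, fun e he hae => ?_⟩
  · have h5 : h - (PowerSeries.trunc (max N (a + 1)) h : ℂ⟦X⟧) ∈ V := by
      refine hN _ (PowerSeries.X_pow_dvd_iff.2 fun m hm => ?_)
      rw [map_sub, Polynomial.coeff_coe, PowerSeries.coeff_trunc,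
        if_pos (lt_max_of_lt_left hm), sub_self]
    simpa using V.sub_mem h1 h5
  · refine PowerSeries.X_pow_dvd_iff.2 fun m hm => ?_
    rw [Polynomial.coeff_coe, PowerSeries.coeff_trunc, PowerSeries.X_pow_dvd_iff.1 h2 m hm, ite_self]
  · rw [Polynomial.coeff_coe, PowerSeries.coeff_trunc, if_pos (by omega), h3]
  · rw [Polynomial.coeff_coe, PowerSeries.coeff_trunc]
    split_ifs with hlt
    · exact h4 e he hae hlt
    · rfl

namespace GenericBranch

variable {C : GenericBranch} {D : Set ℕ}

/-- The triangular families in which no exponent of `D` occurs except the leading one. -/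
def IsReduced (C : GenericBranch) (D : Set ℕ) (Λ : ZMod C.q → ℕ → ℂ) : Prop :=
  (∀ r, Λ r 0 = 1) ∧ ∀ r k, 1 ≤ k → C.gen D r + k ∈ D → Λ r k = 0

/-- A module with set of orders `D` is the closed span of a reduced family. -/
theorem IsExpSet.exists_famSpan_eq (hD : C.IsExpSet D) {V : Submodule ℂ ℂ⟦X⟧} {N : ℕ}
    (hN : ∀ h : ℂ⟦X⟧, PowerSeries.X ^ N ∣ h → h ∈ V)
    (hV : ∀ a ∈ D, ∃ h ∈ V, PowerSeries.X ^ a ∣ h ∧ PowerSeries.coeff a h = 1)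
    (hV' : ∀ h ∈ V, ∀ a, PowerSeries.X ^ a ∣ h → PowerSeries.coeff a h ≠ 0 → a ∈ D)
    (hx : ∀ h ∈ V, PowerSeries.X ^ C.q * h ∈ V) :
    ∃ Λ, C.IsReduced D Λ ∧ famSpan Λ D = V := by
  -- Reduced elements are needed only at the generators; multiplication by powers of x gives the
  -- others.
  choose f f1 f2 f3 f4 using fun r => exists_reduced hN hV (hD.gen_spec r).1
  let Λ : ZMod C.q → ℕ → ℂ := fun r k => PowerSeries.coeff (C.gen D r + k) (f r)
  have h0 : ∀ r, Λ r 0 = 1 := f3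
  have hf : ∀ r, fam Λ (C.gen D r) = f r := by
    intro r
    ext k
    rw [fam, PowerSeries.coeff_X_pow_mul', (hD.gen_spec r).2]
    split_ifs with h
    · rw [PowerSeries.coeff_mk]
      simp only [Λ]
      rw [Nat.add_sub_cancel' h]
    · exact (PowerSeries.X_pow_dvd_iff.1 (f2 r) k (not_le.1 h)).symm
  have hx' : ∀ a : ℕ, ∀ h ∈ V, PowerSeries.X ^ (C.q * a) * h ∈ V := by
    intro a
    induction a with
    | zero => simp
    | succ a ih =>
      intro h hh
      rw [mul_add, mul_one, pow_add, mul_assoc]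
      exact ih _ (hx h hh)
  have hfam : ∀ b ∈ D, fam Λ b ∈ V := by
    intro b hb
    obtain ⟨a, ha⟩ := hD.exists_eq_add (gen_le (C := C) hb)
    rw [ha, fam_add_mul, hf]
    exact hx' a _ (f1 _)
  refine ⟨Λ, ⟨h0, fun r k hk hr => f4 r _ hr (by omega)⟩, le_antisymm (fun h hh => ?_)
    fun h hh => mem_famSpan.2 fun e => ?_⟩
  · have h1 := hN _ (X_pow_dvd_sub_sum h0 h N)
    have h2 : ∑ b ∈ Finset.range N, coord Λ b h • fam Λ b ∈ V := by
      refine V.sum_mem fun b _ => ?_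
      by_cases hb : b ∈ D
      · exact V.smul_mem _ (hfam b hb)
      · rw [mem_famSpan.1 hh b hb, zero_smul]
        exact V.zero_mem
    simpa using V.add_mem h1 h2
  · induction e using Nat.strong_induction_on with
    | _ e ih =>
      intro he
      by_contra hc
      have h1 := X_pow_dvd_sub_sum h0 h e
      refine he (hV' _ (V.sub_mem hh (V.sum_mem fun b hb => ?_)) e h1 ?_)
      · by_cases hbD : b ∈ D
        · exact V.smul_mem _ (hfam b hbD)
        · rw [ih b (Finset.mem_range.1 hb) hbD, zero_smul]
          exact V.zero_mem
      · rw [← coord_sub_coeff_of_dvd Λ h1, map_sub, map_sum, Finset.sum_eq_zero, sub_zero]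
        · exact hc
        · intro b hb
          rw [map_smul, coord_fam h0, if_neg (Finset.mem_range.1 hb).ne', smul_zero]

end GenericBranch

end

noncomputable section

namespace GenericBranch

variable (C : GenericBranch)

/-! ### Modules and ideals of a family -/

theorem mem_tMul_iff {k : ℤ} {M : Submodule C.R E} {z : E} :
    z ∈ C.tMul k M ↔ HahnSeries.single (-k) (1 : ℂ) * z ∈ M := by
  have h1 : ∀ k : ℤ, (HahnSeries.single (-k) (1 : ℂ) : E) * HahnSeries.single k 1 = 1 := by
    intro k
    rw [HahnSeries.single_mul_single, neg_add_cancel, one_mul, HahnSeries.single_zero_one]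
  constructor
  · rintro ⟨y, hy, rfl⟩
    rw [LinearMap.mulLeft_apply, ← mul_assoc, h1, one_mul]
    exact hy
  · intro h
    refine ⟨_, h, ?_⟩
    rw [LinearMap.mulLeft_apply, ← mul_assoc]
    nth_rewrite 1 [← neg_neg k]
    rw [h1, one_mul]

theorem single_neg_mul_single_neg (k l : ℤ) (z : E) : HahnSeries.single (-k) (1 : ℂ) *
    (HahnSeries.single (-l) (1 : ℂ) * z) = HahnSeries.single (-(l + k)) (1 : ℂ) * z := by
  rw [← mul_assoc, HahnSeries.single_mul_single, one_mul, neg_add_rev]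

theorem tMul_tMul (k l : ℤ) (M : Submodule C.R E) : C.tMul k (C.tMul l M) = C.tMul (k + l) M := by
  ext z
  rw [mem_tMul_iff, mem_tMul_iff, mem_tMul_iff, single_neg_mul_single_neg]

theorem tMul_zero (M : Submodule C.R E) : C.tMul 0 M = M := by
  ext z
  rw [mem_tMul_iff, neg_zero, HahnSeries.single_zero_one, one_mul]

theorem mem_HStratum_iff {Δ : Set ℤ} {τ : ℕ} {I : C.Hilb τ} : I ∈ C.HStratum Δ τ ↔
    C.tMul (τ - C.e Δ) (C.dual (Submodule.map (Algebra.linearMap C.R E) I.1)) ∈ C.JStratum Δ := by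
  constructor
  · rintro ⟨M, hM, h⟩
    have h1 := congrArg (C.tMul (-C.e Δ)) h
    rw [iota, AJ, tMul_tMul, tMul_tMul, neg_add_cancel, tMul_zero, ← sub_eq_neg_add] at h1
    rwa [← h1]
  · intro h
    refine ⟨_, h, ?_⟩
    rw [iota, AJ, tMul_tMul, add_sub_cancel]

/-- The module spanned by a triangular family, if this is a module. -/
def expMod (D : Set ℕ) (Λ : ZMod C.q → ℕ → ℂ) : Submodule C.R E where
  carrier := {z | ∃ h : ℂ⟦X⟧, (∀ f ∈ C.R, f * h ∈ famSpan Λ D) ∧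
    HahnSeries.ofPowerSeries ℤ ℂ h = z}
  add_mem' := by
    rintro _ _ ⟨h, hh, rfl⟩ ⟨h', hh', rfl⟩
    refine ⟨h + h', fun f hf => ?_, map_add _ _ _⟩
    rw [mul_add]
    exact Submodule.add_mem _ (hh f hf) (hh' f hf)
  zero_mem' := ⟨0, fun f _ => by rw [mul_zero]; exact Submodule.zero_mem _, map_zero _⟩
  smul_mem' := by
    rintro r _ ⟨h, hh, rfl⟩
    refine ⟨r * h, fun f hf => ?_, ?_⟩
    · rw [← mul_assoc]
      exact hh _ (C.R.mul_mem hf r.2)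
    · rw [smul_E_def, map_mul]

/-- The reduced triangular families that span modules containing `t^a`. -/
structure IsFam (D : Set ℕ) (a : ℕ) (Λ : ZMod C.q → ℕ → ℂ) : Prop where
  isExpSet : C.IsExpSet D
  isReduced : C.IsReduced D Λ
  isYStable : IsYStable C D Λ
  X_pow_mem : PowerSeries.X ^ a ∈ famSpan Λ D

variable {C} {D : Set ℕ} {a : ℕ} {Λ : ZMod C.q → ℕ → ℂ}

/-- `expMod` is the largest R-submodule inside the span, so it makes sense for every family; under
stability it is the whole span. -/
theorem mem_expMod_iff (hD : C.IsExpSet D) (h0 : ∀ r, Λ r 0 = 1) (hΛ : IsYStable C D Λ) {z : E} :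
    z ∈ C.expMod D Λ ↔ ∃ h ∈ famSpan Λ D, HahnSeries.ofPowerSeries ℤ ℂ h = z := by
  constructor
  · rintro ⟨h, hh, rfl⟩
    exact ⟨h, by simpa using hh 1 C.R.one_mem, rfl⟩
  · rintro ⟨h, hh, rfl⟩
    exact ⟨h, fun f hf => hΛ.mul_mem hD h0 hf hh, rfl⟩

variable {Δ : Set ℤ}

theorem expMod_mem_JStratum (hΔ : C.IsNormalizedSemimodule Δ) (h0 : ∀ r, Λ r 0 = 1)
    (hΛ : IsYStable C (natSet Δ) Λ) : C.expMod (natSet Δ) Λ ∈ C.JStratum Δ := by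
  have hm := fun z => mem_expMod_iff (z := z) hΔ.isExpSet h0 hΛ
  have ho : ordSet (C.expMod (natSet Δ) Λ : Set E) = Δ := by
    ext p
    rw [mem_ordSet_iff]
    constructor
    · rintro ⟨z, hz, h1, h2⟩
      obtain ⟨h, hh, rfl⟩ := (hm z).1 hz
      have hp : 0 ≤ p := by
        by_contra hc
        exact h2 (coe_mem_ordGE_zero h p (not_le.1 hc))
      obtain ⟨b, rfl⟩ := Int.eq_ofNat_of_zero_le hp
      refine mem_of_mem_famSpan hh (coe_mem_ordGE_iff.1 h1) ?_
      rwa [← LaurentSeries.coeff_coe_powerSeries]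
    · intro hp
      obtain ⟨b, rfl⟩ := Int.eq_ofNat_of_zero_le (hΔ.nonneg hp)
      refine ⟨_, (hm _).2 ⟨fam Λ b, fam_mem_famSpan h0 hp, rfl⟩,
        coe_mem_ordGE_iff.2 (X_pow_dvd_fam b), ?_⟩
      change HahnSeries.coeff _ ((b : ℕ) : ℤ) ≠ 0
      rw [LaurentSeries.coeff_coe_powerSeries, coeff_fam_self h0]
      exact one_ne_zero
  refine ⟨?_, ?_, ho⟩
  · rintro z hz
    obtain ⟨h, -, rfl⟩ := (hm z).1 hz
    exact ⟨h, rfl⟩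
  · rw [ho]
    exact hΔ.isLeast

theorem exists_expMod_eq (hΔ : C.IsNormalizedSemimodule Δ) {M : Submodule C.R E}
    (hM : M ∈ C.JStratum Δ) : ∃ Λ, C.IsReduced (natSet Δ) Λ ∧ IsYStable C (natSet Δ) Λ ∧
      C.expMod (natSet Δ) Λ = M := by
  have hD := hΔ.isExpSet
  obtain ⟨hM1, -, hM2⟩ := hM
  let V : Submodule ℂ ℂ⟦X⟧ := {
    carrier := {h | HahnSeries.ofPowerSeries ℤ ℂ h ∈ M}
    add_mem' := fun {h h'} hh hh' => by
      change HahnSeries.ofPowerSeries ℤ ℂ (h + h') ∈ M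
      rw [map_add]
      exact M.add_mem hh hh'
    zero_mem' := by
      change HahnSeries.ofPowerSeries ℤ ℂ 0 ∈ M
      rw [map_zero]
      exact M.zero_mem
    smul_mem' := fun c h hh => by
      change HahnSeries.ofPowerSeries ℤ ℂ (c • h) ∈ M
      rw [PowerSeries.smul_eq_C_mul, map_mul, HahnSeries.ofPowerSeries_C, HahnSeries.C_mul_eq_smul]
      exact C.smul_mem_E M c hh }
  have hVR : ∀ f ∈ C.R, ∀ h ∈ V, f * h ∈ V := by
    intro f hf h hh
    change HahnSeries.ofPowerSeries ℤ ℂ (f * h) ∈ M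
    rw [map_mul]
    exact C.coe_mul_mem hf hh
  have hV : ∀ a ∈ natSet Δ, ∃ h ∈ V, PowerSeries.X ^ a ∣ h ∧ PowerSeries.coeff a h = 1 := by
    intro a ha
    have ha' : (a : ℤ) ∈ ordSet (M : Set E) := by rw [hM2]; exact ha
    obtain ⟨z, hz, h1, h2⟩ := mem_ordSet_iff.1 ha'
    obtain ⟨h, rfl⟩ := hM1 hz
    have h3 : PowerSeries.coeff a h ≠ 0 := by
      rwa [← LaurentSeries.coeff_coe_powerSeries]
    refine ⟨(PowerSeries.coeff a h)⁻¹ • h, V.smul_mem _ hz,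
      dvd_smul_of_dvd _ (coe_mem_ordGE_iff.1 h1), ?_⟩
    rw [PowerSeries.coeff_smul, smul_eq_mul, inv_mul_cancel₀ h3]
  have hV' : ∀ h ∈ V, ∀ a, PowerSeries.X ^ a ∣ h → PowerSeries.coeff a h ≠ 0 → a ∈ natSet Δ := by
    intro h hh a ha h0
    change (a : ℤ) ∈ Δ
    rw [← hM2]
    refine mem_ordSet_iff.2 ⟨_, hh, coe_mem_ordGE_iff.2 ha, ?_⟩
    rwa [LaurentSeries.coeff_coe_powerSeries]
  have hN : ∀ h : ℂ⟦X⟧, PowerSeries.X ^ (C.wtMax + 1) ∣ h → h ∈ V := by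
    intro h hh
    -- Since 0 is an order, the module contains a unit `u` of ℂ[[t]]; dividing by `u` reduces high
    -- orders to those already in R.
    obtain ⟨u, hu, -, hu0⟩ := hV 0 hD.zero_mem
    have hu1 : PowerSeries.constantCoeff u ≠ 0 := by
      rw [← PowerSeries.coeff_zero_eq_constantCoeff_apply, hu0]
      exact one_ne_zero
    have h1 : h * u⁻¹ * u = h := by rw [mul_assoc, PowerSeries.inv_mul_cancel _ hu1, mul_one]
    rw [← h1]
    exact hVR _ (C.mem_R_of_dvd (by omega) (hh.mul_right _)) _ hu
  obtain ⟨Λ, hΛ, hs⟩ := hD.exists_famSpan_eq hN hV hV' (hVR _ C.x_mem)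
  have hY : IsYStable C (natSet Δ) Λ := hD.isYStable hΛ.1 (by rw [hs]; exact hVR _ C.y_mem)
  refine ⟨Λ, hΛ, hY, Submodule.ext fun z => ?_⟩
  rw [mem_expMod_iff hD hΛ.1 hY, hs]
  constructor
  · rintro ⟨h, hh, rfl⟩
    exact hh
  · intro hz
    obtain ⟨h, rfl⟩ := hM1 hz
    exact ⟨h, hz, rfl⟩

/-- An ideal I of R has 1 in its dual, so the normalized module contains t^{τ-e(Δ)}; admissibility
comes from stability under y. -/
theorem isAdmissible_of_nonempty (hΔ : C.IsNormalizedSemimodule Δ) {τ : ℕ}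
    (h : (C.HStratum Δ τ).Nonempty) : C.IsAdmissible Δ ∧ (τ : ℤ) - C.e Δ ∈ Δ := by
  obtain ⟨I, hI⟩ := h
  have h1 := C.mem_HStratum_iff.1 hI
  constructor
  · obtain ⟨Λ, h2, h3, -⟩ := exists_expMod_eq hΔ h1
    exact hΔ.isAdmissible_iff.2 (h3.isAdm h2.1)
  · have h2 := h1.2.2
    rw [Set.ext_iff] at h2
    refine (h2 _).1 (mem_ordSet_iff.2 ⟨_, ?_, single_mem_ordGE _ 1, by simp⟩)
    refine C.mem_tMul_iff.2 ?_
    rw [HahnSeries.single_mul_single, neg_add_cancel, one_mul, HahnSeries.single_zero_one, dual,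
      Submodule.mem_div_iff_forall_mul_mem]
    rintro _ ⟨r, -, rfl⟩
    rw [one_mul]
    exact Submodule.mem_one.2 ⟨r, rfl⟩

/-! ### Pairing with the basic elements and the dual ideal. -/

/-- The basic elements `t^{-a} F_b`. -/
def nu (a : ℕ) (Λ : ZMod C.q → ℕ → ℂ) (b : ℕ) : E :=
  HahnSeries.single (-(a : ℤ)) 1 * HahnSeries.ofPowerSeries ℤ ℂ (fam Λ b)

theorem nu_mem_ordGE (a b : ℕ) : nu a Λ b ∈ ordGE ((b : ℤ) - a) := by
  rw [sub_eq_neg_add]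
  exact single_mul_mem_ordGE _ _ (coe_mem_ordGE_iff.2 (X_pow_dvd_fam b))

theorem coeff_nu (a b k : ℕ) : (nu a Λ b).coeff ((b : ℤ) - a + k) = Λ b k := by
  rw [nu, HahnSeries.coeff_single_mul, one_mul]
  have h : (b : ℤ) - a + k - -(a : ℤ) = ((k + b : ℕ) : ℤ) := by push_cast; ring
  rw [h, LaurentSeries.coeff_coe_powerSeries, fam, PowerSeries.coeff_X_pow_mul,
    PowerSeries.coeff_mk]

theorem coeff_nu_self (h0 : ∀ r, Λ r 0 = 1) (a b : ℕ) : (nu a Λ b).coeff ((b : ℤ) - a) = 1 := by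
  have := coeff_nu (Λ := Λ) a b 0
  rwa [Nat.cast_zero, add_zero, h0] at this

theorem nu_sub_sum_mem (a b K : ℕ) : nu a Λ b - ∑ k ∈ Finset.range K,
    Λ b k • HahnSeries.single ((b : ℤ) - a + k) (1 : ℂ) ∈ ordGE ((b : ℤ) - a + K) := by
  intro i hi
  rw [HahnSeries.coeff_sub, HahnSeries.coeff_sum]
  by_cases hb : i < (b : ℤ) - a
  · rw [nu_mem_ordGE a b i hb, Finset.sum_eq_zero, sub_zero]
    intro k _
    rw [HahnSeries.coeff_smul, HahnSeries.coeff_single_of_ne (by omega), smul_zero]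
  · obtain ⟨k, rfl⟩ : ∃ k : ℕ, i = (b : ℤ) - a + k := ⟨(i - (b - a)).toNat, by omega⟩
    rw [coeff_nu, Finset.sum_eq_single k]
    · simp
    · intro k' _ hk'
      rw [HahnSeries.coeff_smul, HahnSeries.coeff_single_of_ne (by omega), smul_zero]
    · intro h
      exact absurd (Finset.mem_range.2 (by omega)) h

theorem resF_mul_nu {f : E} {p : ℤ} (hf : f ∈ ordGE p) {a b K : ℕ}
    (hK : C.frob < p + ((b : ℤ) - a + K)) : C.resF (f * nu a Λ b) = ∑ k ∈ Finset.range K,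
      Λ b k * C.resF (f * HahnSeries.single ((b : ℤ) - a + k) (1 : ℂ)) := by
  have h1 := C.resF_mul_high hf (nu_sub_sum_mem (Λ := Λ) a b K) hK
  rw [mul_sub, map_sub, sub_eq_zero] at h1
  rw [h1, Finset.mul_sum, map_sum]
  refine Finset.sum_congr rfl fun k _ => ?_
  rw [mul_csmul, map_smul, smul_eq_mul]

variable (C) in
/-- The ideal dual to `t^{-a}` times the module of a family. -/
def famIdeal (D : Set ℕ) (a : ℕ) (Λ : ZMod C.q → ℕ → ℂ) : Ideal C.R :=
  (C.dual (C.tMul (-(a : ℤ)) (C.expMod D Λ))).comap (Algebra.linearMap C.R E)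

theorem IsFam.mem_shift_iff (hΛ : C.IsFam D a Λ) {z : E} :
    z ∈ C.tMul (-(a : ℤ)) (C.expMod D Λ) ↔ ∃ h ∈ famSpan Λ D,
      HahnSeries.single (-(a : ℤ)) 1 * HahnSeries.ofPowerSeries ℤ ℂ h = z := by
  rw [mem_tMul_iff, mem_expMod_iff hΛ.isExpSet hΛ.isReduced.1 hΛ.isYStable, neg_neg]
  constructor
  · rintro ⟨h, hh, e⟩
    refine ⟨h, hh, ?_⟩
    rw [e, ← mul_assoc, HahnSeries.single_mul_single, neg_add_cancel, one_mul,
      HahnSeries.single_zero_one, one_mul]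
  · rintro ⟨h, hh, rfl⟩
    refine ⟨h, hh, ?_⟩
    rw [← mul_assoc, HahnSeries.single_mul_single, add_neg_cancel, one_mul,
      HahnSeries.single_zero_one, one_mul]

theorem IsFam.nu_mem (hΛ : C.IsFam D a Λ) {b : ℕ} (hb : b ∈ D) :
    nu a Λ b ∈ C.tMul (-(a : ℤ)) (C.expMod D Λ) :=
  hΛ.mem_shift_iff.2 ⟨_, fam_mem_famSpan hΛ.isReduced.1 hb, rfl⟩

theorem IsFam.one_le (hΛ : C.IsFam D a Λ) : 1 ≤ C.tMul (-(a : ℤ)) (C.expMod D Λ) := by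
  rw [Submodule.one_le]
  refine hΛ.mem_shift_iff.2 ⟨_, hΛ.X_pow_mem, ?_⟩
  rw [map_pow, HahnSeries.ofPowerSeries_X, HahnSeries.single_pow, HahnSeries.single_mul_single]
  simp

/-- The shifted module contains 1, so its dual already lies in R and nothing is lost by intersecting
with R. -/
theorem IsFam.map_famIdeal (hΛ : C.IsFam D a Λ) :
    Submodule.map (Algebra.linearMap C.R E) (C.famIdeal D a Λ) =
      C.dual (C.tMul (-(a : ℤ)) (C.expMod D Λ)) := by
  refine Submodule.map_comap_eq_of_le fun z hz => ?_
  have h1 := Submodule.mem_div_iff_forall_mul_mem.1 hz 1 (Submodule.one_le.1 hΛ.one_le)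
  rw [mul_one] at h1
  obtain ⟨r, hr⟩ := Submodule.mem_one.1 h1
  exact ⟨r, hr⟩

theorem IsFam.dual_dual (hΛ : C.IsFam D a Λ) :
    C.dual (C.dual (C.tMul (-(a : ℤ)) (C.expMod D Λ))) = C.tMul (-(a : ℤ)) (C.expMod D Λ) := by
  refine C.dual_dual (a := C.frob + 1) (b := -(a : ℤ)) (fun z hz => ?_) fun z hz => ?_
  · exact hΛ.one_le (C.mem_one_of_mem_ordGE hz)
  · obtain ⟨h, -, rfl⟩ := hΛ.mem_shift_iff.1 hz
    simpa using single_mul_mem_ordGE (-(a : ℤ)) 1 (coe_mem_ordGE_zero h)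

/-- Pairing with an element of R kills R, so orders in Γ impose no condition. Only the basic
elements with orders outside Γ remain to be tested. -/
theorem IsFam.mem_famIdeal_iff (hΛ : C.IsFam D a Λ) {f : C.R} : f ∈ C.famIdeal D a Λ ↔
    ∀ b ∈ basisSet C D a, C.resF (algebraMap C.R E f * nu a Λ b) = 0 := by
  have hI : f ∈ C.famIdeal D a Λ ↔ ∀ z ∈ C.tMul (-(a : ℤ)) (C.expMod D Λ),
      C.resF (algebraMap C.R E f * z) = 0 := C.mem_dual_iff
  rw [hI]
  constructor
  · exact fun h b hb => h _ (hΛ.nu_mem hb.1)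
  · intro h
    let W : Submodule ℂ E := {
      carrier := {z | C.resF (algebraMap C.R E f * z) = 0}
      add_mem' := fun {z z'} hz hz' => by
        change C.resF (algebraMap C.R E f * (z + z')) = 0
        rw [mul_add, map_add, hz, hz', add_zero]
      zero_mem' := by
        change C.resF (algebraMap C.R E f * 0) = 0
        rw [mul_zero, map_zero]
      smul_mem' := fun c z hz => by
        change C.resF (algebraMap C.R E f * c • z) = 0
        rw [mul_csmul, map_smul, hz, smul_zero] }
    have hone : ∀ z ∈ (1 : Submodule C.R E), z ∈ W := by
      rintro z hz
      obtain ⟨r, rfl⟩ := Submodule.mem_one.1 hz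
      change C.resF (algebraMap C.R E f * algebraMap C.R E r) = 0
      rw [← map_mul]
      exact C.resF_one (Submodule.mem_one.2 ⟨_, rfl⟩)
    have h1 : C.toC (C.tMul (-(a : ℤ)) (C.expMod D Λ)) ≤ W := by
      refine le_of_forall_order (C.frob + 1) (fun z hz => hone z (C.mem_one_of_mem_ordGE hz)) ?_
      intro z hz p hp h0
      by_cases hpG : p ∈ C.GamZ
      · obtain ⟨r, h1, h2⟩ := C.exists_mem_one_of_mem_GamZ hpG
        have h3 : algebraMap C.R E r ∈ (1 : Submodule C.R E) := Submodule.mem_one.2 ⟨r, rfl⟩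
        exact ⟨_, ⟨hone _ h3, hΛ.one_le h3⟩, h1, by rw [h2]; exact one_ne_zero⟩
      · obtain ⟨g, hg, rfl⟩ := hΛ.mem_shift_iff.1 hz
        rw [HahnSeries.coeff_single_mul, one_mul] at h0
        have hp0 : 0 ≤ p - -(a : ℤ) := by
          by_contra hc
          exact h0 (coe_mem_ordGE_zero g _ (not_le.1 hc))
        obtain ⟨b, hb⟩ := Int.eq_ofNat_of_zero_le hp0
        have hpb : p = (b : ℤ) - a := by omega
        have hbD : b ∈ D := by
          refine mem_of_mem_famSpan hg (coe_mem_ordGE_iff.1 ?_) (?_ : PowerSeries.coeff b g ≠ 0)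
          · have h4 := single_mul_mem_ordGE (a : ℤ) 1 hp
            rw [← mul_assoc, HahnSeries.single_mul_single, add_neg_cancel, one_mul,
              HahnSeries.single_zero_one, one_mul, hpb, add_sub_cancel] at h4
            exact h4
          · rw [← LaurentSeries.coeff_coe_powerSeries, ← hb]
            exact h0
        subst hpb
        refine ⟨nu a Λ b, ⟨h b ⟨hbD, hpG⟩, hΛ.nu_mem hbD⟩, nu_mem_ordGE a b, ?_⟩
        rw [coeff_nu_self hΛ.isReduced.1]
        exact one_ne_zero
    exact h1

end GenericBranch

end

noncomputable section

namespace GenericBranch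

variable {C : GenericBranch} {D : Set ℕ} {a τ : ℕ}

/-! ### Frames -/

theorem algebraMap_csmul (c : ℂ) (r : C.R) :
    algebraMap C.R E (c • r) = c • algebraMap C.R E r := by
  rw [Algebra.smul_def, map_mul]
  exact C.algebraMap_smul_E c _

theorem algebraMap_sub_sum (f : C.R) (c : Fin τ → ℂ) (r : Fin τ → C.R) :
    algebraMap C.R E (f - ∑ i, c i • r i) =
      algebraMap C.R E f - ∑ i, c i • algebraMap C.R E (r i) := by
  rw [map_sub, map_sum]
  simp only [algebraMap_csmul]

theorem resF_sub_sum_mul (f : C.R) (c : Fin τ → ℂ) (r : Fin τ → C.R) (z : E) :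
    C.resF (algebraMap C.R E (f - ∑ i, c i • r i) * z) =
      C.resF (algebraMap C.R E f * z) - ∑ i, c i * C.resF (algebraMap C.R E (r i) * z) := by
  rw [algebraMap_sub_sum, sub_mul, map_sub, Finset.sum_mul, map_sum]
  congr 1
  refine Finset.sum_congr rfl fun i _ => ?_
  rw [csmul_mul, map_smul, smul_eq_mul]

/-- Elements of `R` dual to the basic elements `t^{-a} F_b`. -/
structure IsDualFrame (C : GenericBranch) (D : Set ℕ) (a : ℕ) (b : Fin τ → ℕ) (r : Fin τ → C.R) :
    Prop where
  strictMono : StrictMono b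
  range_eq : Set.range b = basisSet C D a
  mem_ordGE : ∀ i, algebraMap C.R E (r i) ∈ ordGE (C.frob - ((b i : ℤ) - a))
  coeff_eq : ∀ i, (algebraMap C.R E (r i)).coeff (C.frob - ((b i : ℤ) - a)) = 1

/-- For `b` in `basisSet` the order b - a is outside Γ, so by symmetry R has an element of the
complementary order. -/
theorem exists_isDualFrame (hf : (basisSet C D a).Finite) (hτ : (basisSet C D a).ncard = τ) :
    ∃ (b : Fin τ → ℕ) (r : Fin τ → C.R), IsDualFrame C D a b r := by
  have hc : hf.toFinset.card = τ := by rw [← hτ, Set.ncard_eq_toFinset_card _ hf]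
  have hb : Set.range (hf.toFinset.orderEmbOfFin hc) = basisSet C D a := by
    rw [Finset.range_orderEmbOfFin, Set.Finite.coe_toFinset]
  have hb' : ∀ i, hf.toFinset.orderEmbOfFin hc i ∈ basisSet C D a := fun i =>
    hb.subset (Set.mem_range_self i)
  have h1 : ∀ i, C.frob - ((hf.toFinset.orderEmbOfFin hc i : ℤ) - a) ∈ C.GamZ := fun i =>
    (C.frob_sub_mem_iff _).2 (hb' i).2
  choose r h2 h3 using fun i => C.exists_mem_one_of_mem_GamZ (h1 i)
  exact ⟨_, r, (hf.toFinset.orderEmbOfFin hc).strictMono, hb, h2, h3⟩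

/-- The pairings of the elements `r i` with the basic elements. -/
def pairing (a : ℕ) (b : Fin τ → ℕ) (r : Fin τ → C.R) (Λ : ZMod C.q → ℕ → ℂ) :
    Matrix (Fin τ) (Fin τ) ℂ :=
  Matrix.of fun j i => C.resF (algebraMap C.R E (r i) * nu a Λ (b j))

variable {b : Fin τ → ℕ} {r : Fin τ → C.R} {Λ : ZMod C.q → ℕ → ℂ}

/-- For i < j the orders add up to more than `frob`, so the matrix is triangular with unit diagonal.
Determinant 1 makes the inverse the adjugate, hence polynomial in the family. -/
theorem IsDualFrame.det_pairing (hr : IsDualFrame C D a b r) (h0 : ∀ r, Λ r 0 = 1) :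
    (pairing a b r Λ).det = 1 := by
  have ht : (pairing a b r Λ).IsUpperTriangular := by
    intro j i (hij : i < j)
    have := hr.strictMono hij
    exact C.resF_mul_high (hr.mem_ordGE i) (nu_mem_ordGE a (b j)) (by omega)
  rw [Matrix.det_of_isUpperTriangular ht]
  refine Finset.prod_eq_one fun j _ => ?_
  refine (C.resF_mul_of_mem (hr.mem_ordGE j) (nu_mem_ordGE a (b j)) (by ring)).trans ?_
  rw [hr.coeff_eq, coeff_nu_self h0, mul_one]

theorem IsFam.sub_sum_mem_iff (hΛ : C.IsFam D a Λ) (hr : IsDualFrame C D a b r) (f : C.R)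
    (c : Fin τ → ℂ) : f - ∑ i, c i • r i ∈ C.famIdeal D a Λ ↔
      (pairing a b r Λ).mulVec c = fun j => C.resF (algebraMap C.R E f * nu a Λ (b j)) := by
  rw [hΛ.mem_famIdeal_iff, ← hr.range_eq, Set.forall_mem_range, funext_iff]
  refine forall_congr' fun j => ?_
  rw [resF_sub_sum_mul, sub_eq_zero, eq_comm]
  simp only [Matrix.mulVec, dotProduct, pairing, Matrix.of_apply, mul_comm]

theorem IsFam.sub_sum_mem_iff_eq (hΛ : C.IsFam D a Λ) (hr : IsDualFrame C D a b r) (f : C.R)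
    (c : Fin τ → ℂ) : f - ∑ i, c i • r i ∈ C.famIdeal D a Λ ↔
      c = (pairing a b r Λ).adjugate.mulVec
        fun j => C.resF (algebraMap C.R E f * nu a Λ (b j)) := by
  rw [hΛ.sub_sum_mem_iff hr]
  have hd := hr.det_pairing hΛ.isReduced.1
  constructor
  · intro h
    rw [← h, Matrix.mulVec_mulVec, Matrix.adjugate_mul, hd, one_smul, Matrix.one_mulVec]
  · rintro rfl
    rw [Matrix.mulVec_mulVec, Matrix.mul_adjugate, hd, one_smul, Matrix.one_mulVec]

theorem finrank_of_existsUnique {I : Ideal C.R}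
    (h : ∀ f : C.R, ∃! c : Fin τ → ℂ, f - ∑ i, c i • r i ∈ I) :
    Module.Finite ℂ (C.R ⧸ I) ∧ Module.finrank ℂ (C.R ⧸ I) = τ := by
  let L : (Fin τ → ℂ) →ₗ[ℂ] C.R ⧸ I :=
    (Ideal.Quotient.mkₐ ℂ I).toLinearMap ∘ₗ Fintype.linearCombination ℂ r
  have hL : ∀ c, L c = Ideal.Quotient.mk I (∑ i, c i • r i) := fun c => rfl
  have hbij : Function.Bijective L := by
    constructor
    · intro c c' hcc
      rw [hL, hL] at hcc
      have h1 := (h (∑ i, c i • r i)).unique (y₁ := c) (y₂ := c')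
      refine h1 (by rw [sub_self]; exact I.zero_mem) ?_
      exact Ideal.Quotient.eq.1 hcc
    · intro x
      obtain ⟨f, rfl⟩ := Ideal.Quotient.mk_surjective x
      obtain ⟨c, hc, -⟩ := h f
      exact ⟨c, (hL c).trans (Ideal.Quotient.eq.2 hc).symm⟩
  let e := LinearEquiv.ofBijective L hbij
  exact ⟨Module.Finite.equiv e, by rw [← e.finrank_eq, Module.finrank_fin_fun]⟩

theorem IsFam.existsUnique (hΛ : C.IsFam D a Λ) (hr : IsDualFrame C D a b r) (f : C.R) :
    ∃! c : Fin τ → ℂ, f - ∑ i, c i • r i ∈ C.famIdeal D a Λ :=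
  ⟨_, (hΛ.sub_sum_mem_iff_eq hr f _).2 rfl, fun c hc => (hΛ.sub_sum_mem_iff_eq hr f c).1 hc⟩

/-- The point of the Hilbert scheme given by a family. -/
def IsFam.hilb (hΛ : C.IsFam D a Λ) (hr : IsDualFrame C D a b r) : C.Hilb τ :=
  ⟨C.famIdeal D a Λ, finrank_of_existsUnique (hΛ.existsUnique hr)⟩

theorem IsFam.isFrame (hΛ : C.IsFam D a Λ) (hr : IsDualFrame C D a b r) :
    C.IsFrame r (hΛ.hilb hr) := hΛ.existsUnique hr

theorem IsFam.frameCoord_hilb (hΛ : C.IsFam D a Λ) (hr : IsDualFrame C D a b r) (f : C.R)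
    (j : Fin τ) : C.frameCoord r (f, j) (hΛ.hilb hr) = (pairing a b r Λ).adjugate.mulVec
      (fun j => C.resF (algebraMap C.R E f * nu a Λ (b j))) j :=
  (hΛ.isFrame hr).frameCoord_eq f _ ((hΛ.sub_sum_mem_iff_eq hr f _).2 rfl) j

theorem exists_eval_resF {σ : Type} (a : ℕ) (Q : ZMod C.q → ℕ → MvPolynomial σ ℂ) (f : C.R)
    (b : ℕ) : ∃ s : MvPolynomial σ ℂ, ∀ p, MvPolynomial.eval p s =
      C.resF (algebraMap C.R E f * nu a (fun r k => MvPolynomial.eval p (Q r k)) b) := by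
  -- Since `f` has order at least 0, terms of t^{-a}F_b with index at least `K` give products of
  -- order above `frob`, on which `resF` vanishes.
  let K := (C.frob + a + 1).toNat
  refine ⟨∑ k ∈ Finset.range K, Q b k * MvPolynomial.C (C.resF (algebraMap C.R E f *
    HahnSeries.single ((b : ℤ) - a + k) (1 : ℂ))), fun p => ?_⟩
  have h0 : algebraMap C.R E f ∈ ordGE 0 := coe_mem_ordGE_zero _
  rw [resF_mul_nu (K := K) h0 (by omega)]
  simp

/-- The coordinates are polynomials in the family. -/
theorem exists_eval_frameCoord {σ : Type} (hr : IsDualFrame C D a b r)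
    (Q : ZMod C.q → ℕ → MvPolynomial σ ℂ)
    (hQ : ∀ p, C.IsFam D a fun r k => MvPolynomial.eval p (Q r k)) (f : C.R) (j : Fin τ) :
    ∃ s : MvPolynomial σ ℂ, ∀ p, C.frameCoord r (f, j) ((hQ p).hilb hr) =
      MvPolynomial.eval p s := by
  choose P hP using fun j i => exists_eval_resF a Q (r i) (b j)
  choose v hv using fun j => exists_eval_resF a Q f (b j)
  refine ⟨(Matrix.of P).adjugate.mulVec v j, fun p => ?_⟩
  rw [(hQ p).frameCoord_hilb hr f j]
  have h1 : pairing a b r (fun r k => MvPolynomial.eval p (Q r k)) =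
      (MvPolynomial.eval p).mapMatrix (Matrix.of P) := by
    ext j i
    exact (hP j i p).symm
  rw [h1, ← RingHom.map_adjugate, Matrix.mulVec, Matrix.mulVec, dotProduct, dotProduct, map_sum]
  refine Finset.sum_congr rfl fun i _ => ?_
  rw [(MvPolynomial.eval p).map_mul, hv]
  rfl

theorem IsFam.resF_mul_nu_eq_zero (hΛ : C.IsFam D a Λ) {f : C.R} (hf : f ∈ C.famIdeal D a Λ)
    {b : ℕ} (hb : b ∈ D) : C.resF (algebraMap C.R E f * nu a Λ b) = 0 :=
  C.mem_dual_iff.1 hf _ (hΛ.nu_mem hb)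

/-- The reduction of an element of `R` involves no frame elements of lower order. -/
theorem IsFam.remainder_coeff_eq_zero (hΛ : C.IsFam D a Λ) (hr : IsDualFrame C D a b r) {e : ℕ}
    {g : C.R} (hg : algebraMap C.R E g ∈ ordGE (C.frob - ((e : ℤ) - a)))
    {c : Fin τ → ℂ} (hc : g - ∑ i, c i • r i ∈ C.famIdeal D a Λ) (i : Fin τ)
    (hi : e < b i) : c i = 0 := by
  by_contra h0
  obtain ⟨m, hm, hmax⟩ := Finset.exists_max_image (Finset.univ.filter fun i => c i ≠ 0) id
    ⟨i, by simpa using h0⟩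
  simp only [Finset.mem_filter, Finset.mem_univ, true_and, id] at hm hmax
  have hbm : e < b m := hi.trans_le (hr.strictMono.monotone (hmax i h0))
  have hmD : b m ∈ D := (hr.range_eq ▸ Set.mem_range_self m : b m ∈ basisSet C D a).1
  have h1 := hΛ.resF_mul_nu_eq_zero hc hmD
  rw [resF_sub_sum_mul, C.resF_mul_high hg (nu_mem_ordGE a (b m)) (by omega), zero_sub,
    neg_eq_zero, Finset.sum_eq_single m, C.resF_mul_of_mem (hr.mem_ordGE m)
      (nu_mem_ordGE a (b m)) (by ring), hr.coeff_eq, coeff_nu_self hΛ.isReduced.1, mul_one,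
    mul_one] at h1
  · exact hm h1
  · intro j _ hj
    by_cases hcj : c j = 0
    · rw [hcj, zero_mul]
    · have := hr.strictMono (lt_of_le_of_ne (hmax j hcj) hj)
      rw [C.resF_mul_high (hr.mem_ordGE j) (nu_mem_ordGE a (b m)) (by omega), mul_zero]
  · intro h
    exact absurd (Finset.mem_univ _) h

/-- The family is determined polynomially by the coordinates. -/
theorem exists_eval_eq (hr : IsDualFrame C D a b r)
    (hΓ : ∀ b : ℕ, (b : ℤ) - a ∈ C.GamZ → b ∈ D) (s : ZMod C.q) (k : ℕ) :
    ∃ S : MvPolynomial (C.R × Fin τ) ℂ, ∀ Λ, C.IsFam D a Λ → ∀ c : C.R × Fin τ → ℂ,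
      (∀ f : C.R, f - ∑ i, c (f, i) • r i ∈ C.famIdeal D a Λ) →
      MvPolynomial.eval c S = Λ s k := by
  induction k using Nat.strong_induction_on with
  | _ k ih =>
    rcases Nat.eq_zero_or_pos k with rfl | hk
    · exact ⟨1, fun Λ hΛ c _ => by rw [map_one, hΛ.isReduced.1]⟩
    by_cases hgk : C.gen D s + k ∈ D
    · exact ⟨0, fun Λ hΛ c _ => by rw [map_zero, hΛ.isReduced.2 s k hk hgk]⟩
    -- The gap gen s + k lies outside a + Γ, so R has an element `g` of complementary order, fit to
    -- read off the coefficient at that exponent.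
    obtain ⟨g, hg1, hg2⟩ := C.exists_mem_one_of_mem_GamZ
      ((C.frob_sub_mem_iff _).2 (mt (hΓ _) hgk))
    have ih' : ∀ j, ∃ S : MvPolynomial (C.R × Fin τ) ℂ, j < k → ∀ Λ, C.IsFam D a Λ →
        ∀ c : C.R × Fin τ → ℂ, (∀ f : C.R, f - ∑ i, c (f, i) • r i ∈ C.famIdeal D a Λ) →
        MvPolynomial.eval c S = Λ s j := by
      intro j
      by_cases hj : j < k
      · obtain ⟨S, hS⟩ := ih j hj
        exact ⟨S, fun _ => hS⟩
      · exact ⟨0, fun h => absurd h hj⟩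
    choose S hS using ih'
    let m : ℕ → E := fun j => HahnSeries.single ((C.gen D s : ℤ) - a + j) (1 : ℂ)
    refine ⟨-∑ j ∈ Finset.range k, S j * (MvPolynomial.C (C.resF (algebraMap C.R E g * m j)) -
      ∑ i, MvPolynomial.X (g, i) * MvPolynomial.C (C.resF (algebraMap C.R E (r i) * m j))),
      fun Λ hΛ c hc => ?_⟩
    have hs := (hΛ.isExpSet.gen_spec s)
    have hρ := hc g
    set ρ := g - ∑ i, c (g, i) • r i with hρd
    have hci : ∀ i, c (g, i) ≠ 0 → b i < C.gen D s + k := by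
      intro i hi
      rcases lt_trichotomy (b i) (C.gen D s + k) with h | h | h
      · exact h
      · exact absurd (h ▸ (hr.range_eq ▸ Set.mem_range_self i : b i ∈ basisSet C D a).1) hgk
      · exact absurd (hΛ.remainder_coeff_eq_zero hr hg1 hρ i h) hi
    have hsum : ∑ i, c (g, i) • algebraMap C.R E (r i) ∈
        ordGE (C.frob - (((C.gen D s + k : ℕ) : ℤ) - a) + 1) := by
      refine Submodule.sum_mem _ fun i _ => ?_
      by_cases hi : c (g, i) = 0
      · intro n _
        rw [hi, HahnSeries.coeff_smul, zero_smul]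
      · have := hci i hi
        exact Submodule.smul_mem _ _ (ordGE_anti (by omega) (hr.mem_ordGE i))
    have hρ1 : algebraMap C.R E ρ ∈ ordGE (C.frob - (((C.gen D s + k : ℕ) : ℤ) - a)) := by
      rw [hρd, algebraMap_sub_sum]
      exact Submodule.sub_mem _ hg1 (ordGE_anti (by omega) hsum)
    have hρ2 : (algebraMap C.R E ρ).coeff (C.frob - (((C.gen D s + k : ℕ) : ℤ) - a)) = 1 := by
      rw [hρd, algebraMap_sub_sum, HahnSeries.coeff_sub, hg2, hsum _ (by omega), sub_zero]
    -- The remainder of `g` lies in the ideal and has the same leading term as `g`. Its vanishing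
    -- pairing with t^{-a}F at the generator of `s` expresses Λ_s^k, with coefficient 1, through
    -- lower levels and frame coordinates.
    have h1 := hΛ.resF_mul_nu_eq_zero hρ hs.1
    rw [resF_mul_nu hρ1 (K := k + 1) (by omega), Finset.sum_range_succ,
      C.resF_mul_of_mem hρ1 (single_mem_ordGE _ _) (by push_cast; ring), hρ2,
      HahnSeries.coeff_single_same, one_mul, mul_one, hs.2] at h1
    rw [map_neg, map_sum, eq_comm, eq_neg_iff_add_eq_zero, add_comm, ← h1]
    congr 1
    refine Finset.sum_congr rfl fun j hj => ?_
    rw [map_mul, hS j (Finset.mem_range.1 hj) Λ hΛ c hc, hρd, resF_sub_sum_mul]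
    simp [m]

/-! ### The stratum -/

variable {Δ : Set ℤ}

theorem IsFam.hilb_mem_HStratum (hΔ : C.IsNormalizedSemimodule Δ)
    (ha : (a : ℤ) = τ - C.e Δ) (hΛ : C.IsFam (natSet Δ) a Λ)
    (hr : IsDualFrame C (natSet Δ) a b r) : hΛ.hilb hr ∈ C.HStratum Δ τ := by
  rw [mem_HStratum_iff, ← ha]
  change C.tMul a (C.dual (Submodule.map (Algebra.linearMap C.R E) (C.famIdeal (natSet Δ) a Λ))) ∈ _
  rw [hΛ.map_famIdeal, hΛ.dual_dual, tMul_tMul, add_neg_cancel, tMul_zero]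
  exact expMod_mem_JStratum hΔ hΛ.isReduced.1 hΛ.isYStable

theorem exists_hilb_eq (hΔ : C.IsNormalizedSemimodule Δ) (ha : (a : ℤ) = τ - C.e Δ)
    (hr : IsDualFrame C (natSet Δ) a b r) {I : C.Hilb τ} (hI : I ∈ C.HStratum Δ τ) :
    ∃ (Λ : ZMod C.q → ℕ → ℂ) (hΛ : C.IsFam (natSet Δ) a Λ), hΛ.hilb hr = I := by
  rw [mem_HStratum_iff, ← ha] at hI
  obtain ⟨Λ, h1, h2, h3⟩ := exists_expMod_eq hΔ hI
  set J := C.dual (Submodule.map (Algebra.linearMap C.R E) I.1) with hJ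
  have hD := hΔ.isExpSet
  have hX : PowerSeries.X ^ a ∈ famSpan Λ (natSet Δ) := by
    have h4 : HahnSeries.ofPowerSeries ℤ ℂ (PowerSeries.X ^ a) ∈ C.expMod (natSet Δ) Λ := by
      rw [h3, mem_tMul_iff, map_pow, HahnSeries.ofPowerSeries_X, HahnSeries.single_pow,
        HahnSeries.single_mul_single]
      simp only [one_pow, mul_one, nsmul_eq_mul, neg_add_cancel, HahnSeries.single_zero_one]
      rw [hJ, dual, Submodule.mem_div_iff_forall_mul_mem]
      rintro _ ⟨f, -, rfl⟩
      rw [one_mul]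
      exact Submodule.mem_one.2 ⟨f, rfl⟩
    obtain ⟨h, hh, he⟩ := (mem_expMod_iff hD h1.1 h2).1 h4
    rwa [← HahnSeries.ofPowerSeries_injective he]
  have hΛ : C.IsFam (natSet Δ) a Λ := ⟨hD, h1, h2, hX⟩
  refine ⟨Λ, hΛ, Subtype.ext ?_⟩
  change C.famIdeal (natSet Δ) a Λ = I.1
  have hle : I.1 ≤ C.famIdeal (natSet Δ) a Λ := by
    intro f hf
    change algebraMap C.R E f ∈ C.dual (C.tMul (-(a : ℤ)) (C.expMod (natSet Δ) Λ))
    rw [h3, tMul_tMul, neg_add_cancel, tMul_zero, hJ, dual, Submodule.mem_div_iff_forall_mul_mem]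
    intro z hz
    rw [mul_comm]
    exact Submodule.mem_div_iff_forall_mul_mem.1 hz _ ⟨f, hf, rfl⟩
  -- Both ideals have colength τ, so the inclusion is an equality.
  refine le_antisymm (fun f hf => ?_) hle
  have := I.2.1
  have hfr : Module.finrank ℂ (C.R ⧸ I.1) = Module.finrank ℂ (C.R ⧸ C.famIdeal (natSet Δ) a Λ) := by
    exact I.2.2.trans (hΛ.hilb hr).2.2.symm
  have hfin : Module.Finite ℂ (C.R ⧸ C.famIdeal (natSet Δ) a Λ) := (hΛ.hilb hr).2.1
  have hinj := (LinearMap.injective_iff_surjective_of_finrank_eq_finrank hfr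
    (f := (Ideal.Quotient.factorₐ ℂ hle).toLinearMap)).2 (Ideal.Quotient.factor_surjective hle)
  have h5 : Ideal.Quotient.mk I.1 f = Ideal.Quotient.mk I.1 0 := hinj <| by
    change Ideal.Quotient.mk (C.famIdeal (natSet Δ) a Λ) f = Ideal.Quotient.mk _ 0
    rw [map_zero]
    exact Ideal.Quotient.eq_zero_iff_mem.2 hf
  rw [map_zero] at h5
  exact Ideal.Quotient.eq_zero_iff_mem.1 h5

theorem eq_of_hilb_eq (hr : IsDualFrame C D a b r)
    (hΓ : ∀ b : ℕ, (b : ℤ) - a ∈ C.GamZ → b ∈ D) {Λ Λ' : ZMod C.q → ℕ → ℂ} (hΛ : C.IsFam D a Λ)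
    (hΛ' : C.IsFam D a Λ') (h : hΛ.hilb hr = hΛ'.hilb hr) : Λ = Λ' := by
  funext s k
  obtain ⟨S, hS⟩ := exists_eval_eq hr hΓ s k
  have h1 := hS Λ hΛ (fun v => C.frameCoord r v (hΛ.hilb hr))
    fun f => (hΛ.isFrame hr).sub_sum_mem f
  rw [h, hS Λ' hΛ' (fun v => C.frameCoord r v (hΛ'.hilb hr))
    fun f => (hΛ'.isFrame hr).sub_sum_mem f] at h1
  exact h1.symm

theorem IsExpSet.isSolution_iff_isFam (hD : C.IsExpSet D) (hA : C.IsAdm D) (ha : a ∈ D) :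
    (hD.levelSystem hA ha).IsSolution Λ ↔ C.IsFam D a Λ := by
  rw [hD.isSolution_iff]
  exact ⟨fun ⟨h0, h1, h2, h3⟩ => ⟨hD, ⟨h0, h1⟩, h2, h3⟩,
    fun h => ⟨h.isReduced.1, h.isReduced.2, h.isYStable, h.X_pow_mem⟩⟩

theorem exists_isIsomorphic (hΔ : C.IsNormalizedSemimodule Δ) (hA : C.IsAdmissible Δ)
    (hτ : (τ : ℤ) - C.e Δ ∈ Δ) :
    ∃ N : ℕ, (N : ℤ) = C.dimOf Δ - ((gaps Δ ((τ : ℤ) - C.e Δ)).ncard : ℤ) ∧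
      (ChartedSet.affineSpace N).IsIsomorphic (C.hStratumCharts Δ τ) := by
  classical
  obtain ⟨a, ha⟩ := Int.eq_ofNat_of_zero_le (hΔ.nonneg hτ)
  rw [ha] at hτ ⊢
  have hD := hΔ.isExpSet
  have haD : a ∈ natSet Δ := hτ
  have hA' := hΔ.isAdmissible_iff.1 hA
  have hΓ : ∀ b : ℕ, (b : ℤ) - a ∈ C.GamZ → b ∈ natSet Δ := fun b hb => by
    have := hΔ.add_mem _ (C.Gam_eq ▸ hb) _ hτ
    rwa [sub_add_cancel] at this
  obtain ⟨hf, hcard⟩ := ncard_basisSet hD.finite_compl hΓ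
  have hcard' : (basisSet C (natSet Δ) a).ncard = τ := by
    rw [← deltaOf_eq] at hcard
    rw [e] at ha
    omega
  obtain ⟨b, r, hr⟩ := exists_isDualFrame hf hcard'
  obtain ⟨K, hK⟩ := hD.exists_bound
  have hK' : ∀ e, K < e → e ∈ natSet Δ := fun e he => hK e he.le
  have hT : ∀ k, K < k → (hD.levelSystem hA' haD).T k = ∅ := fun k hk => by
    refine Finset.filter_eq_empty_iff.2 fun r _ => not_not.2 (hK' _ (by omega))
  obtain ⟨N, hN, Q, P, h1, h2, h3⟩ := (hD.levelSystem hA' haD).exists_parametrization K hT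
  have hQ : ∀ p, C.IsFam (natSet Δ) a fun r k => MvPolynomial.eval p (Q r k) :=
    fun p => (hD.isSolution_iff_isFam hA' haD).1 (h1 p)
  refine ⟨N, ?_, ?_⟩
  · have h4 := hD.sum_levels hA' haD K
    rw [hΔ.dimOf_eq hK', ncard_gaps hK' haD, ← h4, hN]
  let F : (Fin N → ℂ) → C.HStratum Δ τ :=
    fun p => ⟨(hQ p).hilb hr, (hQ p).hilb_mem_HStratum hΔ ha.symm hr⟩
  have hF : Function.Bijective F := by
    constructor
    · intro p p' hp
      have h4 := eq_of_hilb_eq hr hΓ (hQ p) (hQ p') (congrArg Subtype.val hp)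
      funext i
      rw [← h2 p i, ← h2 p' i]
      refine Finset.sum_congr rfl fun k _ => Finset.sum_congr rfl fun r _ => ?_
      rw [congrFun (congrFun h4 r) k]
    · rintro ⟨I, hI⟩
      obtain ⟨Λ, hΛ, rfl⟩ := exists_hilb_eq hΔ ha.symm hr hI
      refine ⟨fun i => ∑ k ∈ Finset.Icc 1 K, ∑ r, P i k r • Λ r k, Subtype.ext (Subtype.ext ?_)⟩
      change C.famIdeal (natSet Δ) a _ = C.famIdeal (natSet Δ) a Λ
      congr 1
      funext r k
      exact h3 Λ ((hD.isSolution_iff_isFam hA' haD).2 hΛ) r k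
  refine isIsomorphic_hStratumCharts C Δ τ N r (fun I hI => ?_) (Equiv.ofBijective F hF)
    (fun f j => exists_eval_frameCoord hr Q hQ f j) fun i => ?_
  · obtain ⟨p, hp⟩ := hF.2 ⟨I, hI⟩
    have h4 : C.IsFrame r (F p).1 := (hQ p).isFrame hr
    rwa [hp] at h4
  -- The parameters are linear in the family, and the family is polynomial in the frame coordinates.
  · choose S hS using fun s k => exists_eval_eq hr hΓ s k
    refine ⟨∑ k ∈ Finset.Icc 1 K, ∑ r, P i k r • S r k, fun p => ?_⟩
    rw [← h2 p i]
    simp only [map_sum, MvPolynomial.smul_eval, smul_eq_mul]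
    refine Finset.sum_congr rfl fun k _ => Finset.sum_congr rfl fun s _ => ?_
    rw [hS s k _ (hQ p)]
    exact fun f => ((hQ p).isFrame hr).sub_sum_mem f

end GenericBranch

theorem mainTheorem2 (C : GenericBranch) (Δ : Set ℤ) (hΔ : C.IsNormalizedSemimodule Δ) (τ : ℕ) :
    ((C.HStratum Δ τ).Nonempty ↔ C.IsAdmissible Δ ∧ (τ : ℤ) - C.e Δ ∈ Δ) ∧
    (C.IsAdmissible Δ → (τ : ℤ) - C.e Δ ∈ Δ →
      ∃ N : ℕ, (N : ℤ) = C.dimOf Δ - ((GenericBranch.gaps Δ ((τ : ℤ) - C.e Δ)).ncard : ℤ) ∧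
        (ChartedSet.affineSpace N).IsIsomorphic (C.hStratumCharts Δ τ)) := by
  refine ⟨⟨GenericBranch.isAdmissible_of_nonempty hΔ, fun ⟨hA, hτ⟩ => ?_⟩,
    GenericBranch.exists_isIsomorphic hΔ⟩
  obtain ⟨N, -, e, -⟩ := GenericBranch.exists_isIsomorphic hΔ hA hτ
  exact ⟨_, (e 0).2⟩

end
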